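/- Let $d\ge 1$, $R\in(0,\infty]$ and $\Omega=\{x\in\mathbb{R}^d : |x|<R\}$ (so $\Omega=\mathbb{R}^d$ if $R=\infty$). Let $\nu>0$, $h_0>0$, $r>1$, $r'=\frac{r}{r-1}$, let $H(p)=\frac{h_0}{r'}|p|^{r'}$ for $p\in\mathbb{R}^d$, let $f\in C^1(\Omega\times[0,\infty))$, and put $\mu=\nu\left(\frac{\nu r}{h_0}\right)^{r-1}$. A triple $(u,m,\lambda)\in C^2(\Omega)\times W^{1,2}_{\mathrm{loc}}(\Omega)\times\mathbb{R}$ is called a solution of the Mean Field Games system if $m\ge 0$, $\int_\Omega m\,dx=1$, $$-\nu\Delta u(x)+H(Du(x))+\lambda=f(x,m(x))\qquad\text{for all } x\in\Omega$$ (for a representative of $m$), and $$\nu\int_\Omega Dm\cdot D\xi\,dx+\int_\Omega m\,DH(Du)\cdot D\xi\,dx=0\qquad\text{for all }\xi\in C_0^\infty(\Omega).$$ A couple $(\varphi,\lambda)\in\left(W^{1,r}_{\mathrm{loc}}(\Omega)\cap L^\infty_{\mathrm{loc}}(\Omega)\right)\times\mathbb{R}$ is called a solution of the $r$-Laplace problem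 if $\varphi>0$ a.e. in $\Omega$, $\int_\Omega\varphi^r\,dx=1$, and $$\mu\int_\Omega|D\varphi|^{r-2}D\varphi\cdot D\xi\,dx+\int_\Omega\left(f(x,\varphi^r)-\lambda\right)\varphi^{r-1}\xi\,dx=0\qquad\text{for all }\xi\in C_0^\infty(\Omega).$$ Such solutions are called radial if $u$ and $m$, respectively $\varphi$, depend only on $|x|$ (for $m$ and $\varphi$: up to a null set). Let $m\ge 0$ be a function on $\Omega$, $\varphi=m^{1/r}$ (almost everywhere in $\Omega$), and $\lambda\in\mathbb{R}$. Then there is a function $u$ such that $(u,m,\lambda)$ is a radial solution of the Mean Field Games system if and only if $(\varphi,\lambda)$ is a radial solution of the $r$-Laplace problem. -/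

import Mathlib

open MeasureTheory TopologicalSpace Set
open scoped ENNReal Distributions

noncomputable section

/-- The open set `{x ∈ ℝ^d : |x| < R}`, for `R ∈ [0, ∞]`; it is the whole space if `R = ∞`. -/
def openBall (d : ℕ) (R : ℝ≥0∞) : Opens (EuclideanSpace ℝ (Fin d)) where
  carrier := {x | ‖x‖ₑ < R}
  is_open' := isOpen_lt continuous_enorm continuous_const

/-- `v ∈ L^p_loc(Ω)`: `v` is in `L^p` on every compact subset of `Ω`. -/
def MemLpLoc {d : ℕ} {F : Type*} [NormedAddCommGroup F] (Ω : Opens (EuclideanSpace ℝ (Fin d)))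
    (p : ℝ≥0∞) (v : EuclideanSpace ℝ (Fin d) → F) : Prop :=
  ∀ K : Set (EuclideanSpace ℝ (Fin d)), IsCompact K → K ⊆ Ω → MemLp v p (volume.restrict K)

/-- `v ∈ W^{1,p}_loc(Ω)` (for `1 ≤ p`) and `G` is its weak gradient: both are in `L^p_loc(Ω)` and
`∫_Ω v Dξ = - ∫_Ω ξ G` for all test functions `ξ ∈ C_0^∞(Ω)`. -/
structure HasWeakGradientLoc {d : ℕ} (Ω : Opens (EuclideanSpace ℝ (Fin d))) (p : ℝ≥0∞)
    (v : EuclideanSpace ℝ (Fin d) → ℝ)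
    (G : EuclideanSpace ℝ (Fin d) → EuclideanSpace ℝ (Fin d)) : Prop where
  memLpLoc : MemLpLoc Ω p v
  memLpLoc_gradient : MemLpLoc Ω p G
  integral_eq : ∀ ξ : 𝓓(Ω, ℝ),
    ∫ x in (Ω : Set (EuclideanSpace ℝ (Fin d))), v x • gradient (⇑ξ) x =
      - ∫ x in (Ω : Set (EuclideanSpace ℝ (Fin d))), ξ x • G x

/-- The Hamiltonian `H(p) = (h₀ / r') |p|^{r'}`. -/
def powerHamiltonian (d : ℕ) (h₀ r' : ℝ) (p : EuclideanSpace ℝ (Fin d)) : ℝ :=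
  h₀ / r' * ‖p‖ ^ r'

/-- `(u, m, lam)` is a (local) solution of the stationary Mean Field Games system
`-ν Δu + H(Du) + lam = f(x, m)`, `-ν Δm - div(DH(Du) m) = 0`, `∫_Ω m = 1`, `m ≥ 0` in `Ω`:
`u ∈ C²(Ω)`, `m ∈ W^{1,2}_loc(Ω)`, the Hamilton-Jacobi-Bellman equation holds pointwise and the
Kolmogorov equation holds weakly. As `m` is a class of functions modulo null sets, the pointwise
equation is required of a nonnegative representative `m'` of `m`. -/
structure IsMFGSolution {d : ℕ} (Ω : Opens (EuclideanSpace ℝ (Fin d))) (ν : ℝ)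
    (H : EuclideanSpace ℝ (Fin d) → ℝ) (f : EuclideanSpace ℝ (Fin d) → ℝ → ℝ)
    (u m : EuclideanSpace ℝ (Fin d) → ℝ) (lam : ℝ) : Prop where
  contDiffOn : ContDiffOn ℝ 2 u Ω
  hjb : ∃ m' : EuclideanSpace ℝ (Fin d) → ℝ,
    (∀ᵐ x ∂volume.restrict (Ω : Set (EuclideanSpace ℝ (Fin d))), m' x = m x) ∧
    ∀ x ∈ Ω, 0 ≤ m' x ∧
      -ν * Laplacian.laplacian u x + H (gradient u x) + lam = f x (m' x)
  kolmogorov : ∃ Dm : EuclideanSpace ℝ (Fin d) → EuclideanSpace ℝ (Fin d),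
    HasWeakGradientLoc Ω 2 m Dm ∧
    ∀ ξ : 𝓓(Ω, ℝ),
      ν * (∫ x in (Ω : Set (EuclideanSpace ℝ (Fin d))), inner ℝ (Dm x) (gradient (⇑ξ) x)) +
        (∫ x in (Ω : Set (EuclideanSpace ℝ (Fin d))),
          m x * inner ℝ (gradient H (gradient u x)) (gradient (⇑ξ) x)) = 0
  integral_eq_one : ∫ x in (Ω : Set (EuclideanSpace ℝ (Fin d))), m x = 1

/-- `(φ, lam)` is a solution of the `r`-Laplace problem
`-μ Δ_r φ + (f(x, φ^r) - lam) φ^{r-1} = 0`, `∫_Ω φ^r = 1`, `φ > 0` in `Ω`: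
`φ ∈ W^{1,r}_loc(Ω) ∩ L^∞_loc(Ω)` and the equation holds weakly. -/
structure IsRLaplaceSolution {d : ℕ} (Ω : Opens (EuclideanSpace ℝ (Fin d))) (μ r : ℝ)
    (f : EuclideanSpace ℝ (Fin d) → ℝ → ℝ)
    (φ : EuclideanSpace ℝ (Fin d) → ℝ) (lam : ℝ) : Prop where
  pos : ∀ᵐ x ∂volume.restrict (Ω : Set (EuclideanSpace ℝ (Fin d))), 0 < φ x
  memLpLoc_top : MemLpLoc Ω ∞ φ
  equation : ∃ Dφ : EuclideanSpace ℝ (Fin d) → EuclideanSpace ℝ (Fin d),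
    HasWeakGradientLoc Ω (ENNReal.ofReal r) φ Dφ ∧
    ∀ ξ : 𝓓(Ω, ℝ),
      μ * (∫ x in (Ω : Set (EuclideanSpace ℝ (Fin d))),
          ‖Dφ x‖ ^ (r - 2) * inner ℝ (Dφ x) (gradient (⇑ξ) x)) +
        (∫ x in (Ω : Set (EuclideanSpace ℝ (Fin d))),
          (f x (φ x ^ r) - lam) * φ x ^ (r - 1) * ξ x) = 0
  integral_eq_one : ∫ x in (Ω : Set (EuclideanSpace ℝ (Fin d))), φ x ^ r = 1

/-- `v` is radial on `Ω`: `v(x)` depends only on `|x|`. -/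
def IsRadialOn {d : ℕ} (Ω : Opens (EuclideanSpace ℝ (Fin d)))
    (v : EuclideanSpace ℝ (Fin d) → ℝ) : Prop :=
  ∃ g : ℝ → ℝ, ∀ x ∈ Ω, v x = g ‖x‖

/-- `v` is radial on `Ω` as a class of functions modulo null sets. -/
def IsAERadialOn {d : ℕ} (Ω : Opens (EuclideanSpace ℝ (Fin d)))
    (v : EuclideanSpace ℝ (Fin d) → ℝ) : Prop :=
  ∃ g : ℝ → ℝ, ∀ᵐ x ∂volume.restrict (Ω : Set (EuclideanSpace ℝ (Fin d))), v x = g ‖x‖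

end

/-!
For radial solutions both systems are ordinary differential equations in `s = |x|`, and the
logarithmic transformation identifies them. Write `m = Φ^r`. A radial vector field that is
divergence free in a ball around the origin vanishes there, since its flux through every sphere
does. Hence the Kolmogorov equation says `ν Dm + m DH(Du) = 0`, which is `IsConjugatePair`:
`ν r DΦ = -h₀ Φ |Du|^{r'-2} Du`. Solved for `Du`, this reads
`μ |DΦ|^{r-2} DΦ = -ν Φ^{r-1} Du`, and taking the divergence gives
`μ Δ_r Φ = (H(Du) - ν Δu) Φ^{r-1}` (`IsConjugatePair.integral_flux`). So the
Hamilton-Jacobi-Bellman equation, multiplied by `Φ^{r-1}`, is the `r`-Laplace equation.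

The flux argument is `flux_eq_integral_of_weak_divergence`: tested with radial functions, a weak
equation `div V = F` for a radial field `V` determines the flux of `V` through the sphere of radius
`t` to be the integral of `F` over the ball of radius `t`. It is applied to functions whose weak
gradient is radial by `HasWeakGradientLoc.exists_profile`: a radial function in `W^{1,p}_loc` has a
profile that is locally absolutely continuous off the origin. From the system to the `r`-Laplace
problem this shows that `m` is a multiple of an exponential (`exists_density_eq_exp`), so `Φ` is
positive and `C¹`.

From the `r`-Laplace problem to the system, regularity has to be gained. The flux identity expresses
`|A'|^{r-2} A'`, for the profile `A` of `φ`, through an integral of bounded functions, so `A` is `C¹`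
on `[0, R)` (`IsRLaplaceSolution.exists_profile`, `hasDerivWithinAt_profile`), and it is positive by
a one-dimensional strong maximum principle (`pos_of_hasDerivWithinAt_profile`). The function `u` is
then defined by integrating the relation for `Du`. It is `C²` also at the origin and where `Du = 0`,
as `Du` is a `C¹` multiple of the flux field `|DΦ|^{r-2} DΦ`, which has the form `κ(|x|) x` with
`κ` a mean of continuous data (`fluxRatio`, `contDiffOn_comp_norm_smul`,
`exists_isConjugatePair`).
-/

local notation "𝔼" d:max => EuclideanSpace ℝ (Fin d)
local notation "𝕊" d:max => Metric.sphere (0 : EuclideanSpace ℝ (Fin d)) 1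

/-! ### Polar coordinates -/

/-- The surface measure on the unit sphere of `ℝ^d`. -/
noncomputable def sphereMeasure (d : ℕ) : Measure (𝕊 d) := (volume : Measure (𝔼 d)).toSphere

instance (d : ℕ) : IsFiniteMeasure (sphereMeasure d) := by
  unfold sphereMeasure; infer_instance

/-- The surface area of the unit sphere of `ℝ^d`. -/
noncomputable def sphereArea (d : ℕ) : ℝ := (sphereMeasure d).real univ

/-- The integral of `σ ↦ v (s σ)` over the unit sphere. -/
noncomputable def sphereIntegral {d : ℕ} (v : 𝔼 d → ℝ) (s : ℝ) : ℝ :=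
  ∫ σ : 𝕊 d, v (s • (σ : 𝔼 d)) ∂sphereMeasure d

/-- The integral of `v` over the sphere of radius `s`, that is, the radial density of `v` in
polar coordinates. -/
noncomputable def radialDensity {d : ℕ} (v : 𝔼 d → ℝ) (s : ℝ) : ℝ :=
  s ^ (d - 1) * sphereIntegral v s

section Polar

variable {d : ℕ}

lemma norm_smul_sphere {s : ℝ} (hs : 0 ≤ s) (σ : 𝕊 d) : ‖s • (σ : 𝔼 d)‖ = s := by
  simp [norm_smul, abs_of_nonneg hs]

lemma radialDensity_norm_mul (η : ℝ → ℝ) (v : 𝔼 d → ℝ) {s : ℝ} (hs : 0 ≤ s) :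
    radialDensity (fun x => η ‖x‖ * v x) s = η s * radialDensity v s := by
  simp only [radialDensity, sphereIntegral, norm_smul_sphere hs, integral_const_mul]
  ring

lemma radialDensity_norm (η : ℝ → ℝ) {s : ℝ} (hs : 0 ≤ s) :
    radialDensity (fun x : 𝔼 d => η ‖x‖) s = sphereArea d * s ^ (d - 1) * η s := by
  simp only [radialDensity, sphereIntegral, norm_smul_sphere hs, integral_const, sphereArea,
    smul_eq_mul]
  ring

variable [NeZero d]

lemma sphereMeasure_ne_zero : sphereMeasure d ≠ 0 := Measure.toSphere_ne_zero _

instance : (ae (sphereMeasure d)).NeBot := ae_neBot.2 sphereMeasure_ne_zero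

lemma sphereArea_pos : 0 < sphereArea d := by
  have : NeZero (sphereMeasure d) := ⟨sphereMeasure_ne_zero⟩
  exact measureReal_univ_pos

lemma measurePreserving_polar :
    MeasurePreserving (fun z : 𝕊 d × Ioi (0 : ℝ) => (z.2 : ℝ) • (z.1 : 𝔼 d))
      ((sphereMeasure d).prod (.volumeIoiPow (d - 1))) volume := by
  have h1 := ((volume : Measure (𝔼 d)).measurePreserving_homeomorphUnitSphereProd)
  have h2 : MeasurePreserving (Subtype.val : ({0}ᶜ : Set (𝔼 d)) → 𝔼 d)
      ((volume : Measure (𝔼 d)).comap (↑)) volume := by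
    refine ⟨measurable_subtype_coe, ?_⟩
    rw [(MeasurableEmbedding.subtype_coe (measurableSet_singleton _).compl).map_comap,
      Subtype.range_coe, restrict_compl_singleton]
  have h3 := h2.comp (MeasurePreserving.symm (homeomorphUnitSphereProd (𝔼 d)).toMeasurableEquiv h1)
  simpa [Function.comp_def, homeomorphUnitSphereProd, sphereMeasure] using! h3

lemma integral_volumeIoiPow (n : ℕ) (g : ℝ → ℝ) :
    ∫ s : Ioi (0 : ℝ), g s ∂Measure.volumeIoiPow n = ∫ s in Ioi (0 : ℝ), s ^ n * g s := by
  simp only [Measure.volumeIoiPow, ENNReal.ofReal]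
  rw [integral_withDensity_eq_integral_smul,
    integral_subtype_comap measurableSet_Ioi fun a ↦ Real.toNNReal (a ^ n) • g a,
    setIntegral_congr_fun measurableSet_Ioi fun x hx ↦ ?_]
  · simp only [NNReal.smul_def, Real.coe_toNNReal _ (pow_nonneg (le_of_lt hx) _), smul_eq_mul]
  · exact (measurable_subtype_coe.pow_const _).real_toNNReal

lemma integrable_volumeIoiPow {n : ℕ} {g : ℝ → ℝ} :
    Integrable (fun s : Ioi (0 : ℝ) => g s) (.volumeIoiPow n) ↔
      IntegrableOn (fun s => s ^ n * g s) (Ioi (0 : ℝ)) := by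
  rw [integrableOn_iff_comap_subtypeVal measurableSet_Ioi, Measure.volumeIoiPow,
    integrable_withDensity_iff_integrable_smul', integrable_congr]
  · refine .of_forall ?_
    rintro ⟨x, hx : 0 < x⟩
    simp (disch := positivity) [ENNReal.toReal_ofReal]
  · fun_prop
  · simp

lemma ae_volumeIoiPow {n : ℕ} {p : ℝ → Prop} (h : ∀ᵐ s : Ioi (0 : ℝ) ∂Measure.volumeIoiPow n, p s) :
    ∀ᵐ s ∂volume.restrict (Ioi (0 : ℝ)), p s := by
  rw [Measure.volumeIoiPow, ae_withDensity_iff (by fun_prop)] at h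
  rw [← map_comap_subtype_coe measurableSet_Ioi,
    (MeasurableEmbedding.subtype_coe measurableSet_Ioi).ae_map_iff]
  filter_upwards [h] with s hs
  exact hs (by simpa using pow_pos s.2 n)

lemma volumeIoiPow_absolutelyContinuous (n : ℕ) :
    Measure.volumeIoiPow n ≪ Measure.comap Subtype.val volume :=
  withDensity_absolutelyContinuous _ _

lemma ae_polar {p : 𝔼 d → Prop} (h : ∀ᵐ x, p x) :
    ∀ᵐ s ∂volume.restrict (Ioi (0 : ℝ)), ∀ᵐ σ : 𝕊 d ∂sphereMeasure d, p (s • (σ : 𝔼 d)) := by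
  have h1 := measurePreserving_polar.quasiMeasurePreserving.ae h
  have h2 := Measure.ae_ae_of_ae_prod (Measure.measurePreserving_swap.quasiMeasurePreserving.ae h1)
  exact ae_volumeIoiPow h2

lemma ae_of_ae_norm {p : ℝ → Prop} (h : ∀ᵐ x : 𝔼 d, p ‖x‖) :
    ∀ᵐ s ∂volume.restrict (Ioi (0 : ℝ)), p s := by
  filter_upwards [ae_polar h, ae_restrict_mem measurableSet_Ioi] with s hs hs0
  obtain ⟨σ, hσ⟩ := hs.exists
  rwa [norm_smul_sphere (le_of_lt hs0)] at hσ

lemma ae_norm_of_ae {p : ℝ → Prop} (h : ∀ᵐ s ∂volume.restrict (Ioi (0 : ℝ)), p s) :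
    ∀ᵐ x : 𝔼 d, p ‖x‖ := by
  obtain ⟨N, hN, hNm, hN0⟩ := exists_measurable_superset_of_null (ae_iff.1 h)
  have hN1 : ∀ᵐ s ∂volume.restrict (Ioi (0 : ℝ)), s ∉ N := measure_eq_zero_iff_ae_notMem.1 hN0
  have h2 : ∀ᵐ s : Ioi (0 : ℝ) ∂Measure.volumeIoiPow (d - 1), (s : ℝ) ∉ N := by
    rw [← map_comap_subtype_coe measurableSet_Ioi,
      (MeasurableEmbedding.subtype_coe measurableSet_Ioi).ae_map_iff] at hN1
    exact volumeIoiPow_absolutelyContinuous _ hN1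
  have h3 : ∀ᵐ z ∂((sphereMeasure d).prod (.volumeIoiPow (d - 1))), (z.2 : ℝ) ∉ N :=
    Measure.quasiMeasurePreserving_snd.ae h2
  have h4 : ∀ᵐ x : 𝔼 d, ‖x‖ ∉ N := by
    rw [← measurePreserving_polar.map_eq]
    refine (ae_map_iff measurePreserving_polar.aemeasurable (measurable_norm hNm.compl)).2 ?_
    filter_upwards [h3] with z hz
    rwa [norm_smul_sphere (le_of_lt z.2.2)]
  filter_upwards [h4] with x hx
  by_contra hp
  exact hx (hN hp)

lemma integrable_polar {f : 𝔼 d → ℝ} (hf : Integrable f) :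
    Integrable (fun z : 𝕊 d × Ioi (0 : ℝ) => f ((z.2 : ℝ) • (z.1 : 𝔼 d)))
      ((sphereMeasure d).prod (.volumeIoiPow (d - 1))) :=
  measurePreserving_polar.integrable_comp_of_integrable hf

lemma integrableOn_radialDensity {f : 𝔼 d → ℝ} (hf : Integrable f) :
    IntegrableOn (radialDensity f) (Ioi 0) :=
  integrable_volumeIoiPow.1 (integrable_polar hf).integral_prod_right

lemma integral_eq_integral_radialDensity {f : 𝔼 d → ℝ} (hf : Integrable f) :
    ∫ x, f x = ∫ s in Ioi 0, radialDensity f s := by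
  have h := integral_map (measurePreserving_polar (d := d)).aemeasurable
    (f := f) (by rw [measurePreserving_polar.map_eq]; exact hf.aestronglyMeasurable)
  rw [measurePreserving_polar.map_eq] at h
  rw [h, integral_prod_symm _ (integrable_polar hf)]
  exact integral_volumeIoiPow (d - 1) (fun s => sphereIntegral f s)

/-- Integration in polar coordinates, with a radial factor taken out. -/
lemma integral_norm_mul {η : ℝ → ℝ} {v : 𝔼 d → ℝ} (h : Integrable (fun x => η ‖x‖ * v x)) :
    ∫ x, η ‖x‖ * v x = ∫ s in Ioi 0, η s * radialDensity v s := by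
  rw [integral_eq_integral_radialDensity h]
  exact setIntegral_congr_fun measurableSet_Ioi fun s hs =>
    radialDensity_norm_mul η v (le_of_lt hs)

end Polar

/-! ### Primitives and weak derivatives on an interval -/

section OneDim

open scoped ContDiff

/-- Integration by parts for two absolutely continuous functions given as primitives. -/
lemma integral_mul_eq_sub_of_primitive {a b : ℝ} (hab : a ≤ b) {A B P D : ℝ → ℝ}
    (hB : IntervalIntegrable B volume a b) (hD : IntervalIntegrable D volume a b)
    (hA : ∀ s ∈ Icc a b, A s = A a + ∫ t in a..s, B t)
    (hP : ∀ s ∈ Icc a b, P s = P a + ∫ t in a..s, D t) :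
    ∫ s in a..b, A s * D s = A b * P b - A a * P a - ∫ s in a..b, B s * P s := by
  have key : ∀ {F G : ℝ → ℝ}, IntervalIntegrable G volume a b →
      (∀ s ∈ Icc a b, F s = F a + ∫ t in a..s, G t) →
      AbsolutelyContinuousOnInterval (fun s => F a + ∫ t in a..s, G t) a b ∧
      (∀ᵐ s, s ∈ uIcc a b → HasDerivAt (fun s => F a + ∫ t in a..s, G t) (G s) s) := by
    intro F G hG hF
    constructor
    · have h1 := hG.absolutelyContinuousOnInterval_intervalIntegral (c := a) (by simp)
      have h2 : AbsolutelyContinuousOnInterval (fun _ : ℝ => F a) a b :=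
        (LipschitzWith.const (F a)).lipschitzOnWith.absolutelyContinuousOnInterval
      exact h2.add h1
    · filter_upwards [hG.ae_hasDerivAt_integral] with s hs hs'
      exact (hs hs' a (by simp)).const_add (F a)
  obtain ⟨hA1, hA2⟩ := key hB hA
  obtain ⟨hP1, hP2⟩ := key hD hP
  have hI := hA1.integral_mul_deriv_eq_deriv_mul hP1
  rw [← hA b ⟨hab, le_rfl⟩, ← hP b ⟨hab, le_rfl⟩] at hI
  simp only [intervalIntegral.integral_same, add_zero] at hI
  rw [intervalIntegral.integral_congr_ae (g := fun s => (A a + ∫ t in a..s, B t) *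
      deriv (fun s => P a + ∫ t in a..s, D t) s), hI,
    intervalIntegral.integral_congr_ae (f := fun s => B s * P s)
      (g := fun s => deriv (fun s => A a + ∫ t in a..s, B t) s * (P a + ∫ t in a..s, D t))]
  · filter_upwards [hA2] with s hs hs'
    have hs1 := uIoc_subset_uIcc hs'
    rw [(hs hs1).deriv, hP s (by rwa [uIcc_of_le hab] at hs1)]
  · filter_upwards [hP2] with s hs hs'
    have hs1 := uIoc_subset_uIcc hs'
    rw [(hs hs1).deriv, hA s (by rwa [uIcc_of_le hab] at hs1)]

lemma exists_Ioo_superset_of_isCompact {I K : Set ℝ} (hI : IsOpen I) (hne : I.Nonempty)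
    (hK : IsCompact K) (hKI : K ⊆ I) : ∃ α ∈ I, ∃ β ∈ I, α < β ∧ K ⊆ Ioo α β := by
  obtain ⟨s₀, hs₀⟩ := hne
  have hK' : IsCompact (insert s₀ K) := hK.insert s₀
  have hsub : insert s₀ K ⊆ I := insert_subset hs₀ hKI
  obtain ⟨m, hm, hmin⟩ := hK'.exists_isLeast (insert_nonempty _ _)
  obtain ⟨M, hM, hmax⟩ := hK'.exists_isGreatest (insert_nonempty _ _)
  obtain ⟨ε, hε, hεI⟩ := Metric.isOpen_iff.1 hI m (hsub hm)
  obtain ⟨δ, hδ, hδI⟩ := Metric.isOpen_iff.1 hI M (hsub hM)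
  refine ⟨m - ε / 2, hεI ?_, M + δ / 2, hδI ?_, ?_, fun x hx => ⟨?_, ?_⟩⟩
  · rw [Metric.mem_ball, Real.dist_eq, abs_lt]; constructor <;> linarith
  · rw [Metric.mem_ball, Real.dist_eq, abs_lt]; constructor <;> linarith
  · have := hmin hM; linarith
  · have := hmin (mem_insert_of_mem _ hx); linarith
  · have := hmax (mem_insert_of_mem _ hx); linarith

lemma LocallyIntegrableOn.intervalIntegrable_of_mem {I : Set ℝ} (hoc : I.OrdConnected)
    {a : ℝ → ℝ} (ha : LocallyIntegrableOn a I) {s t : ℝ} (hs : s ∈ I) (ht : t ∈ I) :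
    IntervalIntegrable a volume s t :=
  (ha.integrableOn_compact_subset (hoc.uIcc_subset hs ht) isCompact_uIcc).intervalIntegrable

/-- An integral of a function with support in `(α, β)` as an interval integral. -/
lemma integral_eq_intervalIntegral_of_support {f : ℝ → ℝ} {α β : ℝ} (hαβ : α ≤ β)
    (hf : ∀ s ∉ Ioo α β, f s = 0) : ∫ s, f s = ∫ s in α..β, f s := by
  rw [intervalIntegral.integral_of_le hαβ, setIntegral_eq_integral_of_forall_compl_eq_zero]
  intro s hs
  exact hf s fun h => hs ⟨h.1, h.2.le⟩

lemma integrable_mul_of_support {X : Type*} [NormedAddCommGroup X] [MeasurableSpace X]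
    [BorelSpace X] {μ : Measure X} {I : Set X} {a ψ : X → ℝ}
    (ha : LocallyIntegrableOn a I μ) (hψ : Continuous ψ) (hc : HasCompactSupport ψ)
    (hs : tsupport ψ ⊆ I) : Integrable (fun s => a s * ψ s) μ := by
  have h1 : IntegrableOn a (tsupport ψ) μ := ha.integrableOn_compact_subset hs hc
  have h2 : IntegrableOn (fun s => a s * ψ s) (tsupport ψ) μ :=
    h1.mul_continuousOn hψ.continuousOn hc
  exact (integrableOn_iff_integrable_of_support_subset
    (fun s hs => subset_tsupport ψ fun h => hs (by simp [h]))).1 h2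

/-- The primitive of a smooth function with vanishing integral and support in `I` is again
smooth with compact support in `I`. -/
lemma exists_primitive_of_integral_eq_zero {I : Set ℝ} (hI : IsOpen I) (hoc : I.OrdConnected)
    (hne : I.Nonempty) {θ : ℝ → ℝ} (hθ : ContDiff ℝ ∞ θ) (hc : HasCompactSupport θ)
    (hs : tsupport θ ⊆ I) (h0 : ∫ s, θ s = 0) :
    ∃ ψ : ℝ → ℝ, ContDiff ℝ ∞ ψ ∧ HasCompactSupport ψ ∧ tsupport ψ ⊆ I ∧ deriv ψ = θ := by
  obtain ⟨α, hα, β, hβ, hαβ, hsub⟩ := exists_Ioo_superset_of_isCompact hI hne hc hs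
  have hout : ∀ s ∉ Ioo α β, θ s = 0 := fun s hs' =>
    image_eq_zero_of_notMem_tsupport fun h => hs' (hsub h)
  have hd : ∀ s, HasDerivAt (fun s => ∫ t in α..s, θ t) (θ s) s := fun s =>
    intervalIntegral.integral_hasDerivAt_right (hθ.continuous.intervalIntegrable _ _)
      (hθ.continuous.stronglyMeasurableAtFilter _ _) hθ.continuous.continuousAt
  have hderiv : deriv (fun s => ∫ t in α..s, θ t) = θ := funext fun s => (hd s).deriv
  have hz : ∀ s ∉ Icc α β, ∫ t in α..s, θ t = 0 := by
    intro s hs'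
    rcases lt_or_ge s α with h | h
    · rw [intervalIntegral.integral_symm, intervalIntegral.integral_zero_ae, neg_zero]
      refine .of_forall fun t ht => hout t fun h' => ?_
      rw [uIoc_of_le h.le] at ht
      exact absurd h'.1 (not_lt.2 ht.2)
    · have h' : β < s := by by_contra hh; exact hs' ⟨h, not_lt.1 hh⟩
      rw [← integral_eq_intervalIntegral_of_support h, h0]
      exact fun t ht => hout t fun h'' => ht ⟨h''.1, h''.2.trans h'⟩
  have hts : tsupport (fun s => ∫ t in α..s, θ t) ⊆ Icc α β := by
    refine closure_minimal (fun s hs' => ?_) isClosed_Icc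
    by_contra h
    exact hs' (hz s h)
  refine ⟨fun s => ∫ t in α..s, θ t, ?_, ?_, hts.trans (hoc.out hα hβ), hderiv⟩
  · rw [contDiff_infty_iff_deriv]
    exact ⟨fun s => (hd s).differentiableAt, by rw [hderiv]; exact hθ⟩
  · exact isCompact_Icc.of_isClosed_subset (isClosed_tsupport _) hts

lemma exists_smooth_integral_eq_one {I : Set ℝ} (hI : IsOpen I) (hne : I.Nonempty) :
    ∃ ρ : ℝ → ℝ, ContDiff ℝ ∞ ρ ∧ HasCompactSupport ρ ∧ tsupport ρ ⊆ I ∧ ∫ s, ρ s = 1 := by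
  obtain ⟨s₀, hs₀⟩ := hne
  obtain ⟨ε, hε, hεI⟩ := Metric.isOpen_iff.1 hI s₀ hs₀
  let b : ContDiffBump s₀ := ⟨ε / 4, ε / 2, by linarith, by linarith⟩
  refine ⟨b.normed volume, b.contDiff_normed, b.hasCompactSupport_normed, ?_, b.integral_normed⟩
  rw [b.tsupport_normed_eq]
  exact (Metric.closedBall_subset_ball (by simp only [b]; linarith)).trans hεI

/-- A locally integrable function on an interval whose weak derivative vanishes is constant. -/
lemma ae_eq_const_of_integral_mul_deriv_eq_zero {I : Set ℝ} (hI : IsOpen I)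
    (hoc : I.OrdConnected) (hne : I.Nonempty) {a : ℝ → ℝ} (ha : LocallyIntegrableOn a I)
    (h : ∀ ψ : ℝ → ℝ, ContDiff ℝ ∞ ψ → HasCompactSupport ψ → tsupport ψ ⊆ I →
      ∫ s, a s * deriv ψ s = 0) :
    ∃ c : ℝ, ∀ᵐ s, s ∈ I → a s = c := by
  obtain ⟨ρ, hρ, hρc, hρs, hρ1⟩ := exists_smooth_integral_eq_one hI hne
  refine ⟨∫ s, a s * ρ s, ?_⟩
  set c := ∫ s, a s * ρ s with hc
  have h1 : ∀ᵐ s, s ∈ I → a s - c = 0 := by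
    refine hI.ae_eq_zero_of_integral_contDiff_smul_eq_zero
      (ha.sub (continuous_const.continuousOn.locallyIntegrableOn hI.measurableSet)) ?_
    intro θ hθ hθc hθs
    -- `θ - (∫ θ) ρ` is the derivative of an admissible test function.
    have hmul : tsupport (fun s => (∫ t, θ t) * ρ s) ⊆ tsupport ρ :=
      closure_mono fun s hs h' => hs (by simp [h'])
    obtain ⟨ψ, hψ, hψc, hψs, hψd⟩ := exists_primitive_of_integral_eq_zero hI hoc hne
      (θ := fun s => θ s - (∫ t, θ t) * ρ s) (hθ.sub (contDiff_const.mul hρ))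
      (hθc.sub hρc.mul_left) ((tsupport_sub _ _).trans (union_subset hθs (hmul.trans hρs)))
      (by
        rw [integral_sub (hθ.continuous.integrable_of_hasCompactSupport hθc)
          ((hρ.continuous.integrable_of_hasCompactSupport hρc).const_mul _),
          integral_const_mul, hρ1, mul_one, sub_self])
    have h2 := h ψ hψ hψc hψs
    have haθ := integrable_mul_of_support ha hθ.continuous hθc hθs
    have haρ := integrable_mul_of_support ha hρ.continuous hρc hρs
    have e1 : ∀ s, a s * deriv ψ s = a s * θ s - (∫ t, θ t) * (a s * ρ s) := by
      intro s; rw [hψd]; ring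
    simp only [e1] at h2
    rw [integral_sub haθ (haρ.const_mul _), integral_const_mul] at h2
    have e2 : ∀ s, θ s • (a s - c) = a s * θ s - c * θ s := by intro s; simp; ring
    simp only [e2]
    rw [integral_sub haθ ((hθ.continuous.integrable_of_hasCompactSupport hθc).const_mul _),
      integral_const_mul]
    linarith
  filter_upwards [h1] with s hs hsI
  linarith [hs hsI]

lemma deriv_eq_zero_of_notMem_tsupport {ψ : ℝ → ℝ} {s : ℝ} (hs : s ∉ tsupport ψ) :
    deriv ψ s = 0 := by
  have : ψ =ᶠ[nhds s] fun _ => 0 := notMem_tsupport_iff_eventuallyEq.1 hs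
  rw [this.deriv_eq, deriv_const]

lemma continuousOn_primitive_of_mem {I : Set ℝ} (hI : IsOpen I) (hoc : I.OrdConnected)
    {b : ℝ → ℝ} (hb : LocallyIntegrableOn b I) {s₀ : ℝ} (hs₀ : s₀ ∈ I) :
    ContinuousOn (fun s => ∫ t in s₀..s, b t) I := by
  intro s hs
  obtain ⟨α, hα, β, hβ, hαβ, hsub⟩ := exists_Ioo_superset_of_isCompact hI ⟨s, hs⟩
    (isCompact_uIcc (a := s₀) (b := s)) (hoc.uIcc_subset hs₀ hs)
  have h1 := intervalIntegral.continuousOn_primitive_interval' (b₁ := α) (b₂ := β) (a := s₀)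
    (LocallyIntegrableOn.intervalIntegrable_of_mem hoc hb hα hβ) (by
      rw [uIcc_of_le hαβ.le]; exact Ioo_subset_Icc_self (hsub left_mem_uIcc))
  have h2 : s ∈ Ioo α β := hsub right_mem_uIcc
  exact (h1.continuousAt (by
    rw [uIcc_of_le hαβ.le]; exact Icc_mem_nhds h2.1 h2.2)).continuousWithinAt

/-- **Du Bois-Reymond**: a function with a locally integrable weak derivative `b` is, up to a
null set, a primitive of `b`. -/
lemma ae_eq_primitive_of_weak_deriv {I : Set ℝ} (hI : IsOpen I)
    (hoc : I.OrdConnected) {a b : ℝ → ℝ} (ha : LocallyIntegrableOn a I)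
    (hb : LocallyIntegrableOn b I) {s₀ : ℝ} (hs₀ : s₀ ∈ I)
    (h : ∀ ψ : ℝ → ℝ, ContDiff ℝ ∞ ψ → HasCompactSupport ψ → tsupport ψ ⊆ I →
      ∫ s, a s * deriv ψ s = - ∫ s, b s * ψ s) :
    ∃ c : ℝ, ∀ᵐ s, s ∈ I → a s = c + ∫ t in s₀..s, b t := by
  have hBc := continuousOn_primitive_of_mem hI hoc hb hs₀
  have hBl : LocallyIntegrableOn (fun s => ∫ t in s₀..s, b t) I :=
    hBc.locallyIntegrableOn hI.measurableSet
  obtain ⟨c, hc⟩ := ae_eq_const_of_integral_mul_deriv_eq_zero hI hoc ⟨s₀, hs₀⟩ (ha.sub hBl) (by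
    intro ψ hψ hψc hψs
    have hψ' : Continuous (deriv ψ) := (contDiff_infty_iff_deriv.1 hψ).2.continuous
    have hψc' : HasCompactSupport (deriv ψ) := hψc.deriv
    have hψs' : tsupport (deriv ψ) ⊆ I := (tsupport_deriv_subset).trans hψs
    have i1 := integrable_mul_of_support ha hψ' hψc' hψs'
    have i2 := integrable_mul_of_support hBl hψ' hψc' hψs'
    simp only [Pi.sub_apply, sub_mul]
    rw [integral_sub i1 i2, h ψ hψ hψc hψs]
    obtain ⟨α, hα, β, hβ, hαβ, hsub⟩ := exists_Ioo_superset_of_isCompact hI ⟨s₀, hs₀⟩ hψc hψs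
    have hout : ∀ s ∉ Ioo α β, ψ s = 0 := fun s hs' =>
      image_eq_zero_of_notMem_tsupport fun h => hs' (hsub h)
    have hout' : ∀ s ∉ Ioo α β, deriv ψ s = 0 := fun s hs' =>
      deriv_eq_zero_of_notMem_tsupport fun h => hs' (hsub h)
    have hint := fun {s t : ℝ} (hs : s ∈ I) (ht : t ∈ I) =>
      LocallyIntegrableOn.intervalIntegrable_of_mem hoc hb hs ht
    have hE := integral_mul_eq_sub_of_primitive hαβ.le (A := fun s => ∫ t in s₀..s, b t)
      (P := ψ) (hint hα hβ) (hψ'.intervalIntegrable α β)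
      (fun s hs => (intervalIntegral.integral_add_adjacent_intervals (hint hs₀ hα)
        (hint hα (hoc.out hα hβ hs))).symm)
      (fun s hs => by
        rw [intervalIntegral.integral_deriv_eq_sub
          (fun t _ => (hψ.differentiable (by simp)).differentiableAt)
          (hψ'.intervalIntegrable α s)]; ring)
    rw [integral_eq_intervalIntegral_of_support hαβ.le
        (f := fun s => (∫ t in s₀..s, b t) * deriv ψ s) (fun s hs => by simp [hout' s hs]), hE,
      hout α (by simp), hout β (by simp),
      ← integral_eq_intervalIntegral_of_support hαβ.le (f := fun s => b s * ψ s)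
        (fun s hs => by simp [hout s hs])]
    ring)
  refine ⟨c, ?_⟩
  filter_upwards [hc] with s hs hsI
  have := hs hsI
  simp only [Pi.sub_apply] at this
  linarith

end OneDim

/-! ### Radii, and the calculus of radial functions -/

section Radii

/-- The positive radii of spheres contained in `openBall d R`: the interval `(0, R)`. -/
def radii (R : ℝ≥0∞) : Set ℝ := {s | 0 < s ∧ ENNReal.ofReal s < R}

/-- The interval `[0, R)`, the range of `x ↦ |x|` on `openBall d R`. -/
def radii₀ (R : ℝ≥0∞) : Set ℝ := {s | 0 ≤ s ∧ ENNReal.ofReal s < R}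

variable {R : ℝ≥0∞}

lemma radii_subset_radii₀ : radii R ⊆ radii₀ R := fun _ hs => ⟨hs.1.le, hs.2⟩

lemma isOpen_radii : IsOpen (radii R) :=
  (isOpen_lt continuous_const continuous_id).inter
    (isOpen_lt ENNReal.continuous_ofReal continuous_const)

lemma measurableSet_radii : MeasurableSet (radii R) := isOpen_radii.measurableSet

lemma mem_radii_of_le {s t : ℝ} (hs : 0 < s) (hst : s ≤ t) (ht : ENNReal.ofReal t < R) :
    s ∈ radii R := ⟨hs, (ENNReal.ofReal_le_ofReal hst).trans_lt ht⟩

lemma mem_radii₀_of_le {s t : ℝ} (hs : 0 ≤ s) (hst : s ≤ t) (ht : ENNReal.ofReal t < R) :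
    s ∈ radii₀ R := ⟨hs, (ENNReal.ofReal_le_ofReal hst).trans_lt ht⟩

lemma ordConnected_radii : (radii R).OrdConnected :=
  ⟨fun _ hs _ ht _ hu => mem_radii_of_le (hs.1.trans_le hu.1) hu.2 ht.2⟩

lemma ordConnected_radii₀ : (radii₀ R).OrdConnected :=
  ⟨fun _ hs _ ht _ hu => mem_radii₀_of_le (hs.1.trans hu.1) hu.2 ht.2⟩

lemma exists_gt_mem_radii {s : ℝ} (hs : s ∈ radii₀ R) : ∃ t ∈ radii R, s < t := by
  have h : ∀ᶠ t in nhdsWithin s (Ioi s), ENNReal.ofReal t < R :=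
    nhdsWithin_le_nhds (ENNReal.continuous_ofReal.continuousAt.eventually_lt_const hs.2)
  obtain ⟨t, ht, hst⟩ := (h.and self_mem_nhdsWithin).exists
  exact ⟨t, ⟨hs.1.trans_lt hst, ht⟩, hst⟩

lemma zero_mem_radii₀ (hR : 0 < R) : (0 : ℝ) ∈ radii₀ R := ⟨le_rfl, by simpa⟩

lemma nonempty_radii (hR : 0 < R) : (radii R).Nonempty := by
  obtain ⟨t, ht, -⟩ := exists_gt_mem_radii (zero_mem_radii₀ hR)
  exact ⟨t, ht⟩

variable {d : ℕ}

lemma mem_openBall_iff {x : 𝔼 d} : x ∈ openBall d R ↔ ‖x‖ ∈ radii₀ R := by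
  change ‖x‖ₑ < R ↔ _
  rw [← ofReal_norm]
  exact ⟨fun h => ⟨norm_nonneg _, h⟩, fun h => h.2⟩

lemma mem_openBall_iff_of_ne {x : 𝔼 d} (hx : x ≠ 0) : x ∈ openBall d R ↔ ‖x‖ ∈ radii R := by
  rw [mem_openBall_iff]
  exact ⟨fun h => ⟨norm_pos_iff.2 hx, h.2⟩, fun h => radii_subset_radii₀ h⟩

lemma isOpen_openBall : IsOpen (openBall d R : Set (𝔼 d)) := (openBall d R).isOpen

lemma measurableSet_openBall : MeasurableSet (openBall d R : Set (𝔼 d)) :=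
  isOpen_openBall.measurableSet

lemma closedBall_subset_openBall {ρ : ℝ} (hρ : ρ ∈ radii R) :
    Metric.closedBall (0 : 𝔼 d) ρ ⊆ openBall d R := fun x hx => by
  rw [mem_closedBall_zero_iff] at hx
  exact mem_openBall_iff.2 (mem_radii₀_of_le (norm_nonneg _) hx hρ.2)

lemma exists_ball_superset (hR : 0 < R) {K : Set (𝔼 d)} (hK : IsCompact K)
    (hKΩ : K ⊆ openBall d R) : ∃ ρ ∈ radii R, K ⊆ Metric.ball 0 ρ := by
  obtain ⟨m, hm, hmax⟩ := (hK.insert 0).exists_isMaxOn (insert_nonempty _ _)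
    continuous_norm.continuousOn
  have hmΩ : m ∈ openBall d R := by
    rcases hm with rfl | hm
    · rw [mem_openBall_iff, norm_zero]; exact zero_mem_radii₀ hR
    · exact hKΩ hm
  obtain ⟨t, ht, hmt⟩ := exists_gt_mem_radii (mem_openBall_iff.1 hmΩ)
  refine ⟨t, ht, fun x hx => ?_⟩
  rw [mem_ball_zero_iff]
  exact (hmax (mem_insert_of_mem _ hx)).trans_lt hmt

variable [NeZero d]

lemma ae_radii_of_ae_norm {p : ℝ → Prop} (h : ∀ᵐ x : 𝔼 d, x ∈ openBall d R → p ‖x‖) :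
    ∀ᵐ s, s ∈ radii R → p s := by
  have h1 := ae_of_ae_norm (d := d) (p := fun s => s ∈ radii₀ R → p s) (by
    filter_upwards [h] with x hx hx'
    exact hx (mem_openBall_iff.2 hx'))
  rw [ae_restrict_iff' measurableSet_Ioi] at h1
  filter_upwards [h1] with s hs hs'
  exact hs hs'.1 (radii_subset_radii₀ hs')

lemma ae_norm_of_ae_radii {p : ℝ → Prop} (h : ∀ᵐ s, s ∈ radii R → p s) :
    ∀ᵐ x : 𝔼 d, x ∈ openBall d R → p ‖x‖ := by
  have h1 := ae_norm_of_ae (d := d) (p := fun s => s ∈ radii R → p s) (ae_restrict_of_ae h)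
  have h2 : ∀ᵐ x : 𝔼 d, x ≠ 0 := by simp [ae_iff]
  filter_upwards [h1, h2] with x hx hx0 hxΩ
  exact hx ((mem_openBall_iff_of_ne hx0).1 hxΩ)

lemma sphereIntegral_congr_ae_radii {v w : 𝔼 d → ℝ} (h : ∀ᵐ x, x ∈ openBall d R → v x = w x) :
    ∀ᵐ s, s ∈ radii R → sphereIntegral v s = sphereIntegral w s := by
  have h1 := ae_polar h
  rw [ae_restrict_iff' measurableSet_Ioi] at h1
  filter_upwards [h1] with s hs hs'
  refine integral_congr_ae ?_
  filter_upwards [hs hs'.1] with σ hσ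
  refine hσ (mem_openBall_iff.2 ?_)
  rw [norm_smul_sphere hs'.1.le]
  exact radii_subset_radii₀ hs'

lemma integrableOn_radialDensity_Ioc {v : 𝔼 d → ℝ}
    (hv : LocallyIntegrableOn v (openBall d R : Set (𝔼 d))) {ρ : ℝ} (hρ : ρ ∈ radii R) :
    IntegrableOn (radialDensity v) (Ioc 0 ρ) := by
  have h1 : IntegrableOn v (Metric.closedBall 0 ρ) :=
    hv.integrableOn_compact_subset (closedBall_subset_openBall hρ) (isCompact_closedBall _ _)
  have h2 := integrableOn_radialDensity (h1.integrable_indicator measurableSet_closedBall)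
  refine (h2.mono_set Ioc_subset_Ioi_self).congr_fun (fun s hs => ?_) measurableSet_Ioc
  simp only [radialDensity, sphereIntegral]
  congr 1
  refine integral_congr_ae (.of_forall fun σ => indicator_of_mem ?_ _)
  rw [mem_closedBall_zero_iff, norm_smul_sphere hs.1.le]
  exact hs.2

lemma intervalIntegrable_radialDensity {v : 𝔼 d → ℝ}
    (hv : LocallyIntegrableOn v (openBall d R : Set (𝔼 d))) {ρ : ℝ} (hρ : ρ ∈ radii R) :
    IntervalIntegrable (radialDensity v) volume 0 ρ :=
  (intervalIntegrable_iff_integrableOn_Ioc_of_le hρ.1.le).2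
    (integrableOn_radialDensity_Ioc hv hρ)

lemma locallyIntegrableOn_radialDensity {v : 𝔼 d → ℝ}
    (hv : LocallyIntegrableOn v (openBall d R : Set (𝔼 d))) :
    LocallyIntegrableOn (radialDensity v) (radii R) := by
  refine (locallyIntegrableOn_iff isOpen_radii.isLocallyClosed).2 fun K hK hKc => ?_
  rcases K.eq_empty_or_nonempty with rfl | hne
  · simp
  obtain ⟨α, -, β, hβ, -, hsub⟩ := exists_Ioo_superset_of_isCompact isOpen_radii
    (hne.mono hK) hKc hK
  exact (integrableOn_radialDensity_Ioc hv hβ).mono_set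
    fun s hs => ⟨(hK hs).1, (hsub hs).2.le⟩

lemma locallyIntegrableOn_sphereIntegral {v : 𝔼 d → ℝ}
    (hv : LocallyIntegrableOn v (openBall d R : Set (𝔼 d))) :
    LocallyIntegrableOn (sphereIntegral v) (radii R) := by
  have h := (locallyIntegrableOn_radialDensity hv).continuousOn_mul
    (g := fun s : ℝ => (s ^ (d - 1))⁻¹) (by
      refine ContinuousOn.inv₀ (by fun_prop) fun s hs => (pow_pos hs.1 _).ne') isOpen_radii.isLocallyClosed
  refine h.congr ?_
  filter_upwards [ae_restrict_mem measurableSet_radii] with s hs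
  have := (pow_pos hs.1 (d - 1)).ne'
  simp only [radialDensity]
  field_simp

end Radii

section RadialCalculus

open scoped ContDiff Gradient Asymptotics

variable {E : Type*} [NormedAddCommGroup E] [InnerProductSpace ℝ E]

lemma norm_div_norm_smul {c : ℝ} {x : E} (h : x = 0 → c = 0) : ‖(c / ‖x‖) • x‖ = |c| := by
  rcases eq_or_ne x 0 with rfl | hx
  · simp [h rfl]
  · have : ‖x‖ ≠ 0 := norm_ne_zero_iff.2 hx
    rw [norm_smul, norm_div, norm_norm, div_mul_cancel₀ _ this, Real.norm_eq_abs]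

lemma continuousOn_div_norm_smul {R : ℝ≥0∞} {s : Set E} (hs : ∀ x ∈ s, ‖x‖ ∈ radii₀ R)
    {k : ℝ → ℝ} (hk : ContinuousOn k (radii₀ R)) (h0 : k 0 = 0) :
    ContinuousOn (fun x : E => (k ‖x‖ / ‖x‖) • x) s := by
  have hkn : ContinuousOn (fun x : E => k ‖x‖) s := hk.comp continuous_norm.continuousOn hs
  intro x hx
  rcases eq_or_ne x 0 with rfl | hx0
  · have h1 := hkn 0 hx
    rw [ContinuousWithinAt, norm_zero, h0] at h1
    rw [ContinuousWithinAt, smul_zero, tendsto_zero_iff_norm_tendsto_zero]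
    have h2 : ∀ y : E, ‖(k ‖y‖ / ‖y‖) • y‖ = |k ‖y‖| := fun y =>
      norm_div_norm_smul fun hy => by rw [hy, norm_zero, h0]
    simpa [h2] using h1.abs
  · exact ((hkn x hx).div continuous_norm.continuousWithinAt (norm_ne_zero_iff.2 hx0)).smul
      continuousWithinAt_id

variable [CompleteSpace E]

lemma hasGradientAt_norm {x : E} (hx : x ≠ 0) : HasGradientAt norm (‖x‖⁻¹ • x) x := by
  have h1 := (hasStrictFDerivAt_norm_sq x).hasFDerivAt.sqrt (by positivity)
  have h2 : (fun y : E => √(‖y‖ ^ 2)) = norm := funext fun y => Real.sqrt_sq (norm_nonneg y)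
  rw [h2, Real.sqrt_sq (norm_nonneg x)] at h1
  refine h1.congr_fderiv ?_
  ext y
  simp
  ring

/-- The gradient of a radial function off the origin. -/
lemma HasDerivAt.hasGradientAt_comp_norm {h : ℝ → ℝ} {h' : ℝ} {x : E} (hx : x ≠ 0)
    (hh : HasDerivAt h h' ‖x‖) : HasGradientAt (fun y => h ‖y‖) ((h' / ‖x‖) • x) x := by
  have h1 := hh.comp_hasFDerivAt x (hasGradientAt_norm hx).hasFDerivAt
  refine h1.congr_fderiv ?_
  ext y
  simp [div_eq_mul_inv, mul_assoc]

/-- A radial function is differentiable at the origin if its profile has derivative zero there. -/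
lemma HasDerivWithinAt.hasGradientAt_comp_norm_zero {h : ℝ → ℝ}
    (hh : HasDerivWithinAt h 0 (Ici 0) 0) : HasGradientAt (fun y : E => h ‖y‖) 0 0 := by
  rw [hasGradientAt_iff_isLittleO]
  have h1 := hasDerivWithinAt_iff_isLittleO.1 hh
  have h2 : Filter.Tendsto (fun x : E => ‖x‖) (nhds 0) (nhdsWithin 0 (Ici 0)) := by
    refine tendsto_nhdsWithin_iff.2 ⟨?_, .of_forall fun x => norm_nonneg x⟩
    simpa using (continuous_norm (E := E)).tendsto 0
  have h3 := h1.comp_tendsto h2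
  have h4 : (fun x : E => h ‖x‖ - h 0) =o[nhds 0] fun x => ‖x‖ := by
    simpa [Function.comp_def] using h3
  simpa using Asymptotics.isLittleO_norm_right.1 h4

/-- The gradient of a radial function with `C¹` profile on `[0, R)`. -/
lemma hasGradientAt_comp_norm {h h' : ℝ → ℝ} {x : E} (h0 : h' 0 = 0)
    (hh : HasDerivWithinAt h (h' ‖x‖) (Ici 0) ‖x‖) :
    HasGradientAt (fun y => h ‖y‖) ((h' ‖x‖ / ‖x‖) • x) x := by
  rcases eq_or_ne x 0 with rfl | hx
  · simp only [norm_zero, h0] at hh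
    simpa using hh.hasGradientAt_comp_norm_zero (E := E)
  · exact (hh.hasDerivAt (Ici_mem_nhds (norm_pos_iff.2 hx))).hasGradientAt_comp_norm hx

/-- The profile derivative of a differentiable radial function. -/
lemma exists_gradient_eq_of_radial {d : ℕ} [NeZero d] {R : ℝ≥0∞} (hR : 0 < R) {u : 𝔼 d → ℝ}
    (hu : IsRadialOn (openBall d R) u)
    (hd : ∀ x ∈ openBall d R, DifferentiableAt ℝ u x)
    (hc : ContinuousOn (∇ u) (openBall d R : Set (𝔼 d))) :
    ∃ k : ℝ → ℝ, ContinuousOn k (radii₀ R) ∧ k 0 = 0 ∧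
      ∀ x ∈ openBall d R, ∇ u x = (k ‖x‖ / ‖x‖) • x := by
  obtain ⟨g, hg⟩ := hu
  obtain ⟨e, he⟩ : ∃ e : 𝔼 d, ‖e‖ = 1 := exists_norm_eq _ zero_le_one
  have hse : ∀ s : ℝ, ‖s • e‖ = |s| := fun s => by simp [norm_smul, he]
  have hmem : ∀ s : ℝ, |s| ∈ radii₀ R → s • e ∈ openBall d R := fun s hs => by
    rw [mem_openBall_iff, hse]; exact hs
  set k : ℝ → ℝ := fun s => inner ℝ (∇ u (s • e)) e with hk
  have hder : ∀ s : ℝ, |s| ∈ radii₀ R → HasDerivAt (fun t : ℝ => u (t • e)) (k s) s := by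
    intro s hs
    have h1 := (hd _ (hmem s hs)).hasGradientAt.hasFDerivAt
    have h2 : HasDerivAt (fun t : ℝ => t • e) ((1 : ℝ) • e) s := (hasDerivAt_id s).smul_const e
    have h3 := h1.comp_hasDerivAt s h2
    simpa [Function.comp_def, hk] using h3
  have hug : ∀ x ∈ openBall d R, u x = u (‖x‖ • e) := by
    intro x hx
    rw [hg x hx, hg _ (hmem _ (by simpa using mem_openBall_iff.1 hx)), hse, abs_norm]
  have h0mem : (0 : 𝔼 d) ∈ openBall d R := by
    rw [mem_openBall_iff, norm_zero]; exact zero_mem_radii₀ hR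
  have hk0 : k 0 = 0 := by
    -- The profile `s ↦ u (s e)` is even.
    have h1 := hder 0 (by simpa using zero_mem_radii₀ hR)
    have h2 : HasDerivAt (fun t : ℝ => u ((-t) • e)) (k 0 * -1) 0 := by
      have h1' : HasDerivAt (fun t : ℝ => u (t • e)) (k 0) (-0) := by simpa using h1
      exact h1'.comp (0 : ℝ) (hasDerivAt_neg 0)
    have h3 : (fun t : ℝ => u ((-t) • e)) =ᶠ[nhds 0] fun t => u (t • e) := by
      have hc : ∀ᶠ t : ℝ in nhds 0, t • e ∈ openBall d R := by
        have : Filter.Tendsto (fun t : ℝ => t • e) (nhds 0) (nhds 0) := by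
          have hcont : Continuous fun t : ℝ => t • e := by fun_prop
          simpa using hcont.tendsto 0
        exact this (isOpen_openBall.mem_nhds h0mem)
      filter_upwards [hc] with t ht
      have ht' : (-t) • e ∈ openBall d R := by
        rw [mem_openBall_iff, hse, abs_neg, ← hse]; exact mem_openBall_iff.1 ht
      rw [hg _ ht', hg _ ht, hse, hse, abs_neg]
    have := h1.unique (h2.congr_of_eventuallyEq h3.symm)
    linarith
  refine ⟨k, ?_, hk0, fun x hx => ?_⟩
  · have h1 : ContinuousOn (fun s : ℝ => ∇ u (s • e)) (radii₀ R) :=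
      hc.comp (by fun_prop) fun s hs => hmem s (by rwa [abs_of_nonneg hs.1])
    exact h1.inner continuousOn_const
  · have hx' := mem_openBall_iff.1 hx
    have h1 : HasGradientAt (fun y : 𝔼 d => u (‖y‖ • e)) ((k ‖x‖ / ‖x‖) • x) x :=
      hasGradientAt_comp_norm (h := fun s => u (s • e)) hk0
        (hder ‖x‖ (by simpa using hx')).hasDerivWithinAt
    refine (h1.congr_of_eventuallyEq ?_).gradient
    filter_upwards [isOpen_openBall.mem_nhds hx] with y hy
    exact hug y hy

end RadialCalculus

/-! ### Weak gradients and radial divergence-form equations -/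

section WeakGradient

open scoped ContDiff Gradient

variable {d : ℕ} {Ω : Opens (EuclideanSpace ℝ (Fin d))}

lemma MemLpLoc.locallyIntegrableOn {F : Type*} [NormedAddCommGroup F] {p : ℝ≥0∞} {v : 𝔼 d → F}
    (hv : MemLpLoc Ω p v) (hp : 1 ≤ p) : LocallyIntegrableOn v (Ω : Set (𝔼 d)) := by
  refine (locallyIntegrableOn_iff Ω.isOpen.isLocallyClosed).2 fun K hK hKc => ?_
  have : IsFiniteMeasure (volume.restrict K) := ⟨by simpa using hKc.measure_lt_top⟩
  exact (hv K hKc hK).integrable hp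

lemma ContinuousOn.memLpLoc {F : Type*} [NormedAddCommGroup F] (p : ℝ≥0∞)
    {v : 𝔼 d → F} (hv : ContinuousOn v (Ω : Set (𝔼 d))) : MemLpLoc Ω p v := by
  intro K hKc hK
  have : IsFiniteMeasure (volume.restrict K) := ⟨by simpa using hKc.measure_lt_top⟩
  obtain ⟨C, hC⟩ := hKc.exists_bound_of_continuousOn (hv.mono hK)
  refine MemLp.of_bound ((hv.mono hK).aestronglyMeasurable_of_isCompact hKc hKc.measurableSet) C ?_
  exact (ae_restrict_mem hKc.measurableSet).mono fun x hx => hC x hx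

lemma MemLpLoc.congr {F : Type*} [NormedAddCommGroup F] {p : ℝ≥0∞} {v w : 𝔼 d → F}
    (hv : MemLpLoc Ω p v) (h : ∀ᵐ x ∂volume.restrict (Ω : Set (𝔼 d)), v x = w x) :
    MemLpLoc Ω p w := fun K hKc hK =>
  (hv K hKc hK).ae_eq (ae_mono (Measure.restrict_mono hK le_rfl) h)

lemma fderiv_eq_zero_of_notMem_tsupport {ξ : 𝔼 d → ℝ} {x : 𝔼 d} (hx : x ∉ tsupport ξ) :
    fderiv ℝ ξ x = 0 := by
  have : ξ =ᶠ[nhds x] fun _ => 0 := notMem_tsupport_iff_eventuallyEq.1 hx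
  rw [this.fderiv_eq, fderiv_fun_const, Pi.zero_apply]

lemma continuous_fderiv_apply {ξ : 𝔼 d → ℝ} (hξ : ContDiff ℝ ∞ ξ) (e : 𝔼 d) :
    Continuous fun x => fderiv ℝ ξ x e :=
  (hξ.continuous_fderiv (by simp)).clm_apply continuous_const

/-- Integration by parts of a `C¹` function against a test function. -/
lemma integral_mul_fderiv_eq_neg_of_hasGradientAt {v : 𝔼 d → ℝ} {g : 𝔼 d → 𝔼 d}
    (hv : ∀ x ∈ Ω, HasGradientAt v (g x) x) (hg : ContinuousOn g (Ω : Set (𝔼 d)))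
    {ξ : 𝔼 d → ℝ} (hξ : ContDiff ℝ ∞ ξ) (hc : HasCompactSupport ξ)
    (hs : tsupport ξ ⊆ Ω) (e : 𝔼 d) :
    ∫ x, v x * fderiv ℝ ξ x e = - ∫ x, inner ℝ (g x) e * ξ x := by
  have hvc : ContinuousOn v (Ω : Set (𝔼 d)) := fun x hx =>
    (hv x hx).continuousAt.continuousWithinAt
  have hvl := hvc.locallyIntegrableOn (μ := volume) Ω.isOpen.measurableSet
  have hgc : ContinuousOn (fun x => inner ℝ (g x) e) (Ω : Set (𝔼 d)) :=
    hg.inner continuousOn_const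
  have hgl := hgc.locallyIntegrableOn (μ := volume) Ω.isOpen.measurableSet
  have e1 : ∀ x, inner ℝ (g x) e * ξ x = fderiv ℝ v x e * ξ x := by
    intro x
    by_cases hx : x ∈ tsupport ξ
    · rw [(hv x (hs hx)).fderiv_apply]
    · simp [image_eq_zero_of_notMem_tsupport hx]
  have i1 := integrable_mul_of_support hgl hξ.continuous hc hs
  simp only [e1] at i1 ⊢
  exact integral_mul_fderiv_eq_neg_fderiv_mul_of_integrable i1
    (integrable_mul_of_support hvl (continuous_fderiv_apply hξ e)
      (hc.fderiv_apply ℝ e) ((tsupport_fderiv_apply_subset ℝ e).trans hs))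
    (integrable_mul_of_support hvl hξ.continuous hc hs)
    (fun x hx => (hv x (hs hx)).hasFDerivAt.differentiableAt)
    (fun x _ => (hξ.differentiable (by simp)).differentiableAt)

lemma setIntegral_eq_of_tsupport {F : Type*} [NormedAddCommGroup F] [NormedSpace ℝ F]
    {f : 𝔼 d → F} (hf : ∀ x ∉ Ω, f x = 0) : ∫ x in (Ω : Set (𝔼 d)), f x = ∫ x, f x :=
  setIntegral_eq_integral_of_forall_compl_eq_zero hf

lemma gradient_eq_zero_of_notMem_tsupport {ξ : 𝔼 d → ℝ} {x : 𝔼 d} (hx : x ∉ tsupport ξ) :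
    ∇ ξ x = 0 := by
  rw [gradient, fderiv_eq_zero_of_notMem_tsupport hx, map_zero]

lemma continuous_gradient {ξ : 𝔼 d → ℝ} (hξ : ContDiff ℝ ∞ ξ) : Continuous (∇ ξ) :=
  (LinearIsometryEquiv.continuous _).comp (hξ.continuous_fderiv (by simp))

lemma integrable_smul_of_support {v : 𝔼 d → ℝ} {G : 𝔼 d → 𝔼 d} {K : Set (𝔼 d)}
    (h : IntegrableOn (fun x => v x • G x) K) (h0 : ∀ x ∉ K, v x • G x = 0) :
    Integrable (fun x => v x • G x) :=
  (integrableOn_iff_integrable_of_support_subset fun x hx => by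
    by_contra hK; exact hx (h0 x hK)).1 h

lemma inner_setIntegral_smul_gradient {v : 𝔼 d → ℝ} (hv : LocallyIntegrableOn v (Ω : Set (𝔼 d)))
    {ξ : 𝔼 d → ℝ} (hξ : ContDiff ℝ ∞ ξ) (hc : HasCompactSupport ξ) (hs : tsupport ξ ⊆ Ω)
    (e : 𝔼 d) :
    inner ℝ e (∫ x in (Ω : Set (𝔼 d)), v x • ∇ ξ x) = ∫ x, v x * fderiv ℝ ξ x e := by
  have hout : ∀ x ∉ tsupport ξ, v x • ∇ ξ x = 0 := fun x hx => by
    rw [gradient_eq_zero_of_notMem_tsupport hx, smul_zero]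
  rw [setIntegral_eq_of_tsupport fun x hx => hout x fun h => hx (hs h), ← integral_inner]
  · simp [inner_smul_right, inner_gradient_right]
  · exact integrable_smul_of_support ((hv.integrableOn_compact_subset hs hc).smul_continuousOn
      (continuous_gradient hξ).continuousOn hc) hout

lemma inner_setIntegral_smul {G : 𝔼 d → 𝔼 d} (hG : LocallyIntegrableOn G (Ω : Set (𝔼 d)))
    {ξ : 𝔼 d → ℝ} (hξ : Continuous ξ) (hc : HasCompactSupport ξ) (hs : tsupport ξ ⊆ Ω)
    (e : 𝔼 d) :
    inner ℝ e (∫ x in (Ω : Set (𝔼 d)), ξ x • G x) = ∫ x, inner ℝ (G x) e * ξ x := by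
  have hout : ∀ x ∉ tsupport ξ, ξ x • G x = 0 := fun x hx => by
    rw [image_eq_zero_of_notMem_tsupport hx, zero_smul]
  rw [setIntegral_eq_of_tsupport fun x hx => hout x fun h => hx (hs h), ← integral_inner]
  · simp only [inner_smul_right, real_inner_comm, mul_comm]
  · exact integrable_smul_of_support ((hG.integrableOn_compact_subset hs hc).continuousOn_smul
      hξ.continuousOn hc) hout

/-- Pairing with a fixed vector turns the identity defining the weak gradient into scalar ones. -/
lemma HasWeakGradientLoc.integral_mul_fderiv {p : ℝ≥0∞} (hp : 1 ≤ p) {v : 𝔼 d → ℝ}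
    {G : 𝔼 d → 𝔼 d} (h : HasWeakGradientLoc Ω p v G) {ξ : 𝔼 d → ℝ} (hξ : ContDiff ℝ ∞ ξ)
    (hc : HasCompactSupport ξ) (hs : tsupport ξ ⊆ Ω) (e : 𝔼 d) :
    ∫ x, v x * fderiv ℝ ξ x e = - ∫ x, inner ℝ (G x) e * ξ x := by
  rw [← inner_setIntegral_smul_gradient (h.memLpLoc.locallyIntegrableOn hp) hξ hc hs,
    ← inner_setIntegral_smul (h.memLpLoc_gradient.locallyIntegrableOn hp) hξ.continuous hc hs,
    ← inner_neg_right]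
  exact congrArg (inner ℝ e) (h.integral_eq ⟨ξ, hξ, hc, hs⟩)

/-- The classical gradient of a `C¹` function is its weak gradient. -/
lemma hasWeakGradientLoc_of_hasGradientAt (p : ℝ≥0∞) {v : 𝔼 d → ℝ}
    {g : 𝔼 d → 𝔼 d} (hv : ∀ x ∈ Ω, HasGradientAt v (g x) x)
    (hg : ContinuousOn g (Ω : Set (𝔼 d))) : HasWeakGradientLoc Ω p v g := by
  have hvc : ContinuousOn v (Ω : Set (𝔼 d)) := fun x hx =>
    (hv x hx).continuousAt.continuousWithinAt
  refine ⟨hvc.memLpLoc p, hg.memLpLoc p, fun ξ => ext_inner_left ℝ fun e => ?_⟩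
  rw [inner_neg_right, inner_setIntegral_smul_gradient
      (hvc.locallyIntegrableOn Ω.isOpen.measurableSet) ξ.contDiff ξ.hasCompactSupport
      ξ.tsupport_subset, inner_setIntegral_smul (hg.locallyIntegrableOn Ω.isOpen.measurableSet)
      ξ.continuous ξ.hasCompactSupport ξ.tsupport_subset]
  exact integral_mul_fderiv_eq_neg_of_hasGradientAt hv hg ξ.contDiff ξ.hasCompactSupport
    ξ.tsupport_subset e

end WeakGradient

section RadialTest

open scoped ContDiff Gradient

variable {d : ℕ} {R : ℝ≥0∞}

lemma contDiff_comp_norm {η : ℝ → ℝ} (hη : ContDiff ℝ ∞ η) {α : ℝ} (hα : 0 < α)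
    (hconst : ∀ s < α, η s = η 0) : ContDiff ℝ ∞ fun x : 𝔼 d => η ‖x‖ := by
  refine contDiff_iff_contDiffAt.2 fun x => ?_
  rcases eq_or_ne x 0 with rfl | hx
  · refine (contDiffAt_const (c := η 0)).congr_of_eventuallyEq ?_
    filter_upwards [Metric.ball_mem_nhds (0 : 𝔼 d) hα] with y hy
    exact hconst _ (mem_ball_zero_iff.1 hy)
  · exact hη.contDiffAt.comp x (contDiffAt_norm ℝ hx)

lemma tsupport_comp_norm_subset {η : ℝ → ℝ} {ρ : ℝ} (hzero : ∀ s, ρ ≤ s → η s = 0) :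
    tsupport (fun x : 𝔼 d => η ‖x‖) ⊆ Metric.closedBall 0 ρ := by
  refine closure_minimal (fun x hx => ?_) Metric.isClosed_closedBall
  rw [mem_closedBall_zero_iff]
  by_contra h
  exact hx (hzero _ (not_le.1 h).le)

lemma hasCompactSupport_comp_norm {η : ℝ → ℝ} {ρ : ℝ} (hzero : ∀ s, ρ ≤ s → η s = 0) :
    HasCompactSupport (fun x : 𝔼 d => η ‖x‖) :=
  (isCompact_closedBall (0 : 𝔼 d) ρ).of_isClosed_subset (isClosed_tsupport _)
    (tsupport_comp_norm_subset hzero)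

lemma hasGradientAt_comp_norm_of_smooth {η : ℝ → ℝ} (hη : ContDiff ℝ ∞ η) {α : ℝ} (hα : 0 < α)
    (hconst : ∀ s < α, η s = η 0) (x : 𝔼 d) :
    HasGradientAt (fun x : 𝔼 d => η ‖x‖) ((deriv η ‖x‖ / ‖x‖) • x) x := by
  refine hasGradientAt_comp_norm ?_
    ((hη.differentiable (by simp)).differentiableAt.hasDerivAt.hasDerivWithinAt)
  have : η =ᶠ[nhds 0] fun _ => η 0 := by
    filter_upwards [Iio_mem_nhds hα] with s hs
    exact hconst s hs
  rw [this.deriv_eq, deriv_const]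

/-- A radial vector field `w(|x|) x/|x|` with weak divergence `F` satisfies the integrated
equation on balls: its flux through the sphere of radius `t` is the integral of `F` over the
ball of radius `t`. -/
lemma flux_eq_integral_of_weak_divergence [NeZero d] (hR : 0 < R) {w : ℝ → ℝ} {F : 𝔼 d → ℝ}
    (hw : LocallyIntegrableOn (fun x : 𝔼 d => w ‖x‖) (openBall d R : Set (𝔼 d)))
    (hF : LocallyIntegrableOn F (openBall d R : Set (𝔼 d)))
    (h : ∀ ξ : 𝓓(openBall d R, ℝ),
      (∫ x in (openBall d R : Set (𝔼 d)), inner ℝ ((w ‖x‖ / ‖x‖) • x) (∇ (⇑ξ) x)) +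
        (∫ x in (openBall d R : Set (𝔼 d)), F x * ξ x) = 0) :
    ∀ᵐ t, t ∈ radii R →
      sphereArea d * t ^ (d - 1) * w t = ∫ s in (0 : ℝ)..t, radialDensity F s := by
  have hQc : ContinuousOn (fun t => ∫ s in (0 : ℝ)..t, radialDensity F s) (radii R) := by
    intro t ht
    obtain ⟨t', ht', htt'⟩ := exists_gt_mem_radii (radii_subset_radii₀ ht)
    have h1 := intervalIntegral.continuousOn_primitive_interval' (a := 0)
      (intervalIntegrable_radialDensity hF ht') left_mem_uIcc
    exact (h1.continuousAt (by
      rw [uIcc_of_le ht'.1.le]; exact Icc_mem_nhds ht.1 htt')).continuousWithinAt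
  have hL : LocallyIntegrableOn (fun t => sphereArea d * t ^ (d - 1) * w t) (radii R) := by
    refine (locallyIntegrableOn_radialDensity hw).congr ?_
    filter_upwards [ae_restrict_mem measurableSet_radii] with s hs
    exact radialDensity_norm w hs.1.le
  have key : ∀ᵐ t, t ∈ radii R → sphereArea d * t ^ (d - 1) * w t -
      ∫ s in (0 : ℝ)..t, radialDensity F s = 0 := by
    refine isOpen_radii.ae_eq_zero_of_integral_contDiff_smul_eq_zero
      (hL.sub (hQc.locallyIntegrableOn measurableSet_radii)) ?_
    intro ψ hψ hψc hψs
    obtain ⟨α, hα, β, hβ, hαβ, hsub⟩ := exists_Ioo_superset_of_isCompact isOpen_radii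
      (nonempty_radii hR) hψc hψs
    have hout : ∀ s ∉ Ioo α β, ψ s = 0 := fun s hs' =>
      image_eq_zero_of_notMem_tsupport fun h => hs' (hsub h)
    -- The test function is `η(|x|)` with `η' = ψ` and `η(β) = 0`; it is constant near `0`.
    set η : ℝ → ℝ := fun s => ∫ t in β..s, ψ t with hη_def
    have hd : ∀ s, HasDerivAt η (ψ s) s := fun s =>
      intervalIntegral.integral_hasDerivAt_right (hψ.continuous.intervalIntegrable _ _)
        (hψ.continuous.stronglyMeasurableAtFilter _ _) hψ.continuous.continuousAt
    have hderiv : deriv η = ψ := funext fun s => (hd s).deriv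
    have hη : ContDiff ℝ ∞ η := by
      rw [contDiff_infty_iff_deriv]
      exact ⟨fun s => (hd s).differentiableAt, by rw [hderiv]; exact hψ⟩
    have hηz : ∀ s, β ≤ s → η s = 0 := by
      intro s hs
      refine intervalIntegral.integral_zero_ae (.of_forall fun t ht => hout t fun h' => ?_)
      rw [uIoc_of_le hs] at ht
      exact absurd h'.2 (not_lt.2 ht.1.le)
    have hηα : ∀ s ≤ α, η s = η α := by
      intro s hs
      have h1 : η s = η α + ∫ t in α..s, ψ t :=
        (intervalIntegral.integral_add_adjacent_intervals
          (hψ.continuous.intervalIntegrable _ _) (hψ.continuous.intervalIntegrable _ _)).symm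
      rw [h1, intervalIntegral.integral_symm, intervalIntegral.integral_zero_ae, neg_zero, add_zero]
      refine .of_forall fun t ht => hout t fun h' => ?_
      rw [uIoc_of_le hs] at ht
      exact absurd h'.1 (not_lt.2 ht.2)
    have hconst : ∀ s < α, η s = η 0 := fun s hs => by
      rw [hηα s hs.le, hηα 0 hα.1.le]
    have hsupp := (tsupport_comp_norm_subset (d := d) hηz).trans (closedBall_subset_openBall hβ)
    have h1 := h ⟨fun x => η ‖x‖, contDiff_comp_norm hη hα.1 hconst,
      hasCompactSupport_comp_norm hηz, hsupp⟩
    change (∫ x in (openBall d R : Set (𝔼 d)), inner ℝ ((w ‖x‖ / ‖x‖) • x)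
      (∇ (fun x => η ‖x‖) x)) + (∫ x in (openBall d R : Set (𝔼 d)), F x * η ‖x‖) = 0 at h1
    have e1 : ∀ x : 𝔼 d, inner ℝ ((w ‖x‖ / ‖x‖) • x) (∇ (fun x => η ‖x‖) x) = ψ ‖x‖ * w ‖x‖ := by
      intro x
      rw [(hasGradientAt_comp_norm_of_smooth hη hα.1 hconst x).gradient, hderiv, inner_smul_left,
        inner_smul_right, real_inner_self_eq_norm_sq]
      rcases eq_or_ne x 0 with rfl | hx
      · simp [hout 0 fun h => absurd h.1 (not_lt.2 hα.1.le)]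
      · have : ‖x‖ ≠ 0 := norm_ne_zero_iff.2 hx
        simp only [map_div₀, conj_trivial]
        field_simp
    have e2 : ∀ x : 𝔼 d, F x * η ‖x‖ = η ‖x‖ * F x := fun x => mul_comm _ _
    have hψx : ∀ x ∉ openBall d R, ψ ‖x‖ = 0 := fun x hx => hout _ fun h =>
      hx (mem_openBall_iff.2 (mem_radii₀_of_le (norm_nonneg _) h.2.le hβ.2))
    have hηx : ∀ x ∉ openBall d R, η ‖x‖ = 0 := fun x hx => by
      refine hηz _ (not_lt.1 fun h => hx ?_)
      exact mem_openBall_iff.2 (mem_radii₀_of_le (norm_nonneg _) h.le hβ.2)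
    simp only [e1, e2] at h1
    have hψz : ∀ s, β ≤ s → ψ s = 0 := fun s hs => hout s fun h => absurd h.2 (not_lt.2 hs)
    have i1 : Integrable (fun x : 𝔼 d => ψ ‖x‖ * w ‖x‖) := by
      have := integrable_mul_of_support hw (hψ.continuous.comp continuous_norm)
        (hasCompactSupport_comp_norm hψz)
        ((tsupport_comp_norm_subset (d := d) hψz).trans (closedBall_subset_openBall hβ))
      simpa [mul_comm] using this
    have i2 : Integrable (fun x : 𝔼 d => η ‖x‖ * F x) := by
      have := integrable_mul_of_support hF (hη.continuous.comp continuous_norm)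
        (hasCompactSupport_comp_norm hηz) hsupp
      simpa [mul_comm] using this
    rw [setIntegral_eq_of_tsupport (fun x hx => by rw [hψx x hx, zero_mul]),
      setIntegral_eq_of_tsupport (fun x hx => by rw [hηx x hx, zero_mul]),
      integral_norm_mul (v := fun x => w ‖x‖) i1, integral_norm_mul i2] at h1
    have hβ0 := hβ.1
    have e3 : ∫ s in Ioi (0 : ℝ), η s * radialDensity F s
        = ∫ s in (0 : ℝ)..β, η s * radialDensity F s := by
      rw [intervalIntegral.integral_of_le hβ0.le]
      apply setIntegral_eq_of_subset_of_forall_sdiff_eq_zero measurableSet_Ioi Ioc_subset_Ioi_self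
      intro s hs
      rw [hηz s (not_lt.1 fun h => hs.2 ⟨hs.1, h.le⟩), zero_mul]
    have e4 := integral_mul_eq_sub_of_primitive hβ0.le (A := η) (B := ψ)
      (P := fun t => ∫ s in (0 : ℝ)..t, radialDensity F s) (D := radialDensity F)
      (hψ.continuous.intervalIntegrable _ _) (intervalIntegrable_radialDensity hF hβ)
      (fun s _ => (intervalIntegral.integral_add_adjacent_intervals
          (hψ.continuous.intervalIntegrable _ _) (hψ.continuous.intervalIntegrable _ _)).symm)
      (fun s _ => by simp)
    have hout0 : ∀ s ∉ Ioo 0 β, ψ s = 0 := fun s hs => hout s fun h => hs ⟨hα.1.trans h.1, h.2⟩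
    have e5 : ∫ s in Ioi (0 : ℝ), ψ s * radialDensity (fun x : 𝔼 d => w ‖x‖) s
        = ∫ s, ψ s * (sphereArea d * s ^ (d - 1) * w s) := by
      rw [← setIntegral_eq_integral_of_forall_compl_eq_zero (s := Ioi (0 : ℝ))
        (f := fun s => ψ s * (sphereArea d * s ^ (d - 1) * w s))]
      · exact setIntegral_congr_fun measurableSet_Ioi fun s hs => by
          simp only [radialDensity_norm w (le_of_lt (show (0 : ℝ) < s from hs))]
      · intro s hs
        rw [hout0 s fun h => hs h.1, zero_mul]
    have e6 : ∫ s in (0 : ℝ)..β, ψ s * ∫ t in (0 : ℝ)..s, radialDensity F t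
        = ∫ s, ψ s * ∫ t in (0 : ℝ)..s, radialDensity F t :=
      (integral_eq_intervalIntegral_of_support hβ0.le
        (f := fun s => ψ s * ∫ t in (0 : ℝ)..s, radialDensity F t)
        fun s hs => by rw [hout0 s hs, zero_mul]).symm
    have i3 := integrable_mul_of_support hL hψ.continuous hψc hψs
    have i4 := integrable_mul_of_support (hQc.locallyIntegrableOn (μ := volume) measurableSet_radii)
      hψ.continuous hψc hψs
    simp only [mul_comm _ (ψ _)] at i3 i4
    simp only [smul_eq_mul, mul_sub]
    rw [integral_sub i3 i4]
    rw [e5, e3, e4, hηz β le_rfl, e6] at h1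
    simp only [intervalIntegral.integral_same] at h1
    linarith
  filter_upwards [key] with t ht ht'
  linarith [ht ht']

end RadialTest

/-! ### Radial Sobolev functions -/

section RadialSobolev

open scoped ContDiff Gradient

variable {d : ℕ} {R : ℝ≥0∞}

lemma norm_image_tsupport {ξ : 𝔼 d → ℝ} (hs : tsupport ξ ⊆ (openBall d R : Set (𝔼 d)) \ {0}) :
    norm '' tsupport ξ ⊆ radii R := by
  rintro _ ⟨x, hx, rfl⟩
  exact (mem_openBall_iff_of_ne (hs hx).2).1 (hs hx).1

variable [NeZero d]

/-- The profile of an a.e. radial function can be taken to be its spherical average, which is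
measurable. -/
lemma ae_eq_sphereIntegral_div_of_isAERadialOn {v : 𝔼 d → ℝ} (h : IsAERadialOn (openBall d R) v) :
    ∀ᵐ x, x ∈ openBall d R → v x = sphereIntegral v ‖x‖ / sphereArea d := by
  obtain ⟨g, hg⟩ := h
  have hg' : ∀ᵐ x, x ∈ openBall d R → v x = g ‖x‖ := (ae_restrict_iff' measurableSet_openBall).1 hg
  have h1 : ∀ᵐ s, s ∈ radii R → g s = sphereIntegral v s / sphereArea d := by
    filter_upwards [sphereIntegral_congr_ae_radii hg'] with s hs hs'
    rw [hs hs', sphereIntegral]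
    simp only [norm_smul_sphere hs'.1.le, integral_const, smul_eq_mul]
    rw [sphereArea, mul_div_cancel_left₀]
    exact sphereArea_pos.ne'
  filter_upwards [hg', ae_norm_of_ae_radii (d := d) h1] with x hx hx' hxΩ
  rw [hx hxΩ, hx' hxΩ]

lemma locallyIntegrableOn_comp_norm {b : ℝ → ℝ} (hb : LocallyIntegrableOn b (radii R)) :
    LocallyIntegrableOn (fun x : 𝔼 d => b ‖x‖) ((openBall d R : Set (𝔼 d)) \ {0}) := by
  have hopen : IsOpen ((openBall d R : Set (𝔼 d)) \ {0}) := isOpen_openBall.sdiff isClosed_singleton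
  refine (locallyIntegrableOn_iff hopen.isLocallyClosed).2 fun K hK hKc => ?_
  rcases K.eq_empty_or_nonempty with rfl | ⟨x₀, hx₀⟩
  · simp
  have him : norm '' K ⊆ radii R := by
    rintro _ ⟨x, hx, rfl⟩
    exact (mem_openBall_iff_of_ne (hK hx).2).1 (hK hx).1
  obtain ⟨α, hα, β, hβ, hαβ, hsub⟩ := exists_Ioo_superset_of_isCompact isOpen_radii
    ⟨_, him (mem_image_of_mem _ hx₀)⟩ (hKc.image continuous_norm) him
  have h1 : IntegrableOn b (Icc α β) :=
    hb.integrableOn_compact_subset (ordConnected_radii.out hα hβ) isCompact_Icc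
  have h2 : IntegrableOn (fun s : ℝ => s ^ (d - 1) * b s) (Icc α β) :=
    h1.continuousOn_mul (by fun_prop) isCompact_Icc
  have h3 : Integrable (fun x : 𝔼 d => (Icc α β).indicator b ‖x‖) := by
    rw [integrable_fun_norm_addHaar (volume : Measure (𝔼 d))]
    simp only [finrank_euclideanSpace, Fintype.card_fin, smul_eq_mul]
    have := (h2.integrable_indicator measurableSet_Icc).integrableOn (s := Ioi 0)
    refine this.congr_fun (fun s _ => ?_) measurableSet_Ioi
    by_cases hs : s ∈ Icc α β <;> simp [hs]
  refine h3.integrableOn.congr_fun (fun x hx => ?_) hKc.measurableSet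
  have := hsub (mem_image_of_mem _ hx)
  exact indicator_of_mem (Ioo_subset_Icc_self this) _

/-- The profile of a radial function with weak gradient `G` has the weak derivative obtained by
averaging the radial component of `G` over spheres. The test vector fields are the
`ζ(|x|) x`, whose divergence is `s^{1-d} (s^d ζ)'`. -/
lemma integral_profile_mul_deriv {p : ℝ≥0∞} (hp : 1 ≤ p) {v : 𝔼 d → ℝ} {G : 𝔼 d → 𝔼 d}
    (h : HasWeakGradientLoc (openBall d R) p v G) {ψ : ℝ → ℝ} (hψ : ContDiff ℝ ∞ ψ)
    (hc : HasCompactSupport ψ) (hs : tsupport ψ ⊆ radii R) :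
    ∫ s, sphereIntegral v s / sphereArea d * deriv ψ s =
      - ∫ s, sphereIntegral (fun x => inner ℝ (G x) x) s / (sphereArea d * s) * ψ s := by
  rcases (tsupport ψ).eq_empty_or_nonempty with hemp | hne
  · have h0 : ψ = 0 := tsupport_eq_empty_iff.1 hemp
    simp [h0]
  obtain ⟨α, hα, β, hβ, hαβ, hsub⟩ := exists_Ioo_superset_of_isCompact isOpen_radii
    (hne.mono hs) hc hs
  have hout : ∀ s ∉ Ioo α β, ψ s = 0 := fun s hs' =>
    image_eq_zero_of_notMem_tsupport fun h => hs' (hsub h)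
  have hout' : ∀ s ∉ Ioo α β, deriv ψ s = 0 := fun s hs' =>
    deriv_eq_zero_of_notMem_tsupport fun h => hs' (hsub h)
  obtain ⟨ζ, hζ_eq⟩ : ∃ ζ : ℝ → ℝ, ζ = fun s => ψ s * (s ^ d)⁻¹ := ⟨_, rfl⟩
  have hζ_def : ∀ s, ζ s = ψ s * (s ^ d)⁻¹ := fun s => by rw [hζ_eq]
  have hζout : ∀ s ∉ Ioo α β, ζ s = 0 := fun s hs' => by simp [hζ_def, hout s hs']
  have hζts : tsupport ζ ⊆ tsupport ψ := closure_mono fun s hs' h => hs' (by simp [hζ_def, h])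
  have hζ : ContDiff ℝ ∞ ζ := by
    refine contDiff_iff_contDiffAt.2 fun s => ?_
    by_cases hs' : s ∈ tsupport ζ
    · have h0 : s ^ d ≠ 0 := (pow_pos (hs (hζts hs')).1 d).ne'
      rw [hζ_eq]
      exact hψ.contDiffAt.mul ((contDiff_id.pow d).contDiffAt.inv h0)
    · exact contDiffAt_const.congr_of_eventuallyEq (notMem_tsupport_iff_eventuallyEq.1 hs')
  have hζ0 : ∀ s < α, ζ s = ζ 0 := fun s hs' => by
    rw [hζout s fun h => absurd h.1 (not_lt.2 hs'.le),
      hζout 0 fun h => absurd h.1 (not_lt.2 hα.1.le)]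
  have hζz : ∀ s, β ≤ s → ζ s = 0 := fun s hs' => hζout s fun h => absurd h.2 (not_lt.2 hs')
  have hζE := contDiff_comp_norm (d := d) hζ hα.1 hζ0
  have hζg := hasGradientAt_comp_norm_of_smooth (d := d) hζ hα.1 hζ0
  have hζs := (tsupport_comp_norm_subset (d := d) hζz).trans (closedBall_subset_openBall hβ)
  have hζc := hasCompactSupport_comp_norm (d := d) hζz
  have hζd : ∀ s, 0 < s → HasDerivAt ζ (deriv ψ s * (s ^ d)⁻¹ +
      ψ s * (-(d * s ^ (d - 1)) / (s ^ d) ^ 2)) s := fun s hs' => by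
    rw [hζ_eq]
    exact (hψ.differentiable (by simp)).differentiableAt.hasDerivAt.mul
      ((hasDerivAt_pow d s).inv (pow_pos hs' d).ne')
  have hvl := h.memLpLoc.locallyIntegrableOn hp
  have hGl := h.memLpLoc_gradient.locallyIntegrableOn hp
  -- the test functions `ζ(|x|) x_i`
  have hcoord : ∀ i : Fin d, ContDiff ℝ ∞ fun x : 𝔼 d => x i := fun i => by fun_prop
  have hξ : ∀ i : Fin d, ContDiff ℝ ∞ fun x : 𝔼 d => ζ ‖x‖ * x i := fun i => hζE.mul (hcoord i)
  have hξs : ∀ i : Fin d, tsupport (fun x : 𝔼 d => ζ ‖x‖ * x i) ⊆ tsupport fun x : 𝔼 d => ζ ‖x‖ :=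
    fun i => closure_mono fun x hx h => hx (by
      have h' : ζ ‖x‖ = 0 := h
      simp [h'])
  have hξc : ∀ i : Fin d, HasCompactSupport fun x : 𝔼 d => ζ ‖x‖ * x i := fun i =>
    hζc.of_isClosed_subset (isClosed_tsupport _) (hξs i)
  have hξd : ∀ (i : Fin d) (x : 𝔼 d), fderiv ℝ (fun x : 𝔼 d => ζ ‖x‖ * x i) x
      (EuclideanSpace.single i 1) = ζ ‖x‖ + deriv ζ ‖x‖ / ‖x‖ * (x i) ^ 2 := by
    intro i x
    have h1 : HasFDerivAt (fun x : 𝔼 d => x i) (EuclideanSpace.proj i : 𝔼 d →L[ℝ] ℝ) x :=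
      (EuclideanSpace.proj i : 𝔼 d →L[ℝ] ℝ).hasFDerivAt
    have h2 := (hζg x).hasFDerivAt.fun_mul h1
    rw [h2.fderiv]
    simp [EuclideanSpace.inner_single_right]
    ring
  have hW : ∀ i : Fin d, ∫ x, v x * (ζ ‖x‖ + deriv ζ ‖x‖ / ‖x‖ * (x i) ^ 2) =
      - ∫ x, G x i * (ζ ‖x‖ * x i) := by
    intro i
    have := h.integral_mul_fderiv hp (hξ i) (hξc i) ((hξs i).trans hζs) (EuclideanSpace.single i 1)
    simpa [hξd, EuclideanSpace.inner_single_right] using this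
  have hGi : ∀ i : Fin d, LocallyIntegrableOn (fun x => G x i) (openBall d R : Set (𝔼 d)) :=
    fun i => (EuclideanSpace.proj i : 𝔼 d →L[ℝ] ℝ).locallyIntegrableOn_comp hGl
  have iv : ∀ i : Fin d, Integrable fun x => v x * (ζ ‖x‖ + deriv ζ ‖x‖ / ‖x‖ * (x i) ^ 2) := by
    intro i
    have := integrable_mul_of_support hvl (continuous_fderiv_apply (hξ i) (EuclideanSpace.single i 1))
      ((hξc i).fderiv_apply ℝ _) ((tsupport_fderiv_apply_subset ℝ _).trans ((hξs i).trans hζs))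
    simpa only [hξd] using this
  have iG : ∀ i : Fin d, Integrable fun x => G x i * (ζ ‖x‖ * x i) := fun i =>
    integrable_mul_of_support (hGi i) (hξ i).continuous (hξc i) ((hξs i).trans hζs)
  have hsum : ∫ x, ∑ i : Fin d, v x * (ζ ‖x‖ + deriv ζ ‖x‖ / ‖x‖ * (x i) ^ 2) =
      - ∫ x, ∑ i : Fin d, G x i * (ζ ‖x‖ * x i) := by
    rw [integral_finsetSum _ fun i _ => iv i, integral_finsetSum _ fun i _ => iG i,
      ← Finset.sum_neg_distrib]
    exact Finset.sum_congr rfl fun i _ => hW i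
  have e1 : ∀ x : 𝔼 d, ∑ i : Fin d, v x * (ζ ‖x‖ + deriv ζ ‖x‖ / ‖x‖ * (x i) ^ 2) =
      (d * ζ ‖x‖ + deriv ζ ‖x‖ * ‖x‖) * v x := by
    intro x
    rw [← Finset.mul_sum, Finset.sum_add_distrib, ← Finset.mul_sum, mul_comm]
    congr 1
    have h1 : ∑ i : Fin d, (x i) ^ 2 = ‖x‖ ^ 2 := by
      rw [EuclideanSpace.norm_sq_eq]; simp
    rw [h1]
    rcases eq_or_ne x 0 with rfl | hx
    · simp
    · have : ‖x‖ ≠ 0 := norm_ne_zero_iff.2 hx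
      simp
      field_simp
  have e2 : ∀ x : 𝔼 d, ∑ i : Fin d, G x i * (ζ ‖x‖ * x i) = ζ ‖x‖ * inner ℝ (G x) x := by
    intro x
    rw [PiLp.inner_apply, Finset.mul_sum]
    refine Finset.sum_congr rfl fun i _ => ?_
    simp; ring
  simp only [e1, e2] at hsum
  rw [integral_norm_mul (η := fun s => d * ζ s + deriv ζ s * s) (by
      have := integrable_finsetSum Finset.univ fun i _ => iv i
      simpa only [e1] using this),
    integral_norm_mul (by
      have := integrable_finsetSum Finset.univ fun i _ => iG i
      simpa only [e2] using this)] at hsum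
  have hd1 : d - 1 + 1 = d := Nat.sub_add_cancel (NeZero.pos d)
  have e3 : ∫ s in Ioi (0 : ℝ), (d * ζ s + deriv ζ s * s) * radialDensity v s =
      ∫ s, sphereIntegral v s * deriv ψ s := by
    rw [← setIntegral_eq_integral_of_forall_compl_eq_zero (s := Ioi (0 : ℝ))
      (f := fun s => sphereIntegral v s * deriv ψ s)]
    · refine setIntegral_congr_fun measurableSet_Ioi fun s hs' => ?_
      have h0 : (0 : ℝ) < s := hs'
      have hsd : s ^ d = s ^ (d - 1) * s := by rw [← pow_succ, hd1]
      have h3 : s ^ (d - 1) ≠ 0 := (pow_pos h0 _).ne'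
      simp only [(hζd s h0).deriv, radialDensity, hζ_def, hsd]
      field_simp
      ring
    · intro s hs'
      rw [hout' s fun h => hs' (hα.1.trans h.1), mul_zero]
  have e4 : ∫ s in Ioi (0 : ℝ), ζ s * radialDensity (fun x => inner ℝ (G x) x) s =
      ∫ s, sphereIntegral (fun x => inner ℝ (G x) x) s / s * ψ s := by
    rw [← setIntegral_eq_integral_of_forall_compl_eq_zero (s := Ioi (0 : ℝ))
      (f := fun s => sphereIntegral (fun x => inner ℝ (G x) x) s / s * ψ s)]
    · refine setIntegral_congr_fun measurableSet_Ioi fun s hs' => ?_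
      have h0 : (0 : ℝ) < s := hs'
      have hsd : s ^ d = s ^ (d - 1) * s := by rw [← pow_succ, hd1]
      have h3 : s ^ (d - 1) ≠ 0 := (pow_pos h0 _).ne'
      simp only [radialDensity, hζ_def, hsd]
      field_simp
    · intro s hs'
      rw [hout s fun h => hs' (hα.1.trans h.1), mul_zero]
  rw [e3, e4] at hsum
  have e5 : ∀ s, sphereIntegral v s / sphereArea d * deriv ψ s =
      (sphereArea d)⁻¹ * (sphereIntegral v s * deriv ψ s) := fun s => by ring
  have e6 : ∀ s, sphereIntegral (fun x => inner ℝ (G x) x) s / (sphereArea d * s) * ψ s =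
      (sphereArea d)⁻¹ * (sphereIntegral (fun x => inner ℝ (G x) x) s / s * ψ s) := fun s => by
    rw [div_mul_eq_div_div_swap, div_eq_mul_inv _ (sphereArea d)]; ring
  simp only [e5, e6, integral_const_mul, hsum, mul_neg]

/-- Integration by parts, away from the origin, for a radial function whose profile is a
primitive of a locally integrable function. -/
lemma integral_radial_mul_fderiv (hR : 0 < R) {A b : ℝ → ℝ} (hb : LocallyIntegrableOn b (radii R))
    (hA : ∀ s ∈ radii R, ∀ t ∈ radii R, A t = A s + ∫ u in s..t, b u)
    {ξ : 𝔼 d → ℝ} (hξ : ContDiff ℝ ∞ ξ) (hc : HasCompactSupport ξ)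
    (hs : tsupport ξ ⊆ (openBall d R : Set (𝔼 d)) \ {0}) (e : 𝔼 d) :
    ∫ x, A ‖x‖ * fderiv ℝ ξ x e = - ∫ x, inner ℝ ((b ‖x‖ / ‖x‖) • x) e * ξ x := by
  have him := norm_image_tsupport hs
  obtain ⟨α, hα, β, hβ, hαβ, hsub⟩ := exists_Ioo_superset_of_isCompact isOpen_radii
    (nonempty_radii hR) (hc.image continuous_norm) him
  have hA' : ContinuousOn A (radii R) :=
    ((continuousOn_primitive_of_mem isOpen_radii ordConnected_radii hb hα).const_add (A α)).congr
      fun s hs => hA α hα s hs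
  have hnot : ∀ x : 𝔼 d, ‖x‖ ∉ Ioo α β → x ∉ tsupport ξ := fun x hx h =>
    hx (hsub (mem_image_of_mem _ h))
  set D := radialDensity fun x => fderiv ℝ ξ x e with hD_def
  set P := radialDensity fun x : 𝔼 d => inner ℝ x e / ‖x‖ * ξ x with hP_def
  have hDout : ∀ s, 0 ≤ s → s ∉ Ioo α β → D s = 0 := by
    intro s h0 hs'
    have : ∀ σ : Metric.sphere (0 : 𝔼 d) 1, fderiv ℝ ξ (s • (σ : 𝔼 d)) e = 0 := fun σ => by
      rw [fderiv_eq_zero_of_notMem_tsupport (hnot _ (by rwa [norm_smul_sphere h0]))]; rfl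
    simp [hD_def, radialDensity, sphereIntegral, this]
  have hPout : ∀ s, 0 ≤ s → s ∉ Ioo α β → P s = 0 := by
    intro s h0 hs'
    have : ∀ σ : Metric.sphere (0 : 𝔼 d) 1, ξ (s • (σ : 𝔼 d)) = 0 := fun σ =>
      image_eq_zero_of_notMem_tsupport (hnot _ (by rwa [norm_smul_sphere h0]))
    simp [hP_def, radialDensity, sphereIntegral, this]
  have hdc : Continuous fun x => fderiv ℝ ξ x e := continuous_fderiv_apply hξ e
  -- `ξ` vanishes near the origin, so the singular factor is harmless.
  have hqc : Continuous fun x : 𝔼 d => inner ℝ x e / ‖x‖ * ξ x := by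
    refine continuous_iff_continuousAt.2 fun x => ?_
    rcases eq_or_ne x 0 with rfl | hx
    · have h0 : (0 : 𝔼 d) ∉ tsupport ξ := fun h => (hs h).2 rfl
      have h1 : ξ =ᶠ[nhds 0] fun _ => 0 := notMem_tsupport_iff_eventuallyEq.1 h0
      refine (continuousAt_const (y := (0 : ℝ))).congr ?_
      filter_upwards [h1] with y hy
      rw [hy, mul_zero]
    · exact ((continuousAt_id.inner continuousAt_const).div continuous_norm.continuousAt
        (norm_ne_zero_iff.2 hx)).mul hξ.continuous.continuousAt
  have hqcs : HasCompactSupport fun x : 𝔼 d => inner ℝ x e / ‖x‖ * ξ x := hc.mul_left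
  have hDl : LocallyIntegrableOn D (radii R) := locallyIntegrableOn_radialDensity
    (hdc.continuousOn.locallyIntegrableOn measurableSet_openBall)
  have hPl : LocallyIntegrableOn P (radii R) := locallyIntegrableOn_radialDensity
    (hqc.continuousOn.locallyIntegrableOn measurableSet_openBall)
  have hweak : ∀ η : ℝ → ℝ, ContDiff ℝ ∞ η → HasCompactSupport η → tsupport η ⊆ radii R →
      ∫ s, P s * deriv η s = - ∫ s, D s * η s := by
    intro η hη hηc hηs
    obtain ⟨α', hα', β', hβ', -, hsub'⟩ := exists_Ioo_superset_of_isCompact isOpen_radii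
      (nonempty_radii hR) hηc hηs
    have hηout : ∀ s ∉ Ioo α' β', η s = 0 := fun s hs' =>
      image_eq_zero_of_notMem_tsupport fun h => hs' (hsub' h)
    have hηout' : ∀ s ∉ Ioo α' β', deriv η s = 0 := fun s hs' =>
      deriv_eq_zero_of_notMem_tsupport fun h => hs' (hsub' h)
    have hη0 : ∀ s < α', η s = η 0 := fun s hs' => by
      rw [hηout s fun h => absurd h.1 (not_lt.2 hs'.le),
        hηout 0 fun h => absurd h.1 (not_lt.2 hα'.1.le)]
    have hg := hasGradientAt_comp_norm_of_smooth (d := d) hη hα'.1 hη0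
    have hη'c : Continuous (deriv η) := (contDiff_infty_iff_deriv.1 hη).2.continuous
    have hgc : ContinuousOn (fun x : 𝔼 d => (deriv η ‖x‖ / ‖x‖) • x)
        ((⊤ : Opens (𝔼 d)) : Set (𝔼 d)) :=
      continuousOn_div_norm_smul (R := ⊤) (fun x _ => ⟨norm_nonneg _, by simp⟩) hη'c.continuousOn
        (hηout' 0 fun h => absurd h.1 (not_lt.2 hα'.1.le))
    have h1 := integral_mul_fderiv_eq_neg_of_hasGradientAt (Ω := ⊤) (fun x _ => hg x) hgc hξ hc
      (subset_univ _) e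
    have e1 : ∀ x : 𝔼 d, inner ℝ ((deriv η ‖x‖ / ‖x‖) • x) e * ξ x =
        deriv η ‖x‖ * (inner ℝ x e / ‖x‖ * ξ x) := fun x => by
      rw [inner_smul_left]; simp; ring
    simp only [e1] at h1
    rw [integral_norm_mul (η := η), integral_norm_mul (η := deriv η)] at h1
    · have e2 : ∫ s in Ioi (0 : ℝ), η s * D s = ∫ s, D s * η s := by
        rw [← setIntegral_eq_integral_of_forall_compl_eq_zero (s := Ioi (0 : ℝ))
          (f := fun s => D s * η s) fun s hs' => by
            rw [hηout s fun h => hs' (hα'.1.trans h.1), mul_zero]]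
        simp only [mul_comm]
      have e3 : ∫ s in Ioi (0 : ℝ), deriv η s * P s = ∫ s, P s * deriv η s := by
        rw [← setIntegral_eq_integral_of_forall_compl_eq_zero (s := Ioi (0 : ℝ))
          (f := fun s => P s * deriv η s) fun s hs' => by
            rw [hηout' s fun h => hs' (hα'.1.trans h.1), mul_zero]]
        simp only [mul_comm]
      rw [e2, e3] at h1
      rw [h1, neg_neg]
    · exact ((hη'c.comp continuous_norm).mul hqc).integrable_of_hasCompactSupport hqcs.mul_left
    · exact ((hη.continuous.comp continuous_norm).mul hdc).integrable_of_hasCompactSupport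
        (hc.fderiv_apply ℝ e).mul_left
  obtain ⟨c, hcP⟩ := ae_eq_primitive_of_weak_deriv isOpen_radii ordConnected_radii hPl hDl hα hweak
  have hc0 : c = 0 := by
    have h1 : ∃ s ∈ Ioo 0 α, s ∈ radii R → P s = c + ∫ t in α..s, D t := by
      by_contra hcon
      push Not at hcon
      have h2 : volume (Ioo 0 α) = 0 :=
        measure_mono_null (fun s hs' => by
          have := hcon s hs'
          simpa using this) (ae_iff.1 hcP)
      simp [Real.volume_Ioo] at h2
      exact absurd hα.1 (not_lt.2 h2)
    obtain ⟨s, hs', hP⟩ := h1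
    have h2 := hP (mem_radii_of_le hs'.1 hs'.2.le hα.2)
    rw [hPout s hs'.1.le fun h => absurd h.1 (not_lt.2 hs'.2.le), intervalIntegral.integral_symm,
      intervalIntegral.integral_zero_ae] at h2
    · linarith
    · refine .of_forall fun t ht => ?_
      rw [uIoc_of_le hs'.2.le] at ht
      exact hDout t (hs'.1.trans ht.1).le fun h => absurd h.1 (not_lt.2 ht.2)
  have hto : ∀ {f g : ℝ → ℝ}, (∀ s, 0 ≤ s → s ∉ Ioo α β → g s = 0) →
      ∫ s in Ioi (0 : ℝ), f s * g s = ∫ s in α..β, f s * g s := by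
    intro f g hg
    rw [intervalIntegral.integral_of_le hαβ.le]
    apply setIntegral_eq_of_subset_of_forall_sdiff_eq_zero measurableSet_Ioi
      (fun s hs' => hα.1.trans hs'.1)
    intro s hs'
    rw [hg s (le_of_lt hs'.1) fun h => hs'.2 ⟨h.1, h.2.le⟩, mul_zero]
  have hDint := LocallyIntegrableOn.intervalIntegrable_of_mem ordConnected_radii hDl hα hβ
  have hbint := LocallyIntegrableOn.intervalIntegrable_of_mem ordConnected_radii hb hα hβ
  have hDtot : ∫ s in α..β, D s = 0 := by
    have h1 : ∫ x, (1 : ℝ) * fderiv ℝ ξ x e = 0 := by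
      have := integral_mul_fderiv_eq_neg_of_hasGradientAt (Ω := ⊤) (v := fun _ => (1 : ℝ))
        (g := fun _ => 0) (fun x _ => hasGradientAt_const x 1) continuousOn_const hξ hc
        (subset_univ _) e
      simpa using this
    rw [integral_norm_mul (η := fun _ => 1), hto hDout] at h1
    · simpa using h1
    · simpa using hdc.integrable_of_hasCompactSupport (hc.fderiv_apply ℝ e)
  have hE := integral_mul_eq_sub_of_primitive hαβ.le (A := A) (B := b) (D := D)
    (P := fun s => ∫ t in α..s, D t) hbint hDint
    (fun s hs' => hA α hα s (ordConnected_radii.out hα hβ hs')) (fun s _ => by simp)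
  rw [hDtot] at hE
  have hE2 : ∫ s in α..β, b s * ∫ t in α..s, D t = ∫ s in α..β, b s * P s := by
    refine intervalIntegral.integral_congr_ae ?_
    filter_upwards [hcP] with s hs' hsm
    rw [uIoc_of_le hαβ.le] at hsm
    rw [hs' (ordConnected_radii.out hα hβ (Ioc_subset_Icc_self hsm)), hc0, zero_add]
  have e1 : ∀ x : 𝔼 d, inner ℝ ((b ‖x‖ / ‖x‖) • x) e * ξ x =
      b ‖x‖ * (inner ℝ x e / ‖x‖ * ξ x) := fun x => by
    rw [inner_smul_left]; simp; ring
  simp only [e1]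
  rw [integral_norm_mul, integral_norm_mul, hto hDout, hto hPout, hE, hE2]
  · simp
  · refine integrable_mul_of_support (locallyIntegrableOn_comp_norm hb) hqc hqcs ?_
    refine Subset.trans (closure_mono fun x hx => ?_) hs
    exact fun h => hx (by
      have h' : ξ x = 0 := h
      simp [h'])
  · exact integrable_mul_of_support (locallyIntegrableOn_comp_norm
      (hA'.locallyIntegrableOn measurableSet_radii)) hdc (hc.fderiv_apply ℝ e)
      ((tsupport_fderiv_apply_subset ℝ e).trans hs)

/-- **Structure of radial Sobolev functions**: a radial function with a locally integrable weak
gradient has an absolutely continuous profile, and its weak gradient is radial. -/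
theorem HasWeakGradientLoc.exists_profile (hR : 0 < R) {p : ℝ≥0∞} (hp : 1 ≤ p) {v : 𝔼 d → ℝ}
    {G : 𝔼 d → 𝔼 d} (h : HasWeakGradientLoc (openBall d R) p v G)
    (hrad : IsAERadialOn (openBall d R) v) :
    ∃ A b : ℝ → ℝ, LocallyIntegrableOn b (radii R) ∧
      (∀ s ∈ radii R, ∀ t ∈ radii R, A t = A s + ∫ u in s..t, b u) ∧
      (∀ᵐ x, x ∈ openBall d R → v x = A ‖x‖) ∧
      (∀ᵐ x, x ∈ openBall d R → G x = (b ‖x‖ / ‖x‖) • x) := by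
  obtain ⟨s₀, hs₀⟩ := nonempty_radii hR
  have hvl := h.memLpLoc.locallyIntegrableOn hp
  have hGl := h.memLpLoc_gradient.locallyIntegrableOn hp
  set b : ℝ → ℝ := fun s => sphereIntegral (fun x => inner ℝ (G x) x) s / (sphereArea d * s)
    with hb_def
  have hGx : LocallyIntegrableOn (fun x => inner ℝ (G x) x) (openBall d R : Set (𝔼 d)) := by
    have hGi : ∀ i : Fin d, LocallyIntegrableOn (fun x => G x i * x i)
        (openBall d R : Set (𝔼 d)) := fun i =>
      ((EuclideanSpace.proj i : 𝔼 d →L[ℝ] ℝ).locallyIntegrableOn_comp hGl).mul_continuousOn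
        (by fun_prop) isOpen_openBall.isLocallyClosed
    refine (locallyIntegrableOn_iff isOpen_openBall.isLocallyClosed).2 fun K hK hKc => ?_
    have := integrable_finsetSum Finset.univ fun i _ =>
      (hGi i).integrableOn_compact_subset hK hKc
    refine this.congr (.of_forall fun x => ?_)
    simp only [PiLp.inner_apply]
    exact Finset.sum_congr rfl fun i _ => by simp [mul_comm]
  have hb : LocallyIntegrableOn b (radii R) := by
    refine (locallyIntegrableOn_sphereIntegral hGx).mul_continuousOn
      (g := fun s => (sphereArea d * s)⁻¹) ?_ isOpen_radii.isLocallyClosed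
    exact ContinuousOn.inv₀ (by fun_prop) fun s hs =>
      (mul_pos sphereArea_pos hs.1).ne'
  have ha : LocallyIntegrableOn (fun s => sphereIntegral v s / sphereArea d) (radii R) := by
    refine (locallyIntegrableOn_sphereIntegral hvl).mul_continuousOn
      (g := fun s => (sphereArea d)⁻¹) continuousOn_const isOpen_radii.isLocallyClosed
  obtain ⟨c, hcv⟩ := ae_eq_primitive_of_weak_deriv isOpen_radii ordConnected_radii ha hb hs₀
    fun ψ hψ hψc hψs => integral_profile_mul_deriv hp h hψ hψc hψs
  have hint := fun {s t : ℝ} (hs : s ∈ radii R) (ht : t ∈ radii R) =>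
    LocallyIntegrableOn.intervalIntegrable_of_mem ordConnected_radii hb hs ht
  set A : ℝ → ℝ := fun s => c + ∫ t in s₀..s, b t with hA_def
  have hA : ∀ s ∈ radii R, ∀ t ∈ radii R, A t = A s + ∫ u in s..t, b u := by
    intro s hs t ht
    rw [hA_def]
    dsimp only
    rw [add_assoc, intervalIntegral.integral_add_adjacent_intervals (hint hs₀ hs) (hint hs ht)]
  have hvA : ∀ᵐ x, x ∈ openBall d R → v x = A ‖x‖ := by
    filter_upwards [ae_eq_sphereIntegral_div_of_isAERadialOn hrad,
      ae_norm_of_ae_radii (d := d) hcv] with x hx hx' hxΩ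
    rw [hx hxΩ, hx' hxΩ]
  refine ⟨A, b, hb, hA, hvA, ?_⟩
  have hopen : IsOpen ((openBall d R : Set (𝔼 d)) \ {0}) := isOpen_openBall.sdiff isClosed_singleton
  have hcomp : ∀ i : Fin d, ∀ᵐ x, x ∈ (openBall d R : Set (𝔼 d)) \ {0} →
      G x i - (b ‖x‖ / ‖x‖ * x i) = 0 := by
    intro i
    have hGi : LocallyIntegrableOn (fun x => G x i) ((openBall d R : Set (𝔼 d)) \ {0}) :=
      ((EuclideanSpace.proj i : 𝔼 d →L[ℝ] ℝ).locallyIntegrableOn_comp hGl).mono_set sdiff_subset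
    have hbi : LocallyIntegrableOn (fun x : 𝔼 d => b ‖x‖ / ‖x‖ * x i)
        ((openBall d R : Set (𝔼 d)) \ {0}) := by
      have := (locallyIntegrableOn_comp_norm (d := d) hb).mul_continuousOn
        (g := fun x => ‖x‖⁻¹ * x i) (by
          refine ContinuousOn.mul (ContinuousOn.inv₀ (by fun_prop) fun x hx => ?_) (by fun_prop)
          exact norm_ne_zero_iff.2 hx.2) hopen.isLocallyClosed
      refine this.congr (.of_forall fun x => ?_)
      simp only [div_eq_mul_inv]; ring
    refine hopen.ae_eq_zero_of_integral_contDiff_smul_eq_zero (hGi.sub hbi) ?_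
    intro ξ hξ hξc hξs
    have h1 := h.integral_mul_fderiv hp hξ hξc (hξs.trans sdiff_subset) (EuclideanSpace.single i 1)
    have h2 := integral_radial_mul_fderiv hR hb hA hξ hξc hξs (EuclideanSpace.single i 1)
    have h3 : ∫ x, v x * fderiv ℝ ξ x (EuclideanSpace.single i 1) =
        ∫ x, A ‖x‖ * fderiv ℝ ξ x (EuclideanSpace.single i 1) := by
      refine integral_congr_ae ?_
      filter_upwards [hvA] with x hx
      by_cases hxΩ : x ∈ openBall d R
      · rw [hx hxΩ]
      · rw [fderiv_eq_zero_of_notMem_tsupport fun hh => hxΩ (hξs hh).1]; simp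
    simp only [EuclideanSpace.inner_single_right, PiLp.smul_apply] at h1 h2
    simp at h1 h2
    have i1 := integrable_mul_of_support hGi hξ.continuous hξc hξs
    have i2 := integrable_mul_of_support hbi hξ.continuous hξc hξs
    have e : ∀ x, ξ x • (G x i - b ‖x‖ / ‖x‖ * x i) = G x i * ξ x - b ‖x‖ / ‖x‖ * x i * ξ x :=
      fun x => by rw [smul_eq_mul]; ring
    simp only [e]
    rw [integral_sub i1 i2]
    linarith
  have hne : ∀ᵐ x : 𝔼 d, x ≠ 0 := by simp [ae_iff]
  filter_upwards [ae_all_iff.2 hcomp, hne] with x hx hx0 hxΩ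
  ext i
  have := hx i ⟨hxΩ, hx0⟩
  simp only [PiLp.smul_apply, smul_eq_mul]
  linarith

end RadialSobolev

/-! ### Powers, and the logarithmic transformation -/

section DualityMap

open scoped Gradient

variable {E : Type*} [NormedAddCommGroup E] [InnerProductSpace ℝ E]

/-- The map `v ↦ |v|^{p-2} v`, the gradient of `|v|^p / p`. -/
noncomputable def dualityMap (p : ℝ) (v : E) : E := ‖v‖ ^ (p - 2) • v

@[simp] lemma dualityMap_zero (p : ℝ) : dualityMap p (0 : E) = 0 := smul_zero _

lemma norm_dualityMap {p : ℝ} (hp : 1 < p) (v : E) : ‖dualityMap p v‖ = ‖v‖ ^ (p - 1) := by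
  rcases eq_or_ne v 0 with rfl | hv
  · simp [Real.zero_rpow (sub_pos.2 hp).ne']
  · have h0 : 0 < ‖v‖ := norm_pos_iff.2 hv
    rw [dualityMap, norm_smul, Real.norm_of_nonneg (by positivity), ← Real.rpow_add_one h0.ne']
    ring_nf

lemma dualityMap_smul {p : ℝ} (c : ℝ) (v : E) :
    dualityMap p (c • v) = dualityMap p c • dualityMap p v := by
  simp only [dualityMap, norm_smul]
  rw [Real.mul_rpow (norm_nonneg _) (norm_nonneg _), smul_smul, smul_smul, smul_eq_mul]
  ring_nf

lemma dualityMap_of_pos {p c : ℝ} (hc : 0 < c) : dualityMap p c = c ^ (p - 1) := by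
  rw [dualityMap, Real.norm_of_nonneg hc.le, smul_eq_mul, ← Real.rpow_add_one hc.ne']
  ring_nf

lemma dualityMap_neg {p : ℝ} (v : E) : dualityMap p (-v) = -dualityMap p v := by
  simp [dualityMap]

lemma dualityMap_dualityMap {p q : ℝ} (hp : 1 < p) (hpq : (p - 1) * (q - 1) = 1) (v : E) :
    dualityMap q (dualityMap p v) = v := by
  rcases eq_or_ne v 0 with rfl | hv
  · simp
  · have h0 : 0 < ‖v‖ := norm_pos_iff.2 hv
    rw [dualityMap, norm_dualityMap hp, dualityMap, smul_smul, ← Real.rpow_mul h0.le,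
      ← Real.rpow_add h0]
    have : (p - 1) * (q - 2) + (p - 2) = 0 := by linear_combination hpq
    rw [this, Real.rpow_zero, one_smul]

lemma inner_dualityMap_self {p : ℝ} (hp : 1 < p) (v : E) :
    inner ℝ (dualityMap p v) v = ‖v‖ ^ p := by
  rcases eq_or_ne v 0 with rfl | hv
  · simp [Real.zero_rpow (by linarith : p ≠ 0)]
  · have h0 : 0 < ‖v‖ := norm_pos_iff.2 hv
    rw [dualityMap, inner_smul_left, real_inner_self_eq_norm_sq, conj_trivial,
      ← Real.rpow_natCast, ← Real.rpow_add h0]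
    norm_num

lemma continuous_dualityMap {p : ℝ} (hp : 1 < p) : Continuous (dualityMap p : E → E) := by
  refine continuous_iff_continuousAt.2 fun v => ?_
  rcases eq_or_ne v 0 with rfl | hv
  · rw [ContinuousAt, dualityMap_zero, tendsto_zero_iff_norm_tendsto_zero]
    simp only [norm_dualityMap hp]
    have h1 : Continuous fun v : E => ‖v‖ ^ (p - 1) :=
      continuous_norm.rpow_const fun _ => Or.inr (sub_pos.2 hp).le
    simpa [Real.zero_rpow (sub_pos.2 hp).ne'] using h1.tendsto 0
  · exact (continuous_norm.continuousAt.rpow_const (Or.inl (norm_ne_zero_iff.2 hv))).smul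
      continuousAt_id

lemma dualityMap_radial {p : ℝ} {c : ℝ} {x : E} (h : x = 0 → c = 0) :
    dualityMap p ((c / ‖x‖) • x) = (dualityMap p c / ‖x‖) • x := by
  rw [dualityMap, norm_div_norm_smul h, smul_smul, dualityMap, Real.norm_eq_abs, smul_eq_mul,
    mul_div_assoc]

end DualityMap

section Hamiltonian

open scoped Gradient

variable {d : ℕ}

lemma gradient_powerHamiltonian {h₀ q : ℝ} (hq : 1 < q) (p : 𝔼 d) :
    ∇ (powerHamiltonian d h₀ q) p = h₀ • dualityMap q p := by
  have hq0 : q ≠ 0 := by linarith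
  have h1 : HasGradientAt (fun p : 𝔼 d => h₀ / q * ‖p‖ ^ q)
      ((h₀ * ‖p‖ ^ (q - 1) / ‖p‖) • p) p := by
    refine hasGradientAt_comp_norm (h := fun s => h₀ / q * s ^ q)
      (h' := fun s => h₀ * s ^ (q - 1)) (by simp [Real.zero_rpow (sub_pos.2 hq).ne']) ?_
    have := (Real.hasDerivAt_rpow_const (x := ‖p‖) (Or.inr hq.le)).const_mul (h₀ / q)
    refine (this.congr_deriv ?_).hasDerivWithinAt
    field_simp
  rw [show ∇ (powerHamiltonian d h₀ q) p = _ from h1.gradient, dualityMap, smul_smul]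
  rcases eq_or_ne p 0 with rfl | hp
  · simp
  · congr 1
    have h0 : 0 < ‖p‖ := norm_pos_iff.2 hp
    rw [mul_div_assoc, ← Real.rpow_sub_one h0.ne']
    ring_nf

end Hamiltonian

section SmoothOnOpen

open scoped Gradient

variable {d : ℕ} {Ω : Opens (EuclideanSpace ℝ (Fin d))}

lemma ContDiffOn.hasGradientAt_and_continuousOn {v : 𝔼 d → ℝ}
    (hv : ContDiffOn ℝ 1 v (Ω : Set (𝔼 d))) :
    (∀ x ∈ Ω, HasGradientAt v (∇ v x) x) ∧ ContinuousOn (∇ v) (Ω : Set (𝔼 d)) := by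
  refine ⟨fun x hx => ?_, ?_⟩
  · exact ((hv.differentiableOn (by simp)).differentiableAt
      (Ω.isOpen.mem_nhds hx)).hasGradientAt
  · exact (LinearIsometryEquiv.continuous _).comp_continuousOn
      (hv.continuousOn_fderiv_of_isOpen Ω.isOpen le_rfl)

lemma contDiffOn_one_of_hasFDerivAt {F : Type*} [NormedAddCommGroup F] [NormedSpace ℝ F]
    {v : 𝔼 d → F} {v' : 𝔼 d → 𝔼 d →L[ℝ] F}
    (hv : ∀ x ∈ Ω, HasFDerivAt v (v' x) x) (hc : ContinuousOn v' (Ω : Set (𝔼 d))) :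
    ContDiffOn ℝ 1 v (Ω : Set (𝔼 d)) := by
  rw [show (1 : WithTop ℕ∞) = 0 + 1 from rfl, contDiffOn_succ_iff_fderiv_of_isOpen Ω.isOpen]
  refine ⟨fun x hx => (hv x hx).differentiableAt.differentiableWithinAt, by simp, ?_⟩
  rw [contDiffOn_zero]
  exact hc.congr fun x hx => (hv x hx).fderiv

lemma contDiffOn_one_of_hasGradientAt {v : 𝔼 d → ℝ} {g : 𝔼 d → 𝔼 d}
    (hv : ∀ x ∈ Ω, HasGradientAt v (g x) x) (hg : ContinuousOn g (Ω : Set (𝔼 d))) :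
    ContDiffOn ℝ 1 v (Ω : Set (𝔼 d)) :=
  contDiffOn_one_of_hasFDerivAt (fun x hx => (hv x hx).hasFDerivAt)
    ((LinearIsometryEquiv.continuous _).comp_continuousOn hg)

lemma contDiffOn_two_of_hasGradientAt {v : 𝔼 d → ℝ} {g : 𝔼 d → 𝔼 d}
    (hv : ∀ x ∈ Ω, HasGradientAt v (g x) x) (hg : ContDiffOn ℝ 1 g (Ω : Set (𝔼 d))) :
    ContDiffOn ℝ 2 v (Ω : Set (𝔼 d)) := by
  rw [show (2 : WithTop ℕ∞) = 1 + 1 from one_add_one_eq_two.symm,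
    contDiffOn_succ_iff_fderiv_of_isOpen Ω.isOpen]
  refine ⟨fun x hx => (hv x hx).differentiableAt.differentiableWithinAt, by simp, ?_⟩
  have h1 : ContDiffOn ℝ 1 (fun x => InnerProductSpace.toDual ℝ (𝔼 d) (g x)) (Ω : Set (𝔼 d)) :=
    (InnerProductSpace.toDual ℝ (𝔼 d)).contDiff.comp_contDiffOn hg
  exact h1.congr fun x hx => (hv x hx).hasFDerivAt.fderiv

end SmoothOnOpen

section LogTransform

open scoped Gradient ContDiff

variable {d : ℕ} {Ω : Opens (EuclideanSpace ℝ (Fin d))} {ν h₀ r r' : ℝ}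

/-- The relation `r ν DΦ = -h₀ Φ |Du|^{r'-2} Du` between the value function `u` and the `r`-th root
`Φ` of the density; it says that `ν DΦ^r + Φ^r DH(Du) = 0`, that is, the flux in the Kolmogorov
equation vanishes. -/
structure IsConjugatePair (Ω : Opens (EuclideanSpace ℝ (Fin d))) (ν h₀ r r' : ℝ)
    (u Φ : EuclideanSpace ℝ (Fin d) → ℝ) (g : EuclideanSpace ℝ (Fin d) → EuclideanSpace ℝ (Fin d)) :
    Prop where
  contDiffOn : ContDiffOn ℝ 2 u (Ω : Set (EuclideanSpace ℝ (Fin d)))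
  pos : ∀ x ∈ Ω, 0 < Φ x
  hasGradientAt : ∀ x ∈ Ω, HasGradientAt Φ (g x) x
  gradient_eq : ∀ x ∈ Ω, g x = -(h₀ / (ν * r) * Φ x) • dualityMap r' (∇ u x)

namespace IsConjugatePair

variable {u Φ : 𝔼 d → ℝ} {g : 𝔼 d → 𝔼 d}

lemma continuousOn_gradient_value (h : IsConjugatePair Ω ν h₀ r r' u Φ g) :
    ContinuousOn (∇ u) (Ω : Set (𝔼 d)) :=
  (h.contDiffOn.of_le one_le_two).hasGradientAt_and_continuousOn.2

lemma continuousOn (h : IsConjugatePair Ω ν h₀ r r' u Φ g) :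
    ContinuousOn Φ (Ω : Set (𝔼 d)) := fun x hx =>
  (h.hasGradientAt x hx).continuousAt.continuousWithinAt

lemma continuousOn_gradient (h : IsConjugatePair Ω ν h₀ r r' u Φ g) (hr' : 1 < r') :
    ContinuousOn g (Ω : Set (𝔼 d)) := by
  refine ContinuousOn.congr ?_ h.gradient_eq
  exact (continuousOn_const.mul h.continuousOn).neg.smul
    ((continuous_dualityMap hr').comp_continuousOn h.continuousOn_gradient_value)

lemma hasGradientAt_rpow (h : IsConjugatePair Ω ν h₀ r r' u Φ g) (a : ℝ) {x : 𝔼 d} (hx : x ∈ Ω) :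
    HasGradientAt (fun x => Φ x ^ a) ((a * Φ x ^ (a - 1)) • g x) x := by
  have h1 := (h.hasGradientAt x hx).hasFDerivAt.rpow_const (p := a) (Or.inl (h.pos x hx).ne')
  refine h1.congr_fderiv ?_
  simp

/-- The density `Φ^r` has vanishing flux. -/
lemma hasGradientAt_density (h : IsConjugatePair Ω ν h₀ r r' u Φ g) (hν : 0 < ν) (hr : 1 < r)
    (hr' : 1 < r') {x : 𝔼 d} (hx : x ∈ Ω) :
    HasGradientAt (fun x => Φ x ^ r)
      (-(ν⁻¹ * Φ x ^ r) • ∇ (powerHamiltonian d h₀ r') (∇ u x)) x := by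
  convert h.hasGradientAt_rpow r hx using 1
  have hΦ := h.pos x hx
  rw [h.gradient_eq x hx, gradient_powerHamiltonian hr', smul_smul, smul_smul,
    show Φ x ^ r = Φ x ^ (r - 1) * Φ x by rw [← Real.rpow_add_one hΦ.ne']; ring_nf]
  congr 1
  have : r ≠ 0 := by linarith
  field_simp

lemma flux_eq (h : IsConjugatePair Ω ν h₀ r r' u Φ g) (hν : 0 < ν) (hh₀ : 0 < h₀) (hr : 1 < r)
    (hr' : 1 < r') (hrr' : (r - 1) * (r' - 1) = 1) {x : 𝔼 d} (hx : x ∈ Ω) :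
    (ν * (ν * r / h₀) ^ (r - 1)) • dualityMap r (g x) = -(ν * Φ x ^ (r - 1)) • ∇ u x := by
  have hΦ := h.pos x hx
  have hr0 : 0 < r := by linarith
  rw [h.gradient_eq x hx, dualityMap_smul, dualityMap_neg, dualityMap_of_pos (by positivity),
    dualityMap_dualityMap hr' (by rw [mul_comm]; exact hrr'), smul_smul,
    Real.mul_rpow (by positivity) hΦ.le]
  congr 1
  have h1 : (ν * r / h₀) ^ (r - 1) * (h₀ / (ν * r)) ^ (r - 1) = 1 := by
    rw [← Real.mul_rpow (by positivity) (by positivity)]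
    have : ν * r / h₀ * (h₀ / (ν * r)) = 1 := by field_simp
    rw [this, Real.one_rpow]
  linear_combination (-ν * Φ x ^ (r - 1)) * h1

lemma integral_flux (h : IsConjugatePair Ω ν h₀ r r' u Φ g) (hν : 0 < ν) (hh₀ : 0 < h₀)
    (hr : 1 < r) (hr' : 1 < r') (hrr' : (r - 1) * (r' - 1) = 1) (ξ : 𝓓(Ω, ℝ)) :
    (ν * (ν * r / h₀) ^ (r - 1)) *
        (∫ x in (Ω : Set (𝔼 d)), ‖g x‖ ^ (r - 2) * inner ℝ (g x) (∇ (⇑ξ) x)) =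
      ∫ x in (Ω : Set (𝔼 d)),
        (ν * Laplacian.laplacian u x - powerHamiltonian d h₀ r' (∇ u x)) * Φ x ^ (r - 1) * ξ x := by
  set e : Fin d → 𝔼 d := fun i => EuclideanSpace.single i 1 with he
  have hξ : ContDiff ℝ ∞ ξ := ξ.contDiff
  have hξ0 : ∀ x ∉ Ω, ξ x = 0 := fun x hx =>
    image_eq_zero_of_notMem_tsupport fun hh => hx (ξ.tsupport_subset hh)
  -- the components of the vector field `Φ^{r-1} Du`
  set v : Fin d → 𝔼 d → ℝ := fun i x => Φ x ^ (r - 1) * fderiv ℝ u x (e i) with hv_def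
  have hΦ1 : ContDiffOn ℝ 1 (fun x => Φ x ^ (r - 1)) (Ω : Set (𝔼 d)) :=
    (contDiffOn_one_of_hasGradientAt h.hasGradientAt
      (h.continuousOn_gradient hr')).rpow_const_of_ne fun x hx => (h.pos x hx).ne'
  have hDu : ContDiffOn ℝ 1 (fderiv ℝ u) (Ω : Set (𝔼 d)) :=
    h.contDiffOn.fderiv_of_isOpen Ω.isOpen (by norm_num)
  have hv : ∀ i, ContDiffOn ℝ 1 (v i) (Ω : Set (𝔼 d)) := fun i =>
    hΦ1.mul (hDu.clm_apply contDiffOn_const)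
  have hvg := fun i => (hv i).hasGradientAt_and_continuousOn
  have hibp : ∀ i, ∫ x, v i x * fderiv ℝ ξ x (e i) = - ∫ x, inner ℝ (∇ (v i) x) (e i) * ξ x :=
    fun i => integral_mul_fderiv_eq_neg_of_hasGradientAt (hvg i).1 (hvg i).2 hξ
      ξ.hasCompactSupport ξ.tsupport_subset (e i)
  have hdv : ∀ i, ∀ x ∈ Ω, inner ℝ (∇ (v i) x) (e i) =
      Φ x ^ (r - 1) * fderiv ℝ (fderiv ℝ u) x (e i) (e i) +
        ((r - 1) * Φ x ^ (r - 2)) * (g x i * ∇ u x i) := by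
    intro i x hx
    have h1 := (h.hasGradientAt_rpow (r - 1) hx).hasFDerivAt
    have h2 : HasFDerivAt (fderiv ℝ u) (fderiv ℝ (fderiv ℝ u) x) x :=
      ((hDu.differentiableOn (by simp)).differentiableAt (Ω.isOpen.mem_nhds hx)).hasFDerivAt
    have h3 := h1.fun_mul (h2.clm_apply (hasFDerivAt_const (e i) x))
    rw [inner_gradient_left]
    change fderiv ℝ (fun x => Φ x ^ (r - 1) * fderiv ℝ u x (e i)) x (e i) = _
    rw [h3.fderiv]
    have h4 : fderiv ℝ u x (e i) = ∇ u x i := by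
      rw [← inner_gradient_left (𝕜 := ℝ), he, EuclideanSpace.inner_single_right]; simp
    rw [← h4]
    simp [he, EuclideanSpace.inner_single_right]
    ring_nf
  have hdiv : ∀ x ∈ Ω, ∑ i, inner ℝ (∇ (v i) x) (e i) =
      ν⁻¹ * ((ν * Laplacian.laplacian u x - powerHamiltonian d h₀ r' (∇ u x)) * Φ x ^ (r - 1)) := by
    intro x hx
    have hΦ := h.pos x hx
    have h1 : Laplacian.laplacian u x = ∑ i, fderiv ℝ (fderiv ℝ u) x (e i) (e i) := by
      rw [InnerProductSpace.laplacian_eq_iteratedFDeriv_orthonormalBasis u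
        (EuclideanSpace.basisFun (Fin d) ℝ)]
      simp [iteratedFDeriv_two_apply, he]
    have h2 : ∑ i, g x i * ∇ u x i = -(h₀ / (ν * r) * Φ x) * ‖∇ u x‖ ^ r' := by
      rw [← inner_dualityMap_self hr', ← conj_trivial (-(h₀ / (ν * r) * Φ x)), ← inner_smul_left,
        ← h.gradient_eq x hx, PiLp.inner_apply]
      exact Finset.sum_congr rfl fun i _ => by simp [mul_comm]
    rw [Finset.sum_congr rfl fun i _ => hdv i x hx, Finset.sum_add_distrib, ← Finset.mul_sum,
      ← Finset.mul_sum, ← h1, h2, powerHamiltonian,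
      show Φ x ^ (r - 1) = Φ x ^ (r - 2) * Φ x by rw [← Real.rpow_add_one hΦ.ne']; ring_nf]
    have hr0 : r ≠ 0 := by linarith
    have hr'0 : r' ≠ 0 := by linarith
    have hrr : r * r' = r + r' := by linear_combination hrr'
    have hk : (r - 1) / r = 1 / r' := by
      rw [div_eq_div_iff hr0 hr'0]; linear_combination hrr
    have hk' : (r - 1) * (h₀ / (ν * r)) = ν⁻¹ * (h₀ / r') := by
      rw [show (r - 1) * (h₀ / (ν * r)) = ν⁻¹ * h₀ * ((r - 1) / r) by field_simp, hk]; ring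
    have hν' : ν⁻¹ * ν = 1 := inv_mul_cancel₀ hν.ne'
    linear_combination (-(Φ x ^ (r - 2) * Φ x * ‖∇ u x‖ ^ r')) * hk' -
      Laplacian.laplacian u x * (Φ x ^ (r - 2) * Φ x) * hν'
  have hpt : ∀ x ∈ Ω, (ν * (ν * r / h₀) ^ (r - 1)) *
      (‖g x‖ ^ (r - 2) * inner ℝ (g x) (∇ (⇑ξ) x)) =
      ∑ i, (-ν) * (v i x * fderiv ℝ ξ x (e i)) := by
    intro x hx
    have h1 := congrArg (fun y => inner ℝ y (∇ (⇑ξ) x)) (h.flux_eq hν hh₀ hr hr' hrr' hx)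
    simp only [inner_smul_left, dualityMap, conj_trivial] at h1
    rw [h1, PiLp.inner_apply, Finset.mul_sum]
    refine Finset.sum_congr rfl fun i _ => ?_
    have h4 : ∀ w : 𝔼 d → ℝ, fderiv ℝ w x (e i) = ∇ w x i := fun w => by
      rw [← inner_gradient_left (𝕜 := ℝ), he, EuclideanSpace.inner_single_right]; simp
    simp only [hv_def, h4]
    simp
    ring
  have i1 : ∀ i, Integrable fun x => v i x * fderiv ℝ ξ x (e i) := fun i =>
    integrable_mul_of_support ((hv i).continuousOn.locallyIntegrableOn Ω.isOpen.measurableSet)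
      (continuous_fderiv_apply hξ _) (ξ.hasCompactSupport.fderiv_apply ℝ _)
      ((tsupport_fderiv_apply_subset ℝ _).trans ξ.tsupport_subset)
  have i2 : ∀ i, Integrable fun x => inner ℝ (∇ (v i) x) (e i) * ξ x := fun i =>
    integrable_mul_of_support (ContinuousOn.locallyIntegrableOn
      ((hvg i).2.inner continuousOn_const) Ω.isOpen.measurableSet)
      hξ.continuous ξ.hasCompactSupport ξ.tsupport_subset
  rw [← integral_const_mul, setIntegral_congr_fun Ω.isOpen.measurableSet hpt,
    setIntegral_eq_of_tsupport (fun x hx => by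
      refine Finset.sum_eq_zero fun i _ => ?_
      rw [fderiv_eq_zero_of_notMem_tsupport fun hh => hx (ξ.tsupport_subset hh)]; simp),
    integral_finsetSum _ fun i _ => (i1 i).const_mul _]
  simp only [integral_const_mul, hibp]
  rw [← Finset.mul_sum, Finset.sum_neg_distrib, neg_mul_neg, ← integral_finsetSum _ fun i _ => i2 i,
    ← setIntegral_eq_of_tsupport (Ω := Ω)
      (f := fun x => ∑ i, inner ℝ (∇ (v i) x) (e i) * ξ x) (fun x hx => by simp [hξ0 x hx]),
    ← integral_const_mul]
  refine setIntegral_congr_fun Ω.isOpen.measurableSet fun x hx => ?_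
  rw [← Finset.sum_mul, hdiv x hx]
  field_simp

end IsConjugatePair

end LogTransform

/-! ### From the Mean Field Games system to the r-Laplace problem -/

section Profiles

open scoped Gradient ContDiff

variable {d : ℕ} {R : ℝ≥0∞}

/-- The fundamental theorem of calculus on `[0, R)`, with one-sided derivative at `0`. -/
lemma hasDerivWithinAt_primitive {z : ℝ → ℝ} (hz : ContinuousOn z (radii₀ R)) {s : ℝ}
    (hs : s ∈ radii₀ R) :
    HasDerivWithinAt (fun s => ∫ t in (0 : ℝ)..s, z t) (z s) (Ici 0) s := by
  obtain ⟨t, ht, hst⟩ := exists_gt_mem_radii hs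
  have hsub : Icc 0 t ⊆ radii₀ R := fun y hy => mem_radii₀_of_le hy.1 hy.2 ht.2
  set z' : ℝ → ℝ := IccExtend ht.1.le ((Icc 0 t).domRestrict z) with hz'
  have hz'c : Continuous z' := (hz.mono hsub).domRestrict.Icc_extend'
  have hzz : ∀ y ∈ Icc 0 t, z' y = z y := fun y hy => by
    rw [hz', IccExtend_of_mem _ _ hy]; rfl
  have h1 : HasDerivAt (fun s => ∫ t in (0 : ℝ)..s, z' t) (z' s) s :=
    intervalIntegral.integral_hasDerivAt_right (hz'c.intervalIntegrable _ _)
      (hz'c.stronglyMeasurableAtFilter _ _) hz'c.continuousAt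
  rw [hzz s ⟨hs.1, hst.le⟩] at h1
  have h2 : ∀ y ∈ Icc 0 t, ∫ u in (0 : ℝ)..y, z u = ∫ u in (0 : ℝ)..y, z' u := by
    intro y hy
    refine intervalIntegral.integral_congr fun u hu => (hzz u ?_).symm
    rw [uIcc_of_le hy.1] at hu
    exact ⟨hu.1, hu.2.trans hy.2⟩
  refine h1.hasDerivWithinAt.congr_of_eventuallyEq ?_ (h2 s ⟨hs.1, hst.le⟩)
  filter_upwards [self_mem_nhdsWithin, mem_nhdsWithin_of_mem_nhds (Iio_mem_nhds hst)] with y hy hy'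
  exact h2 y ⟨hy, (le_of_lt hy')⟩

lemma continuousOn_of_hasDerivWithinAt {h h' : ℝ → ℝ}
    (hh : ∀ s ∈ radii₀ R, HasDerivWithinAt h (h' s) (Ici 0) s) : ContinuousOn h (radii₀ R) :=
  fun s hs => (hh s hs).continuousWithinAt.mono fun _ hy => hy.1

lemma ae_norm_eq_of_radial {b : ℝ → ℝ} {G : 𝔼 d → 𝔼 d} [NeZero d]
    (hG : ∀ᵐ x, x ∈ openBall d R → G x = (b ‖x‖ / ‖x‖) • x) :
    ∀ᵐ x, x ∈ openBall d R → ‖G x‖ = |b ‖x‖| := by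
  have hne : ∀ᵐ x : 𝔼 d, x ≠ 0 := by simp [ae_iff]
  filter_upwards [hG, hne] with x hx h0 hxΩ
  rw [hx hxΩ, norm_div_norm_smul fun h => absurd h h0]

lemma aestronglyMeasurable_of_radial {b : ℝ → ℝ} {G : 𝔼 d → 𝔼 d} [NeZero d]
    (hGm : AEStronglyMeasurable G (volume.restrict (openBall d R : Set (𝔼 d))))
    (hG : ∀ᵐ x, x ∈ openBall d R → G x = (b ‖x‖ / ‖x‖) • x) :
    AEStronglyMeasurable (fun x => b ‖x‖) (volume.restrict (openBall d R : Set (𝔼 d))) := by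
  have hx : AEStronglyMeasurable (fun x : 𝔼 d => ‖x‖⁻¹ • x)
      (volume.restrict (openBall d R : Set (𝔼 d))) :=
    (measurable_norm.inv.smul measurable_id).aestronglyMeasurable
  refine AEStronglyMeasurable.congr (hGm.inner (𝕜 := ℝ) hx) ?_
  rw [Filter.EventuallyEq, ae_restrict_iff' measurableSet_openBall]
  have hne : ∀ᵐ x : 𝔼 d, x ≠ 0 := by simp [ae_iff]
  filter_upwards [hG, hne] with x hx h0 hxΩ
  have : ‖x‖ ≠ 0 := norm_ne_zero_iff.2 h0
  rw [hx hxΩ, inner_smul_left, inner_smul_right, real_inner_self_eq_norm_sq, conj_trivial]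
  field_simp

lemma locallyIntegrableOn_of_radial {b : ℝ → ℝ} {G : 𝔼 d → 𝔼 d} [NeZero d]
    (hGl : LocallyIntegrableOn G (openBall d R : Set (𝔼 d)))
    (hG : ∀ᵐ x, x ∈ openBall d R → G x = (b ‖x‖ / ‖x‖) • x) :
    LocallyIntegrableOn (fun x => b ‖x‖) (openBall d R : Set (𝔼 d)) := by
  have hm := aestronglyMeasurable_of_radial hGl.aestronglyMeasurable hG
  refine (locallyIntegrableOn_iff isOpen_openBall.isLocallyClosed).2 fun K hK hKc => ?_
  refine Integrable.mono (hGl.integrableOn_compact_subset hK hKc) (hm.mono_set hK) ?_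
  rw [ae_restrict_iff' hKc.measurableSet]
  filter_upwards [ae_norm_eq_of_radial hG] with x hx hxK
  rw [hx (hK hxK), Real.norm_eq_abs]

variable {Ω : Opens (EuclideanSpace ℝ (Fin d))}

lemma integrable_inner_gradient {G : 𝔼 d → 𝔼 d}
    (hG : LocallyIntegrableOn G (Ω : Set (𝔼 d))) (ξ : 𝓓(Ω, ℝ)) :
    Integrable fun x => inner ℝ (G x) (∇ (⇑ξ) x) := by
  have hξ : ContDiff ℝ ∞ ξ := ξ.contDiff
  have h1 : ∀ i : Fin d, Integrable fun x => G x i * fderiv ℝ ξ x (EuclideanSpace.single i 1) :=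
    fun i => integrable_mul_of_support
      ((EuclideanSpace.proj i : 𝔼 d →L[ℝ] ℝ).locallyIntegrableOn_comp hG)
      (continuous_fderiv_apply hξ _) (ξ.hasCompactSupport.fderiv_apply ℝ _)
      ((tsupport_fderiv_apply_subset ℝ _).trans ξ.tsupport_subset)
  refine (integrable_finsetSum Finset.univ fun i _ => h1 i).congr (.of_forall fun x => ?_)
  simp only [PiLp.inner_apply]
  refine Finset.sum_congr rfl fun i _ => ?_
  rw [← inner_gradient_left (𝕜 := ℝ), EuclideanSpace.inner_single_right]
  simp [mul_comm]

lemma HasWeakGradientLoc.congr_left {p : ℝ≥0∞} {v w : 𝔼 d → ℝ} {G : 𝔼 d → 𝔼 d}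
    (h : HasWeakGradientLoc Ω p v G)
    (hvw : ∀ᵐ x ∂volume.restrict (Ω : Set (𝔼 d)), v x = w x) : HasWeakGradientLoc Ω p w G := by
  refine ⟨h.memLpLoc.congr hvw, h.memLpLoc_gradient, fun ξ => ?_⟩
  rw [← h.integral_eq ξ]
  refine integral_congr_ae ?_
  filter_upwards [hvw] with x hx
  rw [hx]

end Profiles

section Forward

open scoped Gradient ContDiff

variable {d : ℕ} [NeZero d] {R : ℝ≥0∞} {ν h₀ r r' lam : ℝ}

/-- For a radial solution of the Kolmogorov equation the flux `ν Dm + m DH(Du)`, being radial and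
divergence free, vanishes; hence `m` is a multiple of `exp (-h(|x|))` with `ν h' = h₀ |k|^{r'-2} k`,
where `k` is the profile of `Du`. -/
lemma exists_density_eq_exp (hR : 0 < R) (hν : 0 < ν) (hr' : 1 < r') {u m : 𝔼 d → ℝ}
    {k : ℝ → ℝ} (hk : ContinuousOn k (radii₀ R)) (hk0 : k 0 = 0)
    (hku : ∀ x ∈ openBall d R, ∇ u x = (k ‖x‖ / ‖x‖) • x) {Dm : 𝔼 d → 𝔼 d}
    (hDm : HasWeakGradientLoc (openBall d R) 2 m Dm)
    (heq : ∀ ξ : 𝓓(openBall d R, ℝ),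
      ν * (∫ x in (openBall d R : Set (𝔼 d)), inner ℝ (Dm x) (∇ (⇑ξ) x)) +
        (∫ x in (openBall d R : Set (𝔼 d)),
          m x * inner ℝ (∇ (powerHamiltonian d h₀ r') (∇ u x)) (∇ (⇑ξ) x)) = 0)
    (hmrad : IsAERadialOn (openBall d R) m) :
    ∃ C : ℝ, ∀ᵐ x, x ∈ openBall d R →
      m x = C * Real.exp (-∫ t in (0 : ℝ)..‖x‖, h₀ / ν * dualityMap r' (k t)) := by
  obtain ⟨A, b, hb, hA, hmA, hDb⟩ := hDm.exists_profile hR one_le_two hmrad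
  have hJc : ContinuousOn (fun s => dualityMap r' (k s)) (radii₀ R) :=
    (continuous_dualityMap hr').comp_continuousOn hk
  have hml := hDm.memLpLoc.locallyIntegrableOn one_le_two
  have hDl := hDm.memLpLoc_gradient.locallyIntegrableOn one_le_two
  have hJx : ContinuousOn (fun x : 𝔼 d => h₀ * dualityMap r' (k ‖x‖)) (openBall d R : Set (𝔼 d)) :=
    continuousOn_const.mul (hJc.comp continuous_norm.continuousOn fun x hx => mem_openBall_iff.1 hx)
  have hDH : ∀ x ∈ openBall d R, ∇ (powerHamiltonian d h₀ r') (∇ u x) =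
      ((h₀ * dualityMap r' (k ‖x‖)) / ‖x‖) • x := fun x hx => by
    rw [gradient_powerHamiltonian hr', hku x hx,
      dualityMap_radial fun h => by rw [h, norm_zero, hk0], smul_smul, mul_div_assoc]
  have hDHc : ContinuousOn (fun x => ((h₀ * dualityMap r' (k ‖x‖)) / ‖x‖) • x)
      (openBall d R : Set (𝔼 d)) :=
    continuousOn_div_norm_smul (k := fun s => h₀ * dualityMap r' (k s))
      (fun x hx => mem_openBall_iff.1 hx) (continuousOn_const.mul hJc) (by simp [hk0])
  have hw : ∀ᵐ t, t ∈ radii R → ν * b t + A t * (h₀ * dualityMap r' (k t)) = 0 := by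
    have hwl : LocallyIntegrableOn
        (fun x : 𝔼 d => ν * b ‖x‖ + A ‖x‖ * (h₀ * dualityMap r' (k ‖x‖)))
        (openBall d R : Set (𝔼 d)) := by
      have hAl : LocallyIntegrableOn (fun x : 𝔼 d => A ‖x‖) (openBall d R : Set (𝔼 d)) :=
        hml.congr ((ae_restrict_iff' measurableSet_openBall).2 hmA)
      exact ((locallyIntegrableOn_of_radial hDl hDb).smul ν).add
        (hAl.mul_continuousOn hJx isOpen_openBall.isLocallyClosed)
    have hF0 : LocallyIntegrableOn (fun _ : 𝔼 d => (0 : ℝ)) (openBall d R : Set (𝔼 d)) :=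
      locallyIntegrableOn_zero
    have hflux := flux_eq_integral_of_weak_divergence hR
      (w := fun t => ν * b t + A t * (h₀ * dualityMap r' (k t))) hwl hF0 (by
        intro ξ
        simp only [zero_mul, integral_zero, add_zero]
        refine Eq.trans ?_ (heq ξ)
        have i2l : LocallyIntegrableOn
            (fun x => m x • (((h₀ * dualityMap r' (k ‖x‖)) / ‖x‖) • x))
            (openBall d R : Set (𝔼 d)) :=
          hml.smul_continuousOn isOpen_openBall.isLocallyClosed hDHc
        have i1 := (integrable_inner_gradient hDl ξ).integrableOn (s := (openBall d R : Set (𝔼 d)))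
        have i2 := (integrable_inner_gradient i2l ξ).integrableOn (s := (openBall d R : Set (𝔼 d)))
        have e2 : ∫ x in (openBall d R : Set (𝔼 d)),
            m x * inner ℝ (∇ (powerHamiltonian d h₀ r') (∇ u x)) (∇ (⇑ξ) x) =
            ∫ x in (openBall d R : Set (𝔼 d)),
              inner ℝ (m x • (((h₀ * dualityMap r' (k ‖x‖)) / ‖x‖) • x)) (∇ (⇑ξ) x) :=
          setIntegral_congr_fun measurableSet_openBall fun x hx => by
            simp only [hDH x hx, inner_smul_left, conj_trivial]
        rw [e2, ← integral_const_mul, ← integral_add (i1.const_mul ν) i2]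
        refine setIntegral_congr_ae measurableSet_openBall ?_
        filter_upwards [hmA, hDb] with x hx hx' hxΩ
        rw [hx hxΩ, hx' hxΩ]
        simp only [inner_smul_left, conj_trivial]
        ring)
    filter_upwards [hflux] with t ht htR
    have h1 := ht htR
    have h2 : radialDensity (fun _ : 𝔼 d => (0 : ℝ)) = fun _ => 0 := by
      ext s; simp [radialDensity, sphereIntegral]
    rw [h2, intervalIntegral.integral_zero] at h1
    exact (mul_eq_zero.1 h1).resolve_left (mul_pos sphereArea_pos (pow_pos htR.1 _)).ne'
  -- The profile solves `A' = -h' A` in the integrated, hence in the classical sense.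
  set h' : ℝ → ℝ := fun t => h₀ / ν * dualityMap r' (k t) with hh'
  have hh'c : ContinuousOn h' (radii₀ R) := continuousOn_const.mul hJc
  have hbA : ∀ᵐ t, t ∈ radii R → b t = -(h' t * A t) := by
    filter_upwards [hw] with t ht htR
    have := ht htR
    rw [hh']
    field_simp
    linarith
  obtain ⟨s₀, hs₀⟩ := nonempty_radii hR
  have hAc : ContinuousOn A (radii R) :=
    ((continuousOn_primitive_of_mem isOpen_radii ordConnected_radii hb hs₀).const_add (A s₀)).congr
      fun s hs => hA s₀ hs₀ s hs
  have hcc : ContinuousOn (fun t => -(h' t * A t)) (radii R) :=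
    ((hh'c.mono radii_subset_radii₀).mul hAc).neg
  have hA2 : ∀ t ∈ radii R, A t = A s₀ + ∫ s in s₀..t, -(h' s * A s) := by
    intro t ht
    rw [hA s₀ hs₀ t ht]
    congr 1
    refine intervalIntegral.integral_congr_ae ?_
    filter_upwards [hbA] with s hs hs'
    exact hs (ordConnected_radii.uIcc_subset hs₀ ht (uIoc_subset_uIcc hs'))
  have hAd : ∀ t ∈ radii R, HasDerivAt A (-(h' t * A t)) t := by
    intro t ht
    have h1 : HasDerivAt (fun t => A s₀ + ∫ s in s₀..t, -(h' s * A s)) (-(h' t * A t)) t :=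
      (intervalIntegral.integral_hasDerivAt_right
        ((hcc.mono (ordConnected_radii.uIcc_subset hs₀ ht)).intervalIntegrable)
        (hcc.stronglyMeasurableAtFilter isOpen_radii t ht)
        (hcc.continuousAt (isOpen_radii.mem_nhds ht))).const_add _
    refine h1.congr_of_eventuallyEq ?_
    filter_upwards [isOpen_radii.mem_nhds ht] with s hs
    exact hA2 s hs
  have hhd : ∀ t ∈ radii R, HasDerivAt (fun s => ∫ t in (0 : ℝ)..s, h' t) (h' t) t := fun t ht =>
    (hasDerivWithinAt_primitive hh'c (radii_subset_radii₀ ht)).hasDerivAt (Ici_mem_nhds ht.1)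
  have hd0 : ∀ t ∈ radii R,
      HasDerivAt (fun s => A s * Real.exp (∫ t in (0 : ℝ)..s, h' t)) 0 t := by
    intro t ht
    refine ((hAd t ht).fun_mul (hhd t ht).exp).congr_deriv ?_
    ring
  obtain ⟨C, hC⟩ := isOpen_radii.exists_is_const_of_deriv_eq_zero
    (ordConnected_radii (R := R)).isPreconnected
    (fun t ht => (hd0 t ht).differentiableAt.differentiableWithinAt)
    (fun t ht => (hd0 t ht).deriv)
  refine ⟨C, ?_⟩
  have h3 := ae_norm_of_ae_radii (d := d) (R := R)
    (p := fun s => A s = C * Real.exp (-∫ t in (0 : ℝ)..s, h' t)) (.of_forall fun s hs => by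
      rw [← hC s hs, mul_assoc, ← Real.exp_add, add_neg_cancel, Real.exp_zero, mul_one])
  filter_upwards [hmA, h3] with x hx hx' hxΩ
  rw [hx hxΩ, hx' hxΩ]

theorem IsMFGSolution.isRLaplaceSolution (hR : 0 < R) (hν : 0 < ν) (hh₀ : 0 < h₀) (hr : 1 < r)
    (hr' : 1 < r') (hrr' : (r - 1) * (r' - 1) = 1) {f : 𝔼 d → ℝ → ℝ} {u m φ : 𝔼 d → ℝ}
    (hφ : ∀ᵐ x ∂volume.restrict (openBall d R : Set (𝔼 d)), φ x = m x ^ (1 / r))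
    (hsol : IsMFGSolution (openBall d R) ν (powerHamiltonian d h₀ r') f u m lam)
    (hurad : IsRadialOn (openBall d R) u) (hmrad : IsAERadialOn (openBall d R) m) :
    IsRLaplaceSolution (openBall d R) (ν * (ν * r / h₀) ^ (r - 1)) r f φ lam := by
  obtain ⟨hu, ⟨m', hm', hhjb⟩, ⟨Dm, hDm, hkol⟩, hm1⟩ := hsol
  have hu1 := (hu.of_le one_le_two).hasGradientAt_and_continuousOn
  have hr0 : 0 < r := by linarith
  obtain ⟨k, hk, hk0, hku⟩ := exists_gradient_eq_of_radial hR hurad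
    (fun x hx => (hu1.1 x hx).differentiableAt) hu1.2
  obtain ⟨C, hC⟩ := exists_density_eq_exp hR hν hr' hk hk0 hku hDm hkol hmrad
  set h : ℝ → ℝ := fun s => ∫ t in (0 : ℝ)..s, h₀ / ν * dualityMap r' (k t) with hh
  have hC' : ∀ᵐ x ∂volume.restrict (openBall d R : Set (𝔼 d)), m x = C * Real.exp (-h ‖x‖) :=
    (ae_restrict_iff' measurableSet_openBall).2 hC
  -- The normalization `∫ m = 1` makes the constant positive.
  have hCpos : 0 < C := by
    by_contra hneg
    have h1 : ∫ x in (openBall d R : Set (𝔼 d)), m x ≤ 0 := by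
      refine integral_nonpos_of_ae ?_
      filter_upwards [hC'] with x hx
      rw [hx]
      exact mul_nonpos_of_nonpos_of_nonneg (not_lt.1 hneg) (Real.exp_pos _).le
    linarith
  set Φ : 𝔼 d → ℝ := fun x => Real.exp ((Real.log C - h ‖x‖) / r) with hΦ_def
  set g : 𝔼 d → 𝔼 d := fun x => -(h₀ / (ν * r) * Φ x) • dualityMap r' (∇ u x) with hg_def
  have hΦpos : ∀ x, 0 < Φ x := fun x => Real.exp_pos _
  have hΦr : ∀ x, Φ x ^ r = C * Real.exp (-h ‖x‖) := fun x => by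
    rw [hΦ_def, ← Real.exp_mul, div_mul_cancel₀ _ hr0.ne', sub_eq_add_neg, Real.exp_add,
      Real.exp_log hCpos]
  have hpair : IsConjugatePair (openBall d R) ν h₀ r r' u Φ g := by
    refine ⟨hu, fun x _ => hΦpos x, fun x hx => ?_, fun x _ => rfl⟩
    have h1 : HasGradientAt (fun x => h ‖x‖) ((h₀ / ν * dualityMap r' (k ‖x‖) / ‖x‖) • x) x :=
      hasGradientAt_comp_norm (h := h) (h' := fun t => h₀ / ν * dualityMap r' (k t)) (by simp [hk0])
        (hasDerivWithinAt_primitive (continuousOn_const.mul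
          ((continuous_dualityMap hr').comp_continuousOn hk)) (mem_openBall_iff.1 hx))
    have h2 := (((hasDerivAt_id (h ‖x‖)).const_sub (Real.log C)).div_const r).exp
    have h3 := h2.comp_hasFDerivAt x h1.hasFDerivAt
    refine h3.congr_fderiv ?_
    rw [← map_smul]
    congr 1
    rw [hg_def]
    simp only [hku x hx]
    rw [dualityMap_radial fun h => by rw [h, norm_zero, hk0], smul_smul, smul_smul]
    congr 1
    simp only [hΦ_def, id]
    field_simp
  have hΦφ : ∀ᵐ x ∂volume.restrict (openBall d R : Set (𝔼 d)), Φ x = φ x := by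
    filter_upwards [hφ, hC'] with x hx hx'
    rw [hx, hx', ← hΦr, ← Real.rpow_mul (hΦpos x).le, mul_one_div_cancel hr0.ne', Real.rpow_one]
  refine ⟨?_, (hpair.continuousOn.memLpLoc ∞).congr hΦφ, ⟨g,
    (hasWeakGradientLoc_of_hasGradientAt _ hpair.hasGradientAt
      (hpair.continuousOn_gradient hr')).congr_left hΦφ, fun ξ => ?_⟩, ?_⟩
  · filter_upwards [hΦφ] with x hx
    rw [← hx]; exact hΦpos x
  · rw [hpair.integral_flux hν hh₀ hr hr' hrr' ξ, add_comm, ← eq_neg_iff_add_eq_zero,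
      ← integral_neg]
    refine integral_congr_ae ?_
    filter_upwards [hΦφ, hC', hm', ae_restrict_mem measurableSet_openBall] with x hx hx' hx'' hxΩ
    have h1 := (hhjb x hxΩ).2
    rw [← hx, hΦr, ← hx', ← hx'', ← h1]
    ring
  · rw [← hm1]
    refine integral_congr_ae ?_
    filter_upwards [hΦφ, hC'] with x hx hx'
    rw [← hx, hΦr, hx']

end Forward

/-! ### Sphere integrals, radial vector fields and unique continuation -/

lemma forall_mem_of_ae_mem {X Y : Type*} [TopologicalSpace X] [MeasurableSpace X]
    {μ : Measure X} [μ.IsOpenPosMeasure] [TopologicalSpace Y] {U : Set X} (hU : IsOpen U)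
    {a : X → Y} (ha : ContinuousOn a U) {T : Set Y} (hT : IsClosed T)
    (h : ∀ᵐ x ∂μ, x ∈ U → a x ∈ T) : ∀ x ∈ U, a x ∈ T := by
  intro x hx
  by_contra hxT
  have ho : IsOpen (U ∩ a ⁻¹' Tᶜ) := ha.isOpen_inter_preimage hU hT.isOpen_compl
  have h1 : μ (U ∩ a ⁻¹' Tᶜ) = 0 := by
    refine measure_mono_null (fun y hy => ?_) (ae_iff.1 h)
    exact fun hh => hy.2 (hh hy.1)
  exact (ho.measure_pos μ ⟨x, hx, hxT⟩).ne' h1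

section SphereIntegral

variable {d : ℕ} {R : ℝ≥0∞}

lemma abs_sphereIntegral_le {F : 𝔼 d → ℝ} {s C : ℝ} (h : ∀ σ : 𝕊 d, |F (s • (σ : 𝔼 d))| ≤ C) :
    |sphereIntegral F s| ≤ sphereArea d * C := by
  have h1 := norm_integral_le_of_norm_le_const (μ := sphereMeasure d)
    (f := fun σ : 𝕊 d => F (s • (σ : 𝔼 d))) (.of_forall h)
  rwa [mul_comm] at h1

lemma continuousOn_sphereIntegral {F : 𝔼 d → ℝ}
    (hF : ContinuousOn F (openBall d R : Set (𝔼 d))) :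
    ContinuousOn (sphereIntegral F) (radii₀ R) := by
  intro s hs
  obtain ⟨t, ht, hst⟩ := exists_gt_mem_radii hs
  obtain ⟨C, hC⟩ := (isCompact_closedBall (0 : 𝔼 d) t).exists_bound_of_continuousOn
    (hF.mono (closedBall_subset_openBall ht))
  have hmem : ∀ y ∈ radii₀ R, ∀ σ : 𝕊 d, y • (σ : 𝔼 d) ∈ openBall d R := fun y hy σ => by
    rw [mem_openBall_iff, norm_smul_sphere hy.1]; exact hy
  refine continuousWithinAt_of_dominated (bound := fun _ => C) ?_ ?_ (integrable_const _) ?_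
  · filter_upwards [self_mem_nhdsWithin] with y hy
    have : Continuous fun σ : 𝕊 d => F (y • (σ : 𝔼 d)) :=
      hF.comp_continuous (by fun_prop) fun σ => hmem y hy σ
    exact this.aestronglyMeasurable
  · filter_upwards [self_mem_nhdsWithin, mem_nhdsWithin_of_mem_nhds (Iio_mem_nhds hst)]
      with y hy hyt
    refine .of_forall fun σ => hC _ ?_
    rw [mem_closedBall_zero_iff, norm_smul_sphere hy.1]
    exact le_of_lt hyt
  · refine .of_forall fun σ => ?_
    have : ContinuousOn (fun y : ℝ => F (y • (σ : 𝔼 d))) (radii₀ R) :=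
      hF.comp (by fun_prop) fun y hy => hmem y hy σ
    exact this s hs

end SphereIntegral

section FluxRatio

variable {d : ℕ} {R : ℝ≥0∞} {a : ℝ → ℝ}

/-- The ratio `s^{-d} ∫_0^s t^{d-1} a(t) dt`, in a form that makes sense at `s = 0`. If
`div V = a(|x|)` for a radial field `V`, then `V(x)` is this ratio times `x`. -/
noncomputable def fluxRatio (d : ℕ) (a : ℝ → ℝ) (s : ℝ) : ℝ :=
  ∫ τ in (0 : ℝ)..1, τ ^ (d - 1) * a (s * τ)

lemma pow_mul_fluxRatio [NeZero d] {s : ℝ} (hs : 0 ≤ s) :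
    s ^ d * fluxRatio d a s = ∫ t in (0 : ℝ)..s, t ^ (d - 1) * a t := by
  have hd : d - 1 + 1 = d := Nat.sub_add_cancel (NeZero.one_le)
  rcases hs.eq_or_lt with rfl | hs
  · simp [NeZero.ne d]
  have h1 := intervalIntegral.integral_comp_mul_left (a := 0) (b := 1)
    (fun t => t ^ (d - 1) * a t) hs.ne'
  rw [mul_zero, mul_one] at h1
  have h2 : (∫ τ in (0 : ℝ)..1, (s * τ) ^ (d - 1) * a (s * τ)) = s ^ (d - 1) * fluxRatio d a s := by
    rw [fluxRatio, ← intervalIntegral.integral_const_mul]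
    refine intervalIntegral.integral_congr fun τ _ => ?_
    simp only [mul_pow, mul_assoc]
  rw [h2, smul_eq_mul] at h1
  rw [← hd, pow_succ, hd, mul_right_comm, h1]
  field_simp

lemma mul_fluxRatio_zero [NeZero d] : d * fluxRatio d a 0 = a 0 := by
  have hd : d - 1 + 1 = d := Nat.sub_add_cancel (NeZero.one_le)
  have h0 : (d : ℝ) ≠ 0 := NeZero.ne _
  have h1 : ((d - 1 : ℕ) : ℝ) + 1 = d := by exact_mod_cast hd
  simp only [fluxRatio, zero_mul, intervalIntegral.integral_mul_const, integral_pow, h1, hd]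
  simp only [one_pow, zero_pow (NeZero.ne d)]
  field_simp
  ring

lemma continuousOn_fluxRatio (ha : ContinuousOn a (radii₀ R)) :
    ContinuousOn (fluxRatio d a) (radii₀ R) := by
  intro s hs
  obtain ⟨t, ht, hst⟩ := exists_gt_mem_radii hs
  obtain ⟨C, hC⟩ := (isCompact_Icc (a := (0 : ℝ)) (b := t)).exists_bound_of_continuousOn
    (ha.mono fun y hy => mem_radii₀_of_le hy.1 hy.2 ht.2)
  have hmem : ∀ y ∈ radii₀ R, ∀ τ ∈ Icc (0 : ℝ) 1, y * τ ∈ radii₀ R := fun y hy τ hτ =>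
    mem_radii₀_of_le (mul_nonneg hy.1 hτ.1) (mul_le_of_le_one_right hy.1 hτ.2) hy.2
  have hsub : uIoc (0 : ℝ) 1 ⊆ Icc 0 1 := by
    rw [uIoc_of_le zero_le_one]; exact Ioc_subset_Icc_self
  refine intervalIntegral.continuousWithinAt_of_dominated_interval (bound := fun _ => C) ?_ ?_
    intervalIntegrable_const ?_
  · filter_upwards [self_mem_nhdsWithin] with y hy
    have : ContinuousOn (fun τ : ℝ => τ ^ (d - 1) * a (y * τ)) (Icc 0 1) :=
      (continuousOn_pow _).mul (ha.comp (by fun_prop) fun τ hτ => hmem y hy τ hτ)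
    exact (this.aestronglyMeasurable measurableSet_Icc).mono_set hsub
  · filter_upwards [self_mem_nhdsWithin, mem_nhdsWithin_of_mem_nhds (Iio_mem_nhds hst)]
      with y hy hyt
    refine .of_forall fun τ hτ => ?_
    have hτ' := hsub hτ
    have h1 := hC (y * τ) ⟨mul_nonneg hy.1 hτ'.1,
      (mul_le_of_le_one_right hy.1 hτ'.2).trans (le_of_lt hyt)⟩
    rw [norm_mul, norm_pow, Real.norm_of_nonneg hτ'.1]
    exact (mul_le_of_le_one_left (norm_nonneg _) (pow_le_one₀ hτ'.1 hτ'.2)).trans h1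
  · refine .of_forall fun τ hτ => ?_
    have : ContinuousOn (fun y : ℝ => τ ^ (d - 1) * a (y * τ)) (radii₀ R) :=
      continuousOn_const.mul (ha.comp (by fun_prop) fun y hy => hmem y hy τ (hsub (by simpa using hτ)))
    exact this s hs

lemma hasDerivAt_fluxRatio [NeZero d] (ha : ContinuousOn a (radii₀ R)) {s : ℝ}
    (hs : s ∈ radii R) :
    HasDerivAt (fluxRatio d a) ((a s - d * fluxRatio d a s) / s) s := by
  have hs0 : s ≠ 0 := hs.1.ne'
  have h1 : HasDerivAt (fun s => ∫ t in (0 : ℝ)..s, t ^ (d - 1) * a t) (s ^ (d - 1) * a s) s :=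
    (hasDerivWithinAt_primitive (((continuousOn_pow (d - 1)).mul ha))
      (radii_subset_radii₀ hs)).hasDerivAt (Ici_mem_nhds hs.1)
  have h2 := h1.fun_div (hasDerivAt_pow d s) (pow_ne_zero d hs0)
  have h3 : fluxRatio d a =ᶠ[nhds s]
      fun s => (∫ t in (0 : ℝ)..s, t ^ (d - 1) * a t) / s ^ d := by
    filter_upwards [Ioi_mem_nhds hs.1] with t (ht : 0 < t)
    rw [← pow_mul_fluxRatio ht.le, mul_div_cancel_left₀ _ (pow_ne_zero d ht.ne')]
  refine (h2.congr_of_eventuallyEq h3).congr_deriv ?_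
  rw [← pow_mul_fluxRatio hs.1.le]
  have hd : s ^ d = s ^ (d - 1) * s := by
    rw [← pow_succ, Nat.sub_add_cancel (NeZero.one_le)]
  have := pow_ne_zero (d - 1) hs0
  rw [hd]
  field_simp

end FluxRatio

section RadialField

open scoped Gradient

variable {d : ℕ} {R : ℝ≥0∞}

/-- A radial vector field `κ(|x|) x` is `C¹` up to the origin if `κ` is continuous and
`s κ'(s)` tends to `0` as `s → 0`. -/
lemma contDiffOn_comp_norm_smul {κ k : ℝ → ℝ} (hκ : ContinuousOn κ (radii₀ R))
    (hk : ContinuousOn k (radii₀ R)) (hk0 : k 0 = 0)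
    (hd : ∀ s ∈ radii R, HasDerivAt κ (k s / s) s) :
    ContDiffOn ℝ 1 (fun x : 𝔼 d => κ ‖x‖ • x) (openBall d R : Set (𝔼 d)) := by
  have hκn : ContinuousOn (fun x : 𝔼 d => κ ‖x‖) (openBall d R : Set (𝔼 d)) :=
    hκ.comp continuous_norm.continuousOn fun x hx => mem_openBall_iff.1 hx
  have hkn : ContinuousOn (fun x : 𝔼 d => k ‖x‖) (openBall d R : Set (𝔼 d)) :=
    hk.comp continuous_norm.continuousOn fun x hx => mem_openBall_iff.1 hx
  -- the derivative is `κ(|x|) id + W x`, with `|W x| = |k(|x|)|`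
  set W : 𝔼 d → 𝔼 d →L[ℝ] 𝔼 d := fun x =>
    (innerSL ℝ ((k ‖x‖ / ‖x‖ / ‖x‖) • x)).smulRight x with hW
  refine contDiffOn_one_of_hasFDerivAt
    (v' := fun x => κ ‖x‖ • ContinuousLinearMap.id ℝ (𝔼 d) + W x) (fun x hx => ?_) ?_
  · rcases eq_or_ne x 0 with rfl | hx0
    · have h0 : W 0 = 0 := by ext; simp [hW]
      rw [h0, add_zero, hasFDerivAt_iff_isLittleO]
      have h1 : (fun y : 𝔼 d => κ ‖y‖ - κ ‖(0 : 𝔼 d)‖) =o[nhds 0] fun _ => (1 : ℝ) := by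
        rw [Asymptotics.isLittleO_one_iff]
        simpa using ((hκn 0 hx).continuousAt (isOpen_openBall.mem_nhds hx)).tendsto.sub_const
          (κ ‖(0 : 𝔼 d)‖)
      have h2 := h1.smul_isBigO (Asymptotics.isBigO_refl (fun y : 𝔼 d => y) (nhds 0))
      simpa [sub_smul] using h2
    · have h1 := ((hd ‖x‖ ((mem_openBall_iff_of_ne hx0).1 hx)).hasGradientAt_comp_norm
        hx0).hasFDerivAt
      have h2 : HasFDerivAt (fun y : 𝔼 d => y) (ContinuousLinearMap.id ℝ (𝔼 d)) x :=
        hasFDerivAt_id x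
      have h3 := HasFDerivAt.fun_smul (𝕜 := ℝ) (𝕜' := ℝ) h1 h2
      have h4 : W x = (InnerProductSpace.toDual ℝ (𝔼 d)
          ((k ‖x‖ / ‖x‖ / ‖x‖) • x)).smulRight x := by
        ext y
        simp [hW]
      rw [h4]
      exact h3
  · refine (hκn.smul continuousOn_const).add fun x hx => ?_
    rcases eq_or_ne x 0 with rfl | hx0
    · have h1 := hkn 0 hx
      rw [ContinuousWithinAt, norm_zero, hk0] at h1
      have h0 : W 0 = 0 := by ext; simp [hW]
      rw [ContinuousWithinAt, h0, tendsto_zero_iff_norm_tendsto_zero]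
      have h2 : ∀ y : 𝔼 d, ‖W y‖ = |k ‖y‖| := fun y => by
        rcases eq_or_ne y 0 with rfl | hy
        · rw [h0, norm_zero, norm_zero, hk0, abs_zero]
        · rw [hW, ContinuousLinearMap.norm_smulRight_apply, innerSL_apply_norm,
            norm_div_norm_smul fun h => absurd h hy, abs_div, abs_norm,
            div_mul_cancel₀ _ (norm_ne_zero_iff.2 hy)]
      simpa [h2] using h1.abs
    · have hn : ‖x‖ ≠ 0 := norm_ne_zero_iff.2 hx0
      have h1 : ContinuousWithinAt (fun x : 𝔼 d => (k ‖x‖ / ‖x‖ / ‖x‖) • x)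
          (openBall d R : Set (𝔼 d)) x :=
        (((hkn x hx).div continuous_norm.continuousWithinAt hn).div
          continuous_norm.continuousWithinAt hn).smul continuousWithinAt_id
      have h2 : ContinuousWithinAt (fun x : 𝔼 d => innerSL ℝ ((k ‖x‖ / ‖x‖ / ‖x‖) • x))
          (openBall d R : Set (𝔼 d)) x :=
        (innerSL ℝ : 𝔼 d →L⋆[ℝ] 𝔼 d →L[ℝ] ℝ).continuous.continuousAt.comp_continuousWithinAt h1
      have h3 : ContinuousWithinAt (fun x : 𝔼 d => ContinuousLinearMap.smulRightL ℝ (𝔼 d) (𝔼 d)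
          (innerSL ℝ ((k ‖x‖ / ‖x‖ / ‖x‖) • x))) (openBall d R : Set (𝔼 d)) x :=
        (ContinuousLinearMap.smulRightL ℝ (𝔼 d) (𝔼 d)).continuous.continuousAt.comp_continuousWithinAt
          h2
      exact h3.clm_apply continuousWithinAt_id

end RadialField

section UniqueContinuation

/-- A nonnegative function that starts from `0`, and whose derivative at `t` is at most its running
maximum up to a factor that vanishes at the starting point, stays `0` for a while. -/
lemma exists_forall_eq_zero_of_deriv_le {A b : ℝ → ℝ} {α β C p : ℝ} (hαβ : α < β) (hp : 0 < p)
    (hC : 0 ≤ C) (hA : ContinuousOn A (Icc α β)) (hA0 : ∀ t ∈ Icc α β, 0 ≤ A t)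
    (hAb : ∀ t ∈ Icc α β, A t = ∫ s in α..t, b s)
    (hb : ∀ t ∈ Icc α β, ∀ M, (∀ s ∈ Icc α t, A s ≤ M) → |b t| ^ p ≤ C * (t - α) * M ^ p) :
    ∃ T ∈ Ioc α β, ∀ t ∈ Icc α T, A t = 0 := by
  set δ := min (β - α) (min (1 / 2) (1 / (C + 1))) with hδ
  have hδ0 : 0 < δ := by positivity [sub_pos.2 hαβ]
  have hδ1 : δ ≤ β - α := min_le_left _ _
  have hδ2 : δ ≤ 1 / 2 := (min_le_right _ _).trans (min_le_left _ _)
  have hδ3 : C * δ ≤ 1 := by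
    have h1 : δ ≤ 1 / (C + 1) := (min_le_right _ _).trans (min_le_right _ _)
    rw [le_div_iff₀ (by linarith)] at h1
    linarith
  have hsub : Icc α (α + δ) ⊆ Icc α β := Icc_subset_Icc_right (by linarith)
  obtain ⟨τ, hτ, hmax⟩ := (isCompact_Icc (a := α) (b := α + δ)).exists_isMaxOn
    ⟨α, by constructor <;> linarith⟩ (hA.mono hsub)
  have hM0 : 0 ≤ A τ := hA0 τ (hsub hτ)
  have hbM : ∀ t ∈ Icc α (α + δ), |b t| ≤ A τ := by
    intro t ht
    have h1 := hb t (hsub ht) (A τ) fun s hs => hmax ⟨hs.1, hs.2.trans ht.2⟩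
    have h2 : C * (t - α) ≤ 1 :=
      (mul_le_mul_of_nonneg_left (by linarith [ht.2] : t - α ≤ δ) hC).trans hδ3
    have h3 : |b t| ^ p ≤ A τ ^ p :=
      h1.trans (mul_le_of_le_one_left (Real.rpow_nonneg hM0 _) h2)
    exact (Real.rpow_le_rpow_iff (abs_nonneg _) hM0 hp).1 h3
  have hτ0 : A τ ≤ 0 := by
    have h1 : ‖∫ s in α..τ, b s‖ ≤ A τ * |τ - α| :=
      intervalIntegral.norm_integral_le_of_norm_le_const fun s hs => by
        rw [uIoc_of_le hτ.1] at hs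
        exact hbM s ⟨hs.1.le, hs.2.trans hτ.2⟩
    rw [← hAb τ (hsub hτ), Real.norm_of_nonneg hM0, abs_of_nonneg (by linarith [hτ.1])] at h1
    have h2 : A τ * (τ - α) ≤ A τ * (1 / 2) :=
      mul_le_mul_of_nonneg_left (by linarith [hτ.2]) hM0
    linarith
  exact ⟨α + δ, ⟨by linarith, by linarith⟩, fun t ht =>
    le_antisymm ((hmax ht).trans hτ0) (hA0 t (hsub ht))⟩

end UniqueContinuation

/-! ### The radial profile of a solution of the r-Laplace problem -/

section Reaction

variable {d : ℕ} {R : ℝ≥0∞} {f : EuclideanSpace ℝ (Fin d) → ℝ → ℝ} {r lam : ℝ} {A : ℝ → ℝ}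

lemma forall_mem_radii₀_of_forall_mem_radii {a : ℝ → ℝ} (ha : ContinuousOn a (radii₀ R))
    {T : Set ℝ} (hT : IsClosed T) (h : ∀ s ∈ radii R, a s ∈ T) : ∀ s ∈ radii₀ R, a s ∈ T := by
  intro s hs
  obtain ⟨t, ht, hst⟩ := exists_gt_mem_radii hs
  rcases hs.1.eq_or_lt with rfl | hs0
  · have h1 : (0 : ℝ) ∈ closure (Ioo 0 t) := by
      rw [closure_Ioo ht.1.ne]; exact left_mem_Icc.2 ht.1.le
    have h2 : Ioo 0 t ⊆ radii R := fun y hy => mem_radii_of_le hy.1 hy.2.le ht.2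
    have h3 := ((ha 0 hs).mono (h2.trans radii_subset_radii₀)).mem_closure h1
      (fun y hy => h y (h2 hy))
    rwa [hT.closure_eq] at h3
  · exact h s ⟨hs0, hs.2⟩

/-- The zeroth order term `(f(x, φ^r) - λ) φ^{r-1}` of the `r`-Laplace equation, for a radial
function `φ` with profile `A`. -/
noncomputable def radialReaction (f : 𝔼 d → ℝ → ℝ) (r lam : ℝ) (A : ℝ → ℝ) (x : 𝔼 d) : ℝ :=
  (f x (A ‖x‖ ^ r) - lam) * A ‖x‖ ^ (r - 1)

lemma continuousOn_radialReaction (hr : 1 < r)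
    (hf : ContinuousOn (fun q : 𝔼 d × ℝ => f q.1 q.2) ((openBall d R : Set (𝔼 d)) ×ˢ Ici 0))
    {S : Set (𝔼 d)} (hS : S ⊆ openBall d R) (hA : ContinuousOn (fun x : 𝔼 d => A ‖x‖) S)
    (hA0 : ∀ x ∈ S, 0 ≤ A ‖x‖) : ContinuousOn (radialReaction f r lam A) S := by
  have h1 : ContinuousOn (fun x : 𝔼 d => f x (A ‖x‖ ^ r)) S :=
    hf.comp (continuousOn_id.prodMk (hA.rpow_const fun _ _ => Or.inr (by linarith)))
      fun x hx => ⟨hS hx, Real.rpow_nonneg (hA0 x hx) _⟩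
  exact (h1.sub continuousOn_const).mul (hA.rpow_const fun _ _ => Or.inr (by linarith))

lemma exists_abs_radialReaction_le (lam : ℝ) (hr : 1 < r)
    (hf : ContinuousOn (fun q : 𝔼 d × ℝ => f q.1 q.2) ((openBall d R : Set (𝔼 d)) ×ˢ Ici 0))
    {ρ : ℝ} (hρ : ρ ∈ radii R) (C : ℝ) :
    ∃ K, 0 ≤ K ∧ ∀ (A : ℝ → ℝ) (x : 𝔼 d), ‖x‖ ≤ ρ → 0 ≤ A ‖x‖ → A ‖x‖ ≤ C →
      |radialReaction f r lam A x| ≤ K * A ‖x‖ ^ (r - 1) := by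
  obtain ⟨K, hK⟩ := ((isCompact_closedBall (0 : 𝔼 d) ρ).prod
    (isCompact_Icc (a := (0 : ℝ)) (b := C ^ r))).exists_bound_of_continuousOn
    (hf.mono (prod_mono (closedBall_subset_openBall hρ) fun _ h => h.1))
  refine ⟨|K| + |lam|, by positivity, fun A x hx h0 hC => ?_⟩
  have h1 := hK (x, A ‖x‖ ^ r) ⟨mem_closedBall_zero_iff.2 hx, Real.rpow_nonneg h0 _,
    Real.rpow_le_rpow h0 hC (by linarith)⟩
  rw [Real.norm_eq_abs] at h1
  have h2 : |f x (A ‖x‖ ^ r) - lam| ≤ |K| + |lam| :=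
    (abs_sub _ _).trans (add_le_add_left (h1.trans (le_abs_self K)) _)
  rw [radialReaction, abs_mul, abs_of_nonneg (Real.rpow_nonneg h0 _)]
  exact mul_le_mul_of_nonneg_right h2 (Real.rpow_nonneg h0 _)

lemma MemLpLoc.exists_ae_abs_le {v : 𝔼 d → ℝ} {Ω : Opens (𝔼 d)} (hv : MemLpLoc Ω ∞ v)
    {K : Set (𝔼 d)} (hKc : IsCompact K) (hK : K ⊆ Ω) : ∃ C : ℝ, ∀ᵐ x, x ∈ K → |v x| ≤ C := by
  have h1 := (hv K hKc hK).eLpNorm_lt_top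
  rw [eLpNorm_exponent_top] at h1
  refine ⟨(eLpNormEssSup v (volume.restrict K)).toReal, ?_⟩
  rw [← ae_restrict_iff' hKc.measurableSet]
  filter_upwards [ae_le_eLpNormEssSup (f := v) (μ := volume.restrict K)] with x hx
  rw [← Real.norm_eq_abs, ← toReal_enorm]
  exact ENNReal.toReal_mono h1.ne hx

lemma rpow_sub_one_le_one_add_rpow {x : ℝ} (hx : 0 ≤ x) (hr : 1 < r) : x ^ (r - 1) ≤ 1 + x ^ r := by
  rcases le_total x 1 with h | h
  · have := Real.rpow_le_one hx h (sub_pos.2 hr).le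
    have := Real.rpow_nonneg hx r
    linarith
  · have := Real.rpow_le_rpow_of_exponent_le h (by linarith : r - 1 ≤ r)
    linarith

lemma MemLpLoc.locallyIntegrableOn_dualityMap {b : ℝ → ℝ} {G : 𝔼 d → 𝔼 d} [NeZero d]
    (hr : 1 < r) (hGp : MemLpLoc (openBall d R) (ENNReal.ofReal r) G)
    (hG : ∀ᵐ x, x ∈ openBall d R → G x = (b ‖x‖ / ‖x‖) • x) :
    LocallyIntegrableOn (fun x => dualityMap r (b ‖x‖)) (openBall d R : Set (𝔼 d)) := by
  have hr1 : 1 ≤ ENNReal.ofReal r := ENNReal.one_le_ofReal.2 hr.le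
  have hm := aestronglyMeasurable_of_radial (hGp.locallyIntegrableOn hr1).aestronglyMeasurable hG
  refine (locallyIntegrableOn_iff isOpen_openBall.isLocallyClosed).2 fun K hK hKc => ?_
  have : IsFiniteMeasure (volume.restrict K) := ⟨by simpa using hKc.measure_lt_top⟩
  have h1 := (hGp K hKc hK).integrable_norm_rpow'
  rw [ENNReal.toReal_ofReal (by linarith)] at h1
  refine Integrable.mono ((integrable_const (1 : ℝ)).add h1)
    ((continuous_dualityMap hr).comp_aestronglyMeasurable (hm.mono_set hK)) ?_
  rw [ae_restrict_iff' hKc.measurableSet]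
  filter_upwards [ae_norm_eq_of_radial hG] with x hx hxK
  have h2 := rpow_sub_one_le_one_add_rpow (norm_nonneg (G x)) hr
  have h3 : ‖dualityMap r (b ‖x‖)‖ = ‖G x‖ ^ (r - 1) := by
    rw [norm_dualityMap hr, hx (hK hxK), Real.norm_eq_abs]
  rw [h3]
  exact h2.trans (le_abs_self _)

end Reaction

section Profile

open scoped Gradient

variable {d : ℕ} [NeZero d] {R : ℝ≥0∞} {f : EuclideanSpace ℝ (Fin d) → ℝ → ℝ} {μ r r' lam : ℝ}

/-- The radial profile of a solution of the `r`-Laplace problem extends continuously to the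
origin, and the equation, integrated over balls, becomes an ordinary differential equation. -/
lemma IsRLaplaceSolution.exists_profile (hR : 0 < R) (hμ : 0 < μ) (hr : 1 < r) (hr' : 1 < r')
    (hrr' : (r - 1) * (r' - 1) = 1)
    (hf : ContinuousOn (fun q : 𝔼 d × ℝ => f q.1 q.2) ((openBall d R : Set (𝔼 d)) ×ˢ Ici 0))
    {φ : 𝔼 d → ℝ} (hsol : IsRLaplaceSolution (openBall d R) μ r f φ lam)
    (hrad : IsAERadialOn (openBall d R) φ) :
    ∃ A b : ℝ → ℝ, ContinuousOn A (radii₀ R) ∧ (∀ s ∈ radii₀ R, 0 ≤ A s) ∧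
      (∀ᵐ x, x ∈ openBall d R → φ x = A ‖x‖) ∧
      (∀ s ∈ radii R, ∀ t ∈ radii R, A t = A s + ∫ u in s..t, b u) ∧
      (∀ᵐ t, t ∈ radii R → sphereArea d * t ^ (d - 1) * (μ * dualityMap r (b t)) =
        ∫ s in (0 : ℝ)..t, radialDensity (radialReaction f r lam A) s) ∧
      ∀ ξ : 𝓓(openBall d R, ℝ),
        μ * (∫ x in (openBall d R : Set (𝔼 d)),
          inner ℝ ((dualityMap r (b ‖x‖) / ‖x‖) • x) (∇ (⇑ξ) x)) +
        (∫ x in (openBall d R : Set (𝔼 d)), radialReaction f r lam A x * ξ x) = 0 := by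
  obtain ⟨hpos, htop, ⟨Dφ, hD, heq⟩, -⟩ := hsol
  have hr1 : 1 ≤ ENNReal.ofReal r := ENNReal.one_le_ofReal.2 hr.le
  obtain ⟨A, b, hb, hA, hφA, hDb⟩ := hD.exists_profile hR hr1 hrad
  obtain ⟨s₀, hs₀⟩ := nonempty_radii hR
  have hne : ∀ᵐ x : 𝔼 d, x ≠ 0 := by simp [ae_iff]
  have hAc : ContinuousOn A (radii R) :=
    ((continuousOn_primitive_of_mem isOpen_radii ordConnected_radii hb hs₀).const_add (A s₀)).congr
      fun s hs => hA s₀ hs₀ s hs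
  rw [ae_restrict_iff' measurableSet_openBall] at hpos
  have hA0 : ∀ s ∈ radii R, 0 ≤ A s := by
    refine forall_mem_of_ae_mem (μ := volume) isOpen_radii hAc isClosed_Ici ?_
    refine ae_radii_of_ae_norm (d := d) (p := fun s => A s ∈ Ici 0) ?_
    filter_upwards [hpos, hφA] with x hx hx' hxΩ
    rw [← hx' hxΩ]
    exact (hx hxΩ).le
  -- `φ ∈ L^∞_loc` bounds the profile near the origin.
  have hbdd : ∀ ρ ∈ radii R, ∃ C, ∀ s ∈ Ioo 0 ρ, A s ∈ Iic C := by
    intro ρ hρ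
    obtain ⟨C, hC⟩ := htop.exists_ae_abs_le (isCompact_closedBall 0 ρ)
      (closedBall_subset_openBall hρ)
    have hsub : Ioo 0 ρ ⊆ radii R := fun s hs => mem_radii_of_le hs.1 hs.2.le hρ.2
    refine ⟨C, forall_mem_of_ae_mem (μ := volume) isOpen_Ioo (hAc.mono hsub) isClosed_Iic ?_⟩
    have h1 := ae_radii_of_ae_norm (d := d) (R := R) (p := fun s => s ≤ ρ → A s ≤ C) (by
      filter_upwards [hC, hφA] with x hx hx' hxΩ hxρ
      rw [← hx' hxΩ]
      exact (le_abs_self _).trans (hx (mem_closedBall_zero_iff.2 hxρ)))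
    filter_upwards [h1] with s hs hs'
    exact hs (hsub hs') hs'.2.le
  have hFbdd : ∀ ρ ∈ radii R, ∃ K, 0 ≤ K ∧ ∀ x : 𝔼 d, x ≠ 0 → ‖x‖ ≤ ρ →
      |radialReaction f r lam A x| ≤ K := by
    intro ρ hρ
    obtain ⟨ρ', hρ', hlt⟩ := exists_gt_mem_radii (radii_subset_radii₀ hρ)
    obtain ⟨C, hC⟩ := hbdd ρ' hρ'
    obtain ⟨K, hK0, hK⟩ := exists_abs_radialReaction_le lam hr hf hρ C
    refine ⟨K * |C| ^ (r - 1), by positivity, fun x hx hxρ => ?_⟩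
    have hxp : 0 < ‖x‖ := norm_pos_iff.2 hx
    have h1 : 0 ≤ A ‖x‖ := hA0 _ (mem_radii_of_le hxp hxρ hρ.2)
    have h2 : A ‖x‖ ≤ C := hC _ ⟨hxp, hxρ.trans_lt hlt⟩
    exact (hK A x hxρ h1 h2).trans (mul_le_mul_of_nonneg_left
      (Real.rpow_le_rpow h1 (h2.trans (le_abs_self C)) (by linarith)) hK0)
  have hFl : LocallyIntegrableOn (radialReaction f r lam A) (openBall d R : Set (𝔼 d)) := by
    have hm : AEStronglyMeasurable (radialReaction f r lam A)
        (volume.restrict (openBall d R : Set (𝔼 d))) := by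
      rw [← Measure.restrict_congr_set (sdiff_null_ae_eq_self (measure_singleton (0 : 𝔼 d)))]
      have hmem : ∀ x ∈ (openBall d R : Set (𝔼 d)) \ {0}, ‖x‖ ∈ radii R := fun x hx =>
        (mem_openBall_iff_of_ne hx.2).1 hx.1
      exact (continuousOn_radialReaction hr hf sdiff_subset
        (hAc.comp continuous_norm.continuousOn hmem)
        fun x hx => hA0 _ (hmem x hx)).aestronglyMeasurable
        (measurableSet_openBall.diff (measurableSet_singleton 0))
    refine (locallyIntegrableOn_iff isOpen_openBall.isLocallyClosed).2 fun K hK hKc => ?_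
    obtain ⟨ρ, hρ, hKρ⟩ := exists_ball_superset hR hKc hK
    obtain ⟨C, -, hC⟩ := hFbdd ρ hρ
    refine ⟨hm.mono_set hK, .restrict_of_bounded (C := C) hKc.measure_lt_top ?_⟩
    rw [ae_restrict_iff' hKc.measurableSet]
    filter_upwards [hne] with x hx hxK
    exact hC x hx (mem_ball_zero_iff.1 (hKρ hxK)).le
  have heq' : ∀ ξ : 𝓓(openBall d R, ℝ),
      μ * (∫ x in (openBall d R : Set (𝔼 d)),
        inner ℝ ((dualityMap r (b ‖x‖) / ‖x‖) • x) (∇ (⇑ξ) x)) +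
      (∫ x in (openBall d R : Set (𝔼 d)), radialReaction f r lam A x * ξ x) = 0 := by
    intro ξ
    refine Eq.trans (congrArg₂ (fun y z => μ * y + z) ?_ ?_) (heq ξ)
    · refine setIntegral_congr_ae measurableSet_openBall ?_
      filter_upwards [hDb, hne] with x hx hx0 hxΩ
      rw [← dualityMap_radial fun h => absurd h hx0, ← hx hxΩ, dualityMap, inner_smul_left,
        conj_trivial]
    · refine setIntegral_congr_ae measurableSet_openBall ?_
      filter_upwards [hφA] with x hx hxΩ
      rw [radialReaction, hx hxΩ]
  have hflux := flux_eq_integral_of_weak_divergence hR (w := fun t => μ * dualityMap r (b t))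
    ((hD.memLpLoc_gradient.locallyIntegrableOn_dualityMap hr hDb).smul μ) hFl (fun ξ => by
      rw [← heq' ξ, ← integral_const_mul]
      congr 1
      refine integral_congr_ae (.of_forall fun x => ?_)
      simp only [inner_smul_left, conj_trivial]
      ring)
  -- The flux through the sphere of radius `t` is `O(t^d)`, so `b` is bounded near the origin.
  have hbb : ∀ ρ ∈ radii R, IntervalIntegrable b volume 0 ρ := by
    intro ρ hρ
    obtain ⟨K, hK0, hK⟩ := hFbdd ρ hρ
    rw [intervalIntegrable_iff_integrableOn_Ioc_of_le hρ.1.le]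
    have hsub : Ioc 0 ρ ⊆ radii R := fun s hs => mem_radii_of_le hs.1 hs.2 hρ.2
    refine ⟨hb.aestronglyMeasurable.mono_set hsub,
      .restrict_of_bounded (C := (K * ρ / μ) ^ (r' - 1)) measure_Ioc_lt_top ?_⟩
    rw [ae_restrict_iff' measurableSet_Ioc]
    filter_upwards [hflux] with t ht htρ
    have hpow : 0 < t ^ (d - 1) := pow_pos htρ.1 _
    have h1 : ‖∫ s in (0 : ℝ)..t, radialDensity (radialReaction f r lam A) s‖ ≤
        t ^ (d - 1) * (sphereArea d * K) * |t - 0| := by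
      refine intervalIntegral.norm_integral_le_of_norm_le_const fun s hs => ?_
      rw [uIoc_of_le htρ.1.le] at hs
      rw [radialDensity, norm_mul, norm_pow, Real.norm_of_nonneg hs.1.le]
      refine mul_le_mul (pow_le_pow_left₀ hs.1.le hs.2 _) ?_ (norm_nonneg _) hpow.le
      refine abs_sphereIntegral_le fun σ => ?_
      have hn := norm_smul_sphere hs.1.le σ
      refine hK _ (fun h => ?_) (by rw [hn]; exact hs.2.trans htρ.2)
      rw [h, norm_zero] at hn
      exact hs.1.ne hn
    rw [← ht (hsub htρ), sub_zero, abs_of_pos htρ.1, norm_mul, norm_mul, norm_mul,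
      Real.norm_of_nonneg sphereArea_pos.le, Real.norm_of_nonneg hpow.le,
      Real.norm_of_nonneg hμ.le] at h1
    have h2 : ‖dualityMap r (b t)‖ ≤ K * ρ / μ := by
      rw [le_div_iff₀ hμ]
      have h3 : (sphereArea d * t ^ (d - 1)) * (μ * ‖dualityMap r (b t)‖) ≤
          (sphereArea d * t ^ (d - 1)) * (K * t) := h1.trans_eq (by ring)
      have h4 := le_of_mul_le_mul_left h3 (mul_pos sphereArea_pos hpow)
      have h5 := mul_le_mul_of_nonneg_left htρ.2 hK0
      linarith
    rw [← dualityMap_dualityMap hr hrr' (b t), norm_dualityMap hr']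
    exact Real.rpow_le_rpow (norm_nonneg _) h2 (by linarith)
  set B : ℝ → ℝ := fun s => A s₀ + ∫ u in s₀..s, b u with hB
  have hBA : ∀ s ∈ radii R, B s = A s := fun s hs => (hA s₀ hs₀ s hs).symm
  have hBc : ContinuousOn B (radii₀ R) := by
    refine continuousOn_const.add fun s hs => ?_
    obtain ⟨t, ht, hst⟩ := exists_gt_mem_radii
      (show max s s₀ ∈ radii₀ R by rcases max_choice s s₀ with h | h <;> rw [h]
                                   exacts [hs, radii_subset_radii₀ hs₀])
    have h1 := intervalIntegral.continuousOn_primitive_interval' (hbb t ht) (a := s₀) (by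
      rw [uIcc_of_le ht.1.le]; exact ⟨hs₀.1.le, (le_max_right _ _).trans hst.le⟩)
    rw [uIcc_of_le ht.1.le] at h1
    refine (h1 s ⟨hs.1, (le_max_left _ _).trans hst.le⟩).mono_of_mem_nhdsWithin ?_
    filter_upwards [self_mem_nhdsWithin,
      mem_nhdsWithin_of_mem_nhds (Iio_mem_nhds ((le_max_left _ _).trans_lt hst))] with y hy hyt
    exact ⟨hy.1, le_of_lt hyt⟩
  have hFB : ∀ x ∈ openBall d R, x ≠ 0 →
      radialReaction f r lam B x = radialReaction f r lam A x := fun x hx hx0 => by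
    rw [radialReaction, radialReaction, hBA _ ((mem_openBall_iff_of_ne hx0).1 hx)]
  refine ⟨B, b, hBc, ?_, ?_, fun s hs t ht => ?_, ?_, fun ξ => ?_⟩
  · exact forall_mem_radii₀_of_forall_mem_radii hBc isClosed_Ici fun s hs => by
      rw [hBA s hs]; exact hA0 s hs
  · filter_upwards [hφA, hne] with x hx hx0 hxΩ
    rw [hx hxΩ, hBA _ ((mem_openBall_iff_of_ne hx0).1 hxΩ)]
  · rw [hBA s hs, hBA t ht, hA s hs t ht]
  · filter_upwards [hflux] with t ht htR
    rw [ht htR]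
    refine intervalIntegral.integral_congr_ae (.of_forall fun s hs => ?_)
    rw [uIoc_of_le htR.1.le] at hs
    have hsR : s ∈ radii R := mem_radii_of_le hs.1 hs.2 htR.2
    rw [radialDensity, radialDensity, sphereIntegral, sphereIntegral]
    congr 1
    refine integral_congr_ae (.of_forall fun σ => ?_)
    simp only [radialReaction, norm_smul_sphere hs.1.le, hBA s hsR]
  · refine Eq.trans ?_ (heq' ξ)
    congr 1
    refine setIntegral_congr_ae measurableSet_openBall ?_
    filter_upwards [hne] with x hx0 hxΩ
    rw [hFB x hxΩ hx0]

end Profile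

/-! ### From the r-Laplace problem to the Mean Field Games system -/

section ProfileODE

variable {d : ℕ} {R : ℝ≥0∞} {r r' : ℝ} {A a : ℝ → ℝ}

/-- A profile whose almost everywhere derivative has a continuous representative is `C¹` up to the
origin. -/
lemma hasDerivWithinAt_profile (hR : 0 < R) (hr' : 1 < r') {b : ℝ → ℝ}
    (hA : ContinuousOn A (radii₀ R)) (ha : ContinuousOn a (radii₀ R))
    (hAb : ∀ s ∈ radii R, ∀ t ∈ radii R, A t = A s + ∫ u in s..t, b u)
    (hb : ∀ᵐ t, t ∈ radii R → b t = dualityMap r' (t * fluxRatio d a t)) :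
    ∀ s ∈ radii₀ R, HasDerivWithinAt A (dualityMap r' (s * fluxRatio d a s)) (Ici 0) s := by
  set z : ℝ → ℝ := fun s => dualityMap r' (s * fluxRatio d a s) with hz
  have hzc : ContinuousOn z (radii₀ R) :=
    (continuous_dualityMap hr').comp_continuousOn (continuousOn_id.mul (continuousOn_fluxRatio ha))
  have hd := fun s (hs : s ∈ radii₀ R) => hasDerivWithinAt_primitive hzc hs
  have hi : ∀ s ∈ radii₀ R, IntervalIntegrable z volume 0 s := fun s hs =>
    (hzc.mono (by
      rw [uIcc_of_le hs.1]
      exact fun y hy => mem_radii₀_of_le hy.1 hy.2 hs.2)).intervalIntegrable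
  obtain ⟨s₀, hs₀⟩ := nonempty_radii hR
  set c := A s₀ - ∫ u in (0 : ℝ)..s₀, z u with hc
  have h1 : ∀ s ∈ radii R, A s - (∫ u in (0 : ℝ)..s, z u) ∈ ({c} : Set ℝ) := by
    intro s hs
    have h2 : ∫ u in s₀..s, b u = ∫ u in s₀..s, z u := by
      refine intervalIntegral.integral_congr_ae ?_
      filter_upwards [hb] with u hu hu'
      exact hu (ordConnected_radii.uIcc_subset hs₀ hs (uIoc_subset_uIcc hu'))
    have h3 := intervalIntegral.integral_interval_sub_left (hi s (radii_subset_radii₀ hs))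
      (hi s₀ (radii_subset_radii₀ hs₀))
    rw [mem_singleton_iff, hAb s₀ hs₀ s hs, h2, hc]
    linarith
  have h4 := forall_mem_radii₀_of_forall_mem_radii (hA.sub (continuousOn_of_hasDerivWithinAt hd))
    isClosed_singleton h1
  intro s hs
  have h5 : ∀ y ∈ radii₀ R, A y = c + ∫ u in (0 : ℝ)..y, z u := fun y hy => by
    have : A y - (∫ u in (0 : ℝ)..y, z u) = c := h4 y hy
    linarith
  refine ((hd s hs).const_add c).congr_of_eventuallyEq ?_ (h5 s hs)
  obtain ⟨t, ht, hst⟩ := exists_gt_mem_radii hs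
  filter_upwards [self_mem_nhdsWithin, mem_nhdsWithin_of_mem_nhds (Iio_mem_nhds hst)] with y hy hyt
  exact h5 y (mem_radii₀_of_le hy (le_of_lt hyt) ht.2)

variable [NeZero d]

/-- The strong maximum principle for the radial `r`-Laplace equation: a nonnegative profile that
does not vanish on an interval is positive. At a zero of `A` also `A'` and the flux vanish, and
`exists_forall_eq_zero_of_deriv_le` applies. -/
lemma pos_of_hasDerivWithinAt_profile (hr : 1 < r) (hr' : 1 < r') (hrr' : (r - 1) * (r' - 1) = 1)
    (hA : ContinuousOn A (radii₀ R)) (ha : ContinuousOn a (radii₀ R))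
    (hA0 : ∀ s ∈ radii₀ R, 0 ≤ A s) (hpos : ∀ᵐ s, s ∈ radii R → 0 < A s)
    (hd : ∀ s ∈ radii₀ R, HasDerivWithinAt A (dualityMap r' (s * fluxRatio d a s)) (Ici 0) s)
    (hbound : ∀ ρ ∈ radii R, ∃ K, 0 ≤ K ∧ ∀ s ∈ Icc 0 ρ, |a s| ≤ K * A s ^ (r - 1)) :
    ∀ s ∈ radii₀ R, 0 < A s := by
  intro α hα
  by_contra hneg
  have hAα : A α = 0 := le_antisymm (not_lt.1 hneg) (hA0 α hα)
  have hflux : α ^ d * fluxRatio d a α = 0 := by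
    rcases hα.1.eq_or_lt with rfl | hα0
    · simp [NeZero.ne d]
    · have hloc : IsLocalMin A α := by
        filter_upwards [isOpen_radii.mem_nhds ⟨hα0, hα.2⟩] with s hs
        rw [hAα]; exact hA0 s (radii_subset_radii₀ hs)
      have h1 := hloc.hasDerivAt_eq_zero ((hd α hα).hasDerivAt (Ici_mem_nhds hα0))
      have h2 := dualityMap_dualityMap hr' (by rw [mul_comm]; exact hrr')
        (α * fluxRatio d a α)
      rw [h1, dualityMap_zero] at h2
      rw [(mul_eq_zero.1 h2.symm).resolve_left hα0.ne', mul_zero]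
  obtain ⟨β, hβ, hαβ⟩ := exists_gt_mem_radii hα
  have hsub : Icc α β ⊆ radii₀ R := fun s hs => mem_radii₀_of_le (hα.1.trans hs.1) hs.2 hβ.2
  obtain ⟨K, hK0, hK⟩ := hbound β hβ
  set z : ℝ → ℝ := fun s => dualityMap r' (s * fluxRatio d a s) with hz
  have hzc : ContinuousOn z (radii₀ R) :=
    (continuous_dualityMap hr').comp_continuousOn (continuousOn_id.mul (continuousOn_fluxRatio ha))
  have hgc : ContinuousOn (fun t => t ^ (d - 1) * a t) (radii₀ R) := (continuousOn_pow _).mul ha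
  have hii : ∀ {g : ℝ → ℝ}, ContinuousOn g (radii₀ R) → ∀ {s t}, s ∈ radii₀ R → t ∈ radii₀ R →
      IntervalIntegrable g volume s t := fun hg _ _ hs ht =>
    (hg.mono (ordConnected_radii₀.uIcc_subset hs ht)).intervalIntegrable
  obtain ⟨T, hT, hAT⟩ := exists_forall_eq_zero_of_deriv_le (A := A) (b := z) (p := r - 1) hαβ
    (sub_pos.2 hr) hK0 (hA.mono hsub) (fun t ht => hA0 t (hsub ht)) (fun t ht => by
      have h1 := intervalIntegral.integral_eq_sub_of_hasDeriv_right_of_le ht.1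
        (hA.mono ((Icc_subset_Icc_right ht.2).trans hsub))
        (fun s hs => (hd s (hsub ⟨hs.1.le, hs.2.le.trans ht.2⟩)).mono
          fun y hy => (hα.1.trans hs.1.le).trans (le_of_lt hy)) (hii hzc hα (hsub ht))
      rw [h1, hAα, sub_zero]) (fun t ht M hM => by
      have hM0 : 0 ≤ M := hAα.symm.le.trans (hM α ⟨le_rfl, ht.1⟩)
      have h1 : |z t| ^ (r - 1) = |t * fluxRatio d a t| := by
        rw [hz, ← Real.norm_eq_abs, norm_dualityMap hr', ← Real.rpow_mul (norm_nonneg _),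
          mul_comm (r' - 1), hrr', Real.rpow_one, Real.norm_eq_abs]
      have hrhs : 0 ≤ K * (t - α) * M ^ (r - 1) :=
        mul_nonneg (mul_nonneg hK0 (sub_nonneg.2 ht.1)) (Real.rpow_nonneg hM0 _)
      rw [h1]
      have ht0 : 0 ≤ t := hα.1.trans ht.1
      rcases ht0.eq_or_lt with h0 | h0
      · simpa [← h0] using hrhs
      have h2 := intervalIntegral.integral_interval_sub_left
        (hii hgc (mem_radii₀_of_le le_rfl ht0 (hsub ht).2) (hsub ht))
        (hii hgc (mem_radii₀_of_le le_rfl ht0 (hsub ht).2) hα)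
      rw [← pow_mul_fluxRatio ht0, ← pow_mul_fluxRatio hα.1, hflux, sub_zero] at h2
      have h3 : ‖∫ s in α..t, s ^ (d - 1) * a s‖ ≤ t ^ (d - 1) * (K * M ^ (r - 1)) * |t - α| := by
        refine intervalIntegral.norm_integral_le_of_norm_le_const fun s hs => ?_
        rw [uIoc_of_le ht.1] at hs
        have hs0 : 0 ≤ s := hα.1.trans hs.1.le
        have hsβ : s ≤ β := hs.2.trans ht.2
        rw [norm_mul, norm_pow, Real.norm_of_nonneg hs0]
        refine mul_le_mul (pow_le_pow_left₀ hs0 hs.2 _) ((hK s ⟨hs0, hsβ⟩).trans ?_)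
          (norm_nonneg _) (pow_nonneg ht0 _)
        exact mul_le_mul_of_nonneg_left (Real.rpow_le_rpow (hA0 s (hsub ⟨hs.1.le, hsβ⟩))
          (hM s ⟨hs.1.le, hs.2⟩) (by linarith)) hK0
      have hd1 : t ^ d = t ^ (d - 1) * t := by
        rw [← pow_succ, Nat.sub_add_cancel (NeZero.one_le)]
      have hp : 0 < t ^ (d - 1) := pow_pos h0 _
      rw [← h2, hd1, mul_assoc, norm_mul, Real.norm_of_nonneg hp.le, mul_assoc,
        abs_of_nonneg (sub_nonneg.2 ht.1)] at h3
      exact (le_of_mul_le_mul_left h3 hp).trans_eq (by ring))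
  -- the vanishing of `A` on an interval contradicts its positivity almost everywhere
  have h5 := forall_mem_of_ae_mem (μ := volume) (isOpen_Ioo (a := α) (b := T))
    (a := fun _ => (0 : ℝ)) continuousOn_const isClosed_empty (by
      filter_upwards [hpos] with s hs hs'
      have h6 := hs (mem_radii_of_le (hα.1.trans_lt hs'.1) (hs'.2.le.trans hT.2) hβ.2)
      rw [hAT s ⟨hs'.1.le, hs'.2.le⟩] at h6
      exact absurd h6 (lt_irrefl 0))
  exact h5 ((α + T) / 2) ⟨by linarith [hT.1], by linarith [hT.1]⟩

variable {ν h₀ : ℝ}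

open scoped Gradient in
/-- The value function `u` with `Du = -c Φ^{1-r} V`, `c = (ν r / h₀)^{r-1}`, where `V` is the `C¹`
vector field with `|DΦ|^{r-2} DΦ = V`. -/
lemma exists_isConjugatePair (hν : 0 < ν) (hh₀ : 0 < h₀) (hr : 1 < r) (hr' : 1 < r')
    (hrr' : (r - 1) * (r' - 1) = 1) (ha : ContinuousOn a (radii₀ R))
    (hpos : ∀ s ∈ radii₀ R, 0 < A s)
    (hd : ∀ s ∈ radii₀ R, HasDerivWithinAt A (dualityMap r' (s * fluxRatio d a s)) (Ici 0) s) :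
    ∃ u : 𝔼 d → ℝ, IsRadialOn (openBall d R) u ∧
      IsConjugatePair (openBall d R) ν h₀ r r' u (fun x => A ‖x‖)
        (fun x => (dualityMap r' (‖x‖ * fluxRatio d a ‖x‖) / ‖x‖) • x) := by
  set κ : ℝ → ℝ := fluxRatio d a with hκ
  have hκc : ContinuousOn κ (radii₀ R) := continuousOn_fluxRatio ha
  have hAc : ContinuousOn A (radii₀ R) := continuousOn_of_hasDerivWithinAt hd
  have hbc : ContinuousOn (fun s => dualityMap r' (s * κ s)) (radii₀ R) :=
    (continuous_dualityMap hr').comp_continuousOn (continuousOn_id.mul hκc)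
  set c : ℝ := (ν * r / h₀) ^ (r - 1) with hc
  have hc0 : 0 < c := Real.rpow_pos_of_pos (by positivity) _
  set z : ℝ → ℝ := fun s => -(c * A s ^ (1 - r)) * (s * κ s) with hz
  have hzc : ContinuousOn z (radii₀ R) :=
    (continuousOn_const.mul (hAc.rpow_const fun s hs => Or.inl (hpos s hs).ne')).neg.mul
      (continuousOn_id.mul hκc)
  have hΦ : ∀ x ∈ openBall d R, HasGradientAt (fun x : 𝔼 d => A ‖x‖)
      ((dualityMap r' (‖x‖ * κ ‖x‖) / ‖x‖) • x) x := fun x hx =>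
    hasGradientAt_comp_norm (h' := fun s => dualityMap r' (s * κ s)) (by simp)
      (hd _ (mem_openBall_iff.1 hx))
  have hΦ1 : ContDiffOn ℝ 1 (fun x : 𝔼 d => A ‖x‖) (openBall d R : Set (𝔼 d)) :=
    contDiffOn_one_of_hasGradientAt hΦ (continuousOn_div_norm_smul
      (k := fun s => dualityMap r' (s * κ s)) (fun x hx => mem_openBall_iff.1 hx) hbc (by simp))
  have hV : ContDiffOn ℝ 1 (fun x : 𝔼 d => κ ‖x‖ • x) (openBall d R : Set (𝔼 d)) :=
    contDiffOn_comp_norm_smul hκc (k := fun s => a s - d * κ s)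
      (ha.sub (continuousOn_const.mul hκc)) (sub_eq_zero.2 mul_fluxRatio_zero.symm)
      fun s hs => hasDerivAt_fluxRatio ha hs
  have hu : ∀ x ∈ openBall d R, HasGradientAt (fun x : 𝔼 d => ∫ t in (0 : ℝ)..‖x‖, z t)
      ((z ‖x‖ / ‖x‖) • x) x := fun x hx =>
    hasGradientAt_comp_norm (h := fun s => ∫ t in (0 : ℝ)..s, z t) (by simp [hz])
      (hasDerivWithinAt_primitive hzc (mem_openBall_iff.1 hx))
  have hzx : ∀ x : 𝔼 d, (z ‖x‖ / ‖x‖) • x = -(c * A ‖x‖ ^ (1 - r)) • κ ‖x‖ • x := fun x => by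
    rcases eq_or_ne x 0 with rfl | hx
    · simp
    · have := norm_ne_zero_iff.2 hx
      rw [smul_smul, hz]
      congr 1
      field_simp
  refine ⟨fun x => ∫ t in (0 : ℝ)..‖x‖, z t, ⟨fun s => ∫ t in (0 : ℝ)..s, z t, fun _ _ => rfl⟩,
    contDiffOn_two_of_hasGradientAt hu ?_, fun x hx => hpos _ (mem_openBall_iff.1 hx), hΦ,
    fun x hx => ?_⟩
  · simp only [hzx]
    exact ((contDiffOn_const.mul (hΦ1.rpow_const_of_ne
      fun x hx => (hpos _ (mem_openBall_iff.1 hx)).ne')).neg).smul hV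
  · have hAx : 0 < A ‖x‖ := hpos _ (mem_openBall_iff.1 hx)
    have h1 : dualityMap r' (z ‖x‖) =
        -(ν * r / h₀ * (A ‖x‖)⁻¹) * dualityMap r' (‖x‖ * κ ‖x‖) := by
      rw [hz]
      change dualityMap r' (-(c * A ‖x‖ ^ (1 - r)) • (‖x‖ * κ ‖x‖)) = _
      rw [dualityMap_smul, dualityMap_neg,
        dualityMap_of_pos (mul_pos hc0 (Real.rpow_pos_of_pos hAx _)),
        Real.mul_rpow hc0.le (Real.rpow_nonneg hAx.le _), hc,
        ← Real.rpow_mul (by positivity), ← Real.rpow_mul hAx.le, hrr', Real.rpow_one,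
        show (1 - r) * (r' - 1) = -1 by linear_combination -hrr', Real.rpow_neg_one, smul_eq_mul]
    rw [(hu x hx).gradient, dualityMap_radial (fun h => by simp [h, hz]), h1, smul_smul]
    congr 1
    field_simp

end ProfileODE

section Reverse

open scoped Gradient ContDiff

variable {d : ℕ} {R : ℝ≥0∞} {ν h₀ r r' lam : ℝ}

lemma ContDiffOn.continuousOn_laplacian {Ω : Opens (𝔼 d)} {u : 𝔼 d → ℝ}
    (hu : ContDiffOn ℝ 2 u (Ω : Set (𝔼 d))) :
    ContinuousOn (Laplacian.laplacian u) (Ω : Set (𝔼 d)) := by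
  have hDu : ContDiffOn ℝ 1 (fderiv ℝ u) (Ω : Set (𝔼 d)) :=
    hu.fderiv_of_isOpen Ω.isOpen (by norm_num)
  have hD2 := hDu.continuousOn_fderiv_of_isOpen Ω.isOpen le_rfl
  rw [InnerProductSpace.laplacian_eq_iteratedFDeriv_orthonormalBasis u
    (EuclideanSpace.basisFun (Fin d) ℝ)]
  simp only [iteratedFDeriv_two_apply]
  exact continuousOn_finsetSum _ fun i _ =>
    (hD2.clm_apply continuousOn_const).clm_apply continuousOn_const

variable [NeZero d]

theorem IsRLaplaceSolution.exists_isMFGSolution (hR : 0 < R) (hν : 0 < ν) (hh₀ : 0 < h₀)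
    (hr : 1 < r) (hr' : 1 < r') (hrr' : (r - 1) * (r' - 1) = 1) {f : 𝔼 d → ℝ → ℝ}
    (hf : ContinuousOn (fun q : 𝔼 d × ℝ => f q.1 q.2) ((openBall d R : Set (𝔼 d)) ×ˢ Ici 0))
    {m φ : 𝔼 d → ℝ} (hmφ : ∀ᵐ x ∂volume.restrict (openBall d R : Set (𝔼 d)), m x = φ x ^ r)
    (hsol : IsRLaplaceSolution (openBall d R) (ν * (ν * r / h₀) ^ (r - 1)) r f φ lam)
    (hrad : IsAERadialOn (openBall d R) φ) :
    ∃ u : 𝔼 d → ℝ, IsMFGSolution (openBall d R) ν (powerHamiltonian d h₀ r') f u m lam ∧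
      IsRadialOn (openBall d R) u := by
  set μ := ν * (ν * r / h₀) ^ (r - 1) with hμ_def
  have hμ : 0 < μ := mul_pos hν (Real.rpow_pos_of_pos (by positivity) _)
  obtain ⟨A, b, hA, hA0, hφA, hAb, hflux, heq⟩ := hsol.exists_profile hR hμ hr hr' hrr' hf hrad
  have hmem : ∀ x ∈ openBall d R, ‖x‖ ∈ radii₀ R := fun x hx => mem_openBall_iff.1 hx
  set F : 𝔼 d → ℝ := radialReaction f r lam A with hF
  have hFc : ContinuousOn F (openBall d R : Set (𝔼 d)) :=
    continuousOn_radialReaction hr hf subset_rfl (hA.comp continuous_norm.continuousOn hmem)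
      fun x hx => hA0 _ (hmem x hx)
  set a : ℝ → ℝ := fun s => sphereIntegral F s / (μ * sphereArea d) with ha_def
  have hμa : 0 < μ * sphereArea d := mul_pos hμ sphereArea_pos
  have ha : ContinuousOn a (radii₀ R) := (continuousOn_sphereIntegral hFc).div_const _
  have hJb : ∀ᵐ t, t ∈ radii R → dualityMap r (b t) = t * fluxRatio d a t := by
    filter_upwards [hflux] with t ht htR
    have h1 : ∫ s in (0 : ℝ)..t, radialDensity F s =
        μ * sphereArea d * (t ^ d * fluxRatio d a t) := by
      rw [pow_mul_fluxRatio htR.1.le, ← intervalIntegral.integral_const_mul]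
      refine intervalIntegral.integral_congr fun s _ => ?_
      have := (sphereArea_pos (d := d)).ne'
      simp only [radialDensity, ha_def]
      field_simp
    have h2 := ht htR
    have hd1 : t ^ d = t ^ (d - 1) * t := by
      rw [← pow_succ, Nat.sub_add_cancel (NeZero.one_le)]
    rw [h1, hd1] at h2
    refine mul_left_cancel₀ (mul_pos hμa (pow_pos htR.1 (d - 1))).ne' ?_
    linear_combination h2
  have hd := hasDerivWithinAt_profile hR hr' hA ha hAb (by
    filter_upwards [hJb] with t ht htR
    rw [← ht htR, dualityMap_dualityMap hr hrr'])
  have hsolpos := hsol.pos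
  rw [ae_restrict_iff' measurableSet_openBall] at hsolpos
  have hpos : ∀ s ∈ radii₀ R, 0 < A s := by
    refine pos_of_hasDerivWithinAt_profile hr hr' hrr' hA ha hA0 ?_ hd fun ρ hρ => ?_
    · refine ae_radii_of_ae_norm (d := d) (p := fun s => 0 < A s) ?_
      filter_upwards [hsolpos, hφA] with x hx hx' hxΩ
      rw [← hx' hxΩ]
      exact hx hxΩ
    · have hsub : Icc 0 ρ ⊆ radii₀ R := fun s hs => mem_radii₀_of_le hs.1 hs.2 hρ.2
      obtain ⟨C, hC⟩ := isCompact_Icc.exists_bound_of_continuousOn (hA.mono hsub)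
      obtain ⟨K, hK0, hK⟩ := exists_abs_radialReaction_le lam hr hf hρ C
      refine ⟨K / μ, by positivity, fun s hs => ?_⟩
      have h1 : |sphereIntegral F s| ≤ sphereArea d * (K * A s ^ (r - 1)) := by
        refine abs_sphereIntegral_le fun σ => ?_
        have hn := norm_smul_sphere hs.1 σ
        have h2 := hK A (s • (σ : 𝔼 d)) (by rw [hn]; exact hs.2)
        rw [hn] at h2
        exact h2 (hA0 s (hsub hs)) ((le_abs_self _).trans (hC s hs))
      rw [ha_def, abs_div, abs_of_pos hμa, div_le_iff₀ hμa]
      refine h1.trans_eq ?_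
      field_simp
  obtain ⟨u, hurad, hpair⟩ := exists_isConjugatePair hν hh₀ hr hr' hrr' ha hpos hd
  have hmA : ∀ᵐ x ∂volume.restrict (openBall d R : Set (𝔼 d)), A ‖x‖ ^ r = m x := by
    filter_upwards [hmφ, (ae_restrict_iff' measurableSet_openBall).2 hφA] with x hx hx'
    rw [hx, hx']
  -- The two equations differ by a positive factor.
  set E : 𝔼 d → ℝ := fun x => ν * Laplacian.laplacian u x - powerHamiltonian d h₀ r' (∇ u x) +
    (f x (A ‖x‖ ^ r) - lam) with hE
  have hΦc : ContinuousOn (fun x : 𝔼 d => A ‖x‖ ^ (r - 1)) (openBall d R : Set (𝔼 d)) :=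
    hpair.continuousOn.rpow_const fun _ _ => Or.inr (by linarith)
  have hHc : ContinuousOn (fun x => powerHamiltonian d h₀ r' (∇ u x))
      (openBall d R : Set (𝔼 d)) :=
    continuousOn_const.mul (hpair.continuousOn_gradient_value.norm.rpow_const
      fun _ _ => Or.inr (by linarith))
  have hLc : ContinuousOn (fun x => (ν * Laplacian.laplacian u x -
      powerHamiltonian d h₀ r' (∇ u x)) * A ‖x‖ ^ (r - 1)) (openBall d R : Set (𝔼 d)) :=
    ((continuousOn_const.mul hpair.contDiffOn.continuousOn_laplacian).sub hHc).mul hΦc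
  have hEc : ContinuousOn (fun x => E x * A ‖x‖ ^ (r - 1)) (openBall d R : Set (𝔼 d)) :=
    (hLc.add hFc).congr fun x _ => by simp only [hE, hF, Pi.add_apply, radialReaction]; ring
  have hint : ∀ {w : 𝔼 d → ℝ}, ContinuousOn w (openBall d R : Set (𝔼 d)) →
      ∀ ξ : 𝓓(openBall d R, ℝ), Integrable fun x => w x * ξ x := fun hw ξ =>
    integrable_mul_of_support (hw.locallyIntegrableOn measurableSet_openBall) ξ.contDiff.continuous
      ξ.hasCompactSupport ξ.tsupport_subset
  have hE0 : ∀ ξ : 𝓓(openBall d R, ℝ),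
      ∫ x in (openBall d R : Set (𝔼 d)), E x * A ‖x‖ ^ (r - 1) * ξ x = 0 := by
    intro ξ
    have h1 := hpair.integral_flux hν hh₀ hr hr' hrr' ξ
    rw [← hμ_def] at h1
    have hne : ∀ᵐ x : 𝔼 d, x ≠ 0 := by simp [ae_iff]
    have h2 : ∫ x in (openBall d R : Set (𝔼 d)),
          inner ℝ ((dualityMap r (b ‖x‖) / ‖x‖) • x) (∇ (⇑ξ) x) =
        ∫ x in (openBall d R : Set (𝔼 d)),
          ‖(dualityMap r' (‖x‖ * fluxRatio d a ‖x‖) / ‖x‖) • x‖ ^ (r - 2) *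
            inner ℝ ((dualityMap r' (‖x‖ * fluxRatio d a ‖x‖) / ‖x‖) • x) (∇ (⇑ξ) x) := by
      refine setIntegral_congr_ae measurableSet_openBall ?_
      filter_upwards [ae_norm_of_ae_radii (d := d) hJb, hne] with x hx hx0 hxΩ
      rw [← conj_trivial (‖_‖ ^ (r - 2)), ← inner_smul_left]
      change _ = inner ℝ (dualityMap r _) _
      rw [dualityMap_radial fun h => absurd h hx0,
        dualityMap_dualityMap hr' (by rw [mul_comm]; exact hrr'), hx hxΩ]
    have h3 := heq ξ
    rw [h2, h1, ← integral_add (hint hLc ξ).integrableOn (hint hFc ξ).integrableOn] at h3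
    rw [← h3]
    refine integral_congr_ae (.of_forall fun x => ?_)
    simp only [hE, hF, radialReaction]
    ring
  have hEz : ∀ x ∈ openBall d R, E x * A ‖x‖ ^ (r - 1) ∈ ({0} : Set ℝ) := by
    refine forall_mem_of_ae_mem (μ := volume) isOpen_openBall hEc isClosed_singleton ?_
    refine isOpen_openBall.ae_eq_zero_of_integral_contDiff_smul_eq_zero
      (hEc.locallyIntegrableOn measurableSet_openBall) fun g hg hgc hgs => ?_
    have h1 := hE0 ⟨g, hg, hgc, hgs⟩
    rw [setIntegral_eq_of_tsupport (Ω := openBall d R) (fun x hx => by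
      have : g x = 0 := image_eq_zero_of_notMem_tsupport fun hh => hx (hgs hh)
      change E x * A ‖x‖ ^ (r - 1) * g x = 0
      rw [this, mul_zero])] at h1
    rw [← h1]
    refine integral_congr_ae (.of_forall fun x => ?_)
    exact mul_comm _ _
  refine ⟨u, ⟨hpair.contDiffOn, ⟨fun x => A ‖x‖ ^ r, hmA, fun x hx => ?_⟩, ?_, ?_⟩, hurad⟩
  · have hAx := hpos _ (hmem x hx)
    refine ⟨Real.rpow_nonneg hAx.le _, ?_⟩
    have h1 : E x = 0 :=
      (mul_eq_zero.1 (hEz x hx)).resolve_right (Real.rpow_pos_of_pos hAx _).ne'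
    simp only [hE] at h1
    linarith
  · have hDm := fun x (hx : x ∈ openBall d R) => hpair.hasGradientAt_density hν hr hr' hx
    refine ⟨_, (hasWeakGradientLoc_of_hasGradientAt 2 hDm ?_).congr_left hmA, fun ξ => ?_⟩
    · simp only [gradient_powerHamiltonian hr']
      exact (continuousOn_const.mul (hpair.continuousOn.rpow_const
        fun _ _ => Or.inr (by linarith))).neg.smul (((continuous_dualityMap hr').comp_continuousOn
          hpair.continuousOn_gradient_value).const_smul h₀)
    · rw [← integral_const_mul, ← eq_neg_iff_add_eq_zero, ← integral_neg]
      refine integral_congr_ae ?_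
      filter_upwards [hmA] with x hx
      rw [← hx, inner_smul_left, conj_trivial]
      field_simp
  · rw [← hsol.integral_eq_one]
    exact integral_congr_ae hmφ

end Reverse

theorem corollary2 (d : ℕ) (hd : 1 ≤ d) (R : ℝ≥0∞) (hR : 0 < R)
    (ν h₀ r r' : ℝ) (hν : 0 < ν) (hh₀ : 0 < h₀) (hr : 1 < r) (hr' : r' = r / (r - 1))
    (f : EuclideanSpace ℝ (Fin d) → ℝ → ℝ)
    (hf : ContDiffOn ℝ 1 (fun q : EuclideanSpace ℝ (Fin d) × ℝ => f q.1 q.2)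
      ((openBall d R : Set (EuclideanSpace ℝ (Fin d))) ×ˢ Ici 0))
    (m φ : EuclideanSpace ℝ (Fin d) → ℝ) (lam : ℝ)
    (hm : ∀ᵐ x ∂volume.restrict (openBall d R : Set (EuclideanSpace ℝ (Fin d))), 0 ≤ m x)
    (hφ : ∀ᵐ x ∂volume.restrict (openBall d R : Set (EuclideanSpace ℝ (Fin d))),
      φ x = m x ^ (1 / r)) :
    (∃ u : EuclideanSpace ℝ (Fin d) → ℝ,
        IsMFGSolution (openBall d R) ν (powerHamiltonian d h₀ r') f u m lam ∧
          IsRadialOn (openBall d R) u ∧ IsAERadialOn (openBall d R) m) ↔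
      IsRLaplaceSolution (openBall d R) (ν * (ν * r / h₀) ^ (r - 1)) r f φ lam ∧
        IsAERadialOn (openBall d R) φ := by
  have : NeZero d := ⟨by lia⟩
  have hr0 : 0 < r - 1 := sub_pos.2 hr
  have hr'1 : 1 < r' := by rw [hr', lt_div_iff₀ hr0]; linarith
  have hrr' : (r - 1) * (r' - 1) = 1 := by rw [hr']; field_simp; ring
  have hmφ : ∀ᵐ x ∂volume.restrict (openBall d R : Set (EuclideanSpace ℝ (Fin d))),
      m x = φ x ^ r := by
    filter_upwards [hm, hφ] with x hx hx'
    rw [hx', ← Real.rpow_mul hx, one_div_mul_cancel (by linarith), Real.rpow_one]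
  constructor
  · rintro ⟨u, hsol, hurad, hmrad⟩
    refine ⟨hsol.isRLaplaceSolution hR hν hh₀ hr hr'1 hrr' hφ hurad hmrad, ?_⟩
    obtain ⟨g, hg⟩ := hmrad
    refine ⟨fun s => g s ^ (1 / r), ?_⟩
    filter_upwards [hφ, hg] with x hx hx'
    rw [hx, hx']
  · rintro ⟨hsol, hrad⟩
    obtain ⟨u, hu, hurad⟩ :=
      hsol.exists_isMFGSolution hR hν hh₀ hr hr'1 hrr' hf.continuousOn hmφ hrad
    refine ⟨u, hu, hurad, ?_⟩
    obtain ⟨g, hg⟩ := hrad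
    refine ⟨fun s => g s ^ r, ?_⟩
    filter_upwards [hmφ, hg] with x hx hx'
    rw [hx, hx']
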